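/- Let $L>0$, $c\in\mathbb R$ and $\beta\in L^\infty(0,L)$ (real-valued); all other functions are complex-valued. Let $H^1_{(0)}(0,L)=\{g\in H^1(0,L): g(0)=0\}$ with norm $\|g'\|_{L^2}$, let $H^{-1}_{(0)}(0,L)$ be its dual with respect to the pivot space $L^2(0,L)$, and let $\mathcal H^0=L^2(0,L)\times H^1_{(0)}(0,L)\times L^2(0,L)$. Let $\mathcal A_0^*$ be the operator on $\mathcal H^0$ $$\mathcal A_0^*(f,g,h)=\bigl(f''+cf,\;P_\beta f-h,\;-g''\bigr),\qquad P_\beta f(x)=\int_0^x\!\int_\tau^L\beta(s)f(s)\,ds\,d\tau,$$ $$D(\mathcal A_0^*)=\{(f,g,h)\in H^2\times H^2\times H^1:\ f(0)=f(L)=g(0)=g'(L)=h(0)=0\}.$$ **(1) Admissibility inequality.** For every $T>0$ there is $K_T>0$ (depending only on $T,L,c,\beta$) such that $$\int_0^T|X^3(t,L)|^2\,dt\le K_T\Bigl(\|X^1(0)\|_{L^2}^2+\|X^3(0)\|_{L^2}^2+\|\partial_tX^3(0)\|_{H^{-1}_{(0)}}^2\Bigr)$$ (a) for every weak solution on $[0,T]$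 of $$\partial_tX^1=\partial_{xx}X^1+cX^1,\quad \partial_{tt}X^3=\partial_{xx}X^3+\beta X^1,\quad X^1(t,0)=X^1(t,L)=X^3(t,0)=\partial_xX^3(t,L)=0,$$ that is, $X^1\in C([0,T];L^2)$ and $X^3\in C([0,T];L^2)\cap C^1([0,T];H^{-1}_{(0)})$ satisfying the equations when tested against the functions of $H^2(0,L)$ that fulfil the same boundary conditions. Here the trace $X^3(\cdot,L)$ exists in $L^2(0,T)$ in the following sense: for every $t\in[0,T]$ one has $\int_0^tX^3(s)\,ds\in H^1(0,L)$, with value $\int_0^tX^3(s,L)\,ds$ at $x=L$; (b) for every strong solution $X=(X^1,X^2,X^3)\in C^1([0,T];\mathcal H^0)\cap C([0,T];D(\mathcal A_0^*))$ of the dual system $\dot X=\mathcal A_0^*X$; here $X^3(t,L)$ is the value at $L$ of $X^3(t)\in H^1(0,L)$ and is continuous in $t$. **(2) Well-posedness.** The control system $$\partial_ty=\partial_{xx}y+cy+\beta z,\quad \partial_{tt}z=\partial_{xx}z,\quad y(t,0)=y(t,L)=z(t,0)=0,\quad \partial_xz(t,L)=u(t),$$ written for $\mathcal X=(y,z,\partial_tz)$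 as $\dot{\mathcal X}=\mathcal A_0\mathcal X+\mathcal B_0u$ with $\mathcal B_0^*\phi=\phi_3(L)$, is well-posed in $\mathcal H^0$: for all $T>0$, $\mathcal X_0\in\mathcal H^0$ and $u\in L^2(0,T)$ it has exactly one solution $\mathcal X\in C([0,T];D(\mathcal A_0^*)')$ with $\mathcal X(0)=\mathcal X_0$, and $\mathcal X(t)\in\mathcal H^0$ for every $t\in[0,T]$. Here $D(\mathcal A_0^*)'$ is the dual of $D(\mathcal A_0^*)$ with respect to the pivot space $\mathcal H^0$, and a solution is defined by transposition: for all $\phi\in D((\mathcal A_0^*)^2)$ and $t\in[0,T]$, $$\langle\mathcal X(t),\phi\rangle=\langle\mathcal X_0,\phi\rangle+\int_0^t\Bigl(\langle\mathcal X(s),\mathcal A_0^*\phi\rangle+u(s)\,\overline{\phi_3(L)}\Bigr)ds .$$ -/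

import Mathlib

open MeasureTheory Set
open scoped ENNReal ComplexConjugate

noncomputable section

namespace Cascade

/-- Lebesgue measure on the interval `(0, L)`. -/
abbrev mu (L : ℝ) : Measure ℝ := volume.restrict (Ioo 0 L)

/-- The complex Hilbert space `L²(0, L)`. -/
abbrev L2 (L : ℝ) : Type := Lp ℂ 2 (mu L)

theorem intervalIntegrable_of_mu {L : ℝ} {E : Type*} [NormedAddCommGroup E]
    {f : ℝ → E} (hf : Integrable f (mu L)) {a b : ℝ} (ha : a ∈ Icc 0 L) (hb : b ∈ Icc 0 L) :
    IntervalIntegrable f volume a b := by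
  have h : IntegrableOn f (Icc 0 L) volume := by
    rw [integrableOn_Icc_iff_integrableOn_Ioo]; exact hf
  rw [intervalIntegrable_iff]
  exact h.mono_set (uIoc_subset_uIcc.trans (uIcc_subset_Icc ha hb))

theorem L2_integrable {L : ℝ} (f : L2 L) : Integrable f (mu L) :=
  (Lp.memLp f).integrable (by norm_num)

/-- A congruence between functions on `(0, L)` passes to their integrals over subintervals. -/
theorem intervalIntegral_congr_mu {L : ℝ} {f g : ℝ → ℂ} (h : f =ᵐ[mu L] g) {a b : ℝ}
    (ha : a ∈ Icc 0 L) (hb : b ∈ Icc 0 L) : ∫ s in a..b, f s = ∫ s in a..b, g s := by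
  apply intervalIntegral.integral_congr_ae
  have h2 : ∀ᵐ x ∂(volume.restrict (Icc 0 L)), f x = g x := by
    rw [← restrict_Ioo_eq_restrict_Icc]; exact h
  rw [ae_restrict_iff' measurableSet_Icc] at h2
  filter_upwards [h2] with x hx hx'
  exact hx (uIcc_subset_Icc ha hb (uIoc_subset_uIcc hx'))

/-! ### Sobolev functions on `(0, L)` -/

/-- `f`, taken as its continuous representative on `[0, L]`, lies in `H¹(0, L)` and
`f'` is its weak derivative: `f' ∈ L²(0, L)` and `f x = f 0 + ∫₀ˣ f'` on `[0, L]`. -/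
def IsH1 (L : ℝ) (f f' : ℝ → ℂ) : Prop :=
  MemLp f' 2 (mu L) ∧ ∀ x ∈ Icc 0 L, f x = f 0 + ∫ s in (0 : ℝ)..x, f' s

/-- `f ∈ H²(0, L)` with derivatives `f'` and `f''`. -/
def IsH2 (L : ℝ) (f f' f'' : ℝ → ℂ) : Prop :=
  IsH1 L f f' ∧ IsH1 L f' f''

theorem IsH1.zero (L : ℝ) : IsH1 L (fun _ => 0) (fun _ => 0) :=
  ⟨MemLp.zero, fun x _ => by simp⟩

theorem IsH1.add {L : ℝ} {f f' g g' : ℝ → ℂ} (hf : IsH1 L f f') (hg : IsH1 L g g') :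
    IsH1 L (fun x => f x + g x) (fun x => f' x + g' x) := by
  refine ⟨hf.1.add hg.1, fun x hx => ?_⟩
  have h0 : (0 : ℝ) ∈ Icc 0 L := ⟨le_rfl, hx.1.trans hx.2⟩
  rw [intervalIntegral.integral_add
    (intervalIntegrable_of_mu (hf.1.integrable (by norm_num)) h0 hx)
    (intervalIntegrable_of_mu (hg.1.integrable (by norm_num)) h0 hx)]
  simp only [hf.2 x hx, hg.2 x hx]
  ring

theorem IsH1.smul {L : ℝ} {f f' : ℝ → ℂ} (a : ℂ) (hf : IsH1 L f f') :
    IsH1 L (fun x => a * f x) (fun x => a * f' x) := by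
  refine ⟨hf.1.const_mul a, fun x hx => ?_⟩
  rw [intervalIntegral.integral_const_mul]
  simp only [hf.2 x hx]
  ring

/-- `h ∈ H¹(0, L)` and the value of (the continuous representative of) `h` at the end point `L`
is `v`. -/
def HasValueAtEnd (L : ℝ) (h : L2 L) (v : ℂ) : Prop :=
  ∃ f f' : ℝ → ℂ, IsH1 L f f' ∧ h =ᵐ[mu L] f ∧ f L = v

/-! ### The space `H¹₍₀₎(0, L)` and its dual -/

/-- The pairs `(g, g')` with `g ∈ H¹(0, L)`, `g(0) = 0` and weak derivative `g'`. -/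
def H10Sub (L : ℝ) : Submodule ℂ (L2 L × L2 L) where
  carrier := {p | ∀ᵐ x ∂(mu L), p.1 x = ∫ s in (0 : ℝ)..x, p.2 s}
  zero_mem' := by
    have h0 : ((0 : L2 L) : ℝ → ℂ) =ᵐ[mu L] fun _ => 0 := Lp.coeFn_zero ℂ 2 (mu L)
    filter_upwards [h0, ae_restrict_mem measurableSet_Ioo] with x hx hxm
    have h0m : (0 : ℝ) ∈ Icc 0 L := ⟨le_rfl, (hxm.1.trans hxm.2).le⟩
    change ((0 : L2 L) : ℝ → ℂ) x = ∫ s in (0 : ℝ)..x, ((0 : L2 L) : ℝ → ℂ) s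
    rw [hx, intervalIntegral_congr_mu h0 h0m (Ioo_subset_Icc_self hxm)]
    simp
  add_mem' := by
    intro p q hp hq
    filter_upwards [hp, hq, Lp.coeFn_add p.1 q.1, ae_restrict_mem measurableSet_Ioo]
      with x hpx hqx hx hxm
    have h0m : (0 : ℝ) ∈ Icc 0 L := ⟨le_rfl, (hxm.1.trans hxm.2).le⟩
    have hxI := Ioo_subset_Icc_self hxm
    change ((p.1 + q.1 : L2 L) : ℝ → ℂ) x = ∫ s in (0 : ℝ)..x, ((p.2 + q.2 : L2 L) : ℝ → ℂ) s
    rw [hx, intervalIntegral_congr_mu (Lp.coeFn_add p.2 q.2) h0m hxI]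
    simp only [Pi.add_apply]
    rw [intervalIntegral.integral_add (intervalIntegrable_of_mu (L2_integrable _) h0m hxI)
      (intervalIntegrable_of_mu (L2_integrable _) h0m hxI), hpx, hqx]
  smul_mem' := by
    intro a p hp
    filter_upwards [hp, Lp.coeFn_smul a p.1, ae_restrict_mem measurableSet_Ioo]
      with x hpx hx hxm
    have h0m : (0 : ℝ) ∈ Icc 0 L := ⟨le_rfl, (hxm.1.trans hxm.2).le⟩
    have hxI := Ioo_subset_Icc_self hxm
    change ((a • p.1 : L2 L) : ℝ → ℂ) x = ∫ s in (0 : ℝ)..x, ((a • p.2 : L2 L) : ℝ → ℂ) s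
    rw [hx, intervalIntegral_congr_mu (Lp.coeFn_smul a p.2) h0m hxI]
    simp only [Pi.smul_apply, smul_eq_mul]
    rw [intervalIntegral.integral_const_mul, hpx]

/-- `H¹₍₀₎(0, L) = {g ∈ H¹(0, L) | g(0) = 0}`; it carries the norm `‖g'‖` of `L²(0, L)`. -/
def H10 (L : ℝ) : Type := ↥(H10Sub L)

instance (L : ℝ) : AddCommGroup (H10 L) := inferInstanceAs (AddCommGroup ↥(H10Sub L))
instance (L : ℝ) : Module ℂ (H10 L) := inferInstanceAs (Module ℂ ↥(H10Sub L))

/-- The inclusion `g ↦ g` of `H¹₍₀₎(0, L)` in `L²(0, L)`. -/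
def H10.toL2 (L : ℝ) : H10 L →ₗ[ℂ] L2 L :=
  (LinearMap.fst ℂ (L2 L) (L2 L)).comp (H10Sub L).subtype

/-- The weak derivative `g ↦ g'` from `H¹₍₀₎(0, L)` to `L²(0, L)`. -/
def H10.deriv (L : ℝ) : H10 L →ₗ[ℂ] L2 L :=
  (LinearMap.snd ℂ (L2 L) (L2 L)).comp (H10Sub L).subtype

theorem H10.ae_eq {L : ℝ} (g : H10 L) :
    ∀ᵐ x ∂(mu L), H10.toL2 L g x = ∫ s in (0 : ℝ)..x, H10.deriv L g s := g.2

theorem H10.deriv_injective (L : ℝ) : Function.Injective (H10.deriv L) := by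
  intro p q h
  have h1 : H10.toL2 L p = H10.toL2 L q := by
    apply Lp.ext
    filter_upwards [p.ae_eq, q.ae_eq] with x hp hq
    rw [hp, hq, h]
  exact Subtype.ext (Prod.ext h1 h)

instance (L : ℝ) : NormedAddCommGroup (H10 L) :=
  NormedAddCommGroup.induced (H10 L) (L2 L) (H10.deriv L) (H10.deriv_injective L)

theorem H10.norm_def {L : ℝ} (g : H10 L) : ‖g‖ = ‖H10.deriv L g‖ := rfl

/-- The inner product `⟨g₁, g₂⟩ = ∫ g₁' g₂'` (with a complex conjugation) on `H¹₍₀₎(0, L)`. -/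
instance (L : ℝ) : InnerProductSpace ℂ (H10 L) where
  norm_smul_le a g := by
    rw [H10.norm_def, H10.norm_def, map_smul]; exact norm_smul_le _ _
  inner g₁ g₂ := inner ℂ (H10.deriv L g₁) (H10.deriv L g₂)
  norm_sq_eq_re_inner g := by
    rw [H10.norm_def]; exact norm_sq_eq_re_inner (𝕜 := ℂ) (H10.deriv L g)
  conj_inner_symm g₁ g₂ := inner_conj_symm _ _
  add_left g₁ g₂ g₃ := by rw [map_add]; exact inner_add_left _ _ _
  smul_left g₁ g₂ a := by rw [map_smul]; exact inner_smul_left _ _ _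

theorem L2_integral_norm_le {L : ℝ} (f : L2 L) :
    ∫ s in Ioo 0 L, ‖f s‖ ≤ ((mu L).real univ) ^ ((1 : ℝ) / 2) * ‖f‖ := by
  have h := eLpNorm_le_eLpNorm_mul_rpow_measure_univ (p := 1) (q := 2) (μ := mu L) (f := f)
    (by norm_num) (Lp.aestronglyMeasurable f)
  have h1 : ∫ s in Ioo 0 L, ‖f s‖ = (eLpNorm f 1 (mu L)).toReal := by
    rw [eLpNorm_one_eq_lintegral_enorm,
      integral_norm_eq_lintegral_enorm (Lp.aestronglyMeasurable f)]
  rw [h1, Lp.norm_def, mul_comm]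
  have hfin : eLpNorm f 2 (mu L) ≠ ∞ := Lp.eLpNorm_ne_top f
  have hm : (mu L) univ ^ ((1 : ℝ) / 2) ≠ ∞ :=
    ENNReal.rpow_ne_top_of_nonneg (by norm_num) (measure_ne_top _ _)
  have h' : eLpNorm f 1 (mu L) ≤ eLpNorm f 2 (mu L) * (mu L) univ ^ ((1 : ℝ) / 2) := by
    convert h using 3
    norm_num
  have := ENNReal.toReal_mono (ENNReal.mul_ne_top hfin hm) h'
  rw [ENNReal.toReal_mul, ← ENNReal.toReal_rpow] at this
  exact this

/-- The embedding of `H¹₍₀₎(0, L)` in `L²(0, L)` is bounded. -/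
theorem H10.norm_toL2_le {L : ℝ} (g : H10 L) : ‖H10.toL2 L g‖ ≤ (mu L).real univ * ‖g‖ := by
  have hb : ∀ᵐ x ∂(mu L), ‖H10.toL2 L g x‖ ≤
      ((mu L).real univ) ^ ((1 : ℝ) / 2) * ‖H10.deriv L g‖ := by
    filter_upwards [g.ae_eq, ae_restrict_mem measurableSet_Ioo] with x hx hxm
    rw [hx]
    refine le_trans ?_ (L2_integral_norm_le (H10.deriv L g))
    refine (intervalIntegral.norm_integral_le_integral_norm hxm.1.le).trans ?_
    rw [intervalIntegral.integral_of_le hxm.1.le]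
    refine setIntegral_mono_set (L2_integrable _).norm
      (Filter.Eventually.of_forall fun _ => norm_nonneg _) ?_
    exact Filter.Eventually.of_forall fun s hs => ⟨hs.1, hs.2.trans_lt hxm.2⟩
  have := Lp.norm_le_of_ae_bound (f := H10.toL2 L g) (by positivity) hb
  refine this.trans (le_of_eq ?_)
  rw [H10.norm_def, ← mul_assoc]
  congr 1
  change ((mu L).real univ) ^ (2 : ℝ≥0∞).toReal⁻¹ * _ = _
  rw [← Real.rpow_add_of_nonneg measureReal_nonneg (by norm_num) (by norm_num)]
  norm_num

/-- The inclusion of `H¹₍₀₎(0, L)` in `L²(0, L)` as a bounded operator. -/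
def H10.incl (L : ℝ) : H10 L →L[ℂ] L2 L :=
  (H10.toL2 L).mkContinuous ((mu L).real univ) H10.norm_toL2_le

/-- `H⁻¹₍₀₎(0, L)`: the dual of `H¹₍₀₎(0, L)` with respect to the pivot space `L²(0, L)`, i.e.
its bounded conjugate-linear functionals with the operator norm. -/
abbrev Hm1 (L : ℝ) : Type := H10 L →L⋆[ℂ] ℂ

/-- The embedding of the pivot space: `f ∈ L²(0, L)` is the functional `φ ↦ ∫ f conj(φ)`. -/
def pivot (L : ℝ) (f : L2 L) : Hm1 L :=
  (((innerSL ℂ : L2 L →L⋆[ℂ] L2 L →L[ℂ] ℂ).flip f).comp (H10.incl L))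

/-! ### The state space and the dual operator -/

/-- The Hilbert space `ℋ⁰ = L²(0, L) × H¹₍₀₎(0, L) × L²(0, L)`. -/
abbrev H0 (L : ℝ) : Type := WithLp 2 (L2 L × WithLp 2 (H10 L × L2 L))

/-- First component. -/
def H0.c1 {L : ℝ} (X : H0 L) : L2 L := X.fst
/-- Second component. -/
def H0.c2 {L : ℝ} (X : H0 L) : H10 L := X.snd.fst
/-- Third component. -/
def H0.c3 {L : ℝ} (X : H0 L) : L2 L := X.snd.snd

/-- `P_β f (x) = ∫₀ˣ ∫_τ^L β(s) f(s) ds dτ`. -/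
def Pβ (L : ℝ) (β : Lp ℝ ∞ (mu L)) (f : ℝ → ℂ) (x : ℝ) : ℂ :=
  ∫ τ in (0 : ℝ)..x, ∫ s in τ..L, (β s : ℂ) * f s

theorem integrable_beta_mul {L : ℝ} (β : Lp ℝ ∞ (mu L)) (f : L2 L) :
    Integrable (fun s => (β s : ℂ) * f s) (mu L) := by
  have hβ : MemLp (fun s => (β s : ℂ)) ∞ (mu L) := (Lp.memLp β).ofReal
  have h : MemLp (fun s => (β s : ℂ) * f s) 2 (mu L) := (Lp.memLp f).mul (r := 2) hβ
  exact h.integrable (by norm_num)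

theorem Pβ_congr {L : ℝ} (β : Lp ℝ ∞ (mu L)) {f g : ℝ → ℂ} (h : f =ᵐ[mu L] g) {x : ℝ}
    (hx : x ∈ Icc 0 L) : Pβ L β f x = Pβ L β g x := by
  refine intervalIntegral.integral_congr fun τ hτ => ?_
  rw [uIcc_of_le hx.1] at hτ
  refine intervalIntegral_congr_mu ?_ ⟨hτ.1, hτ.2.trans hx.2⟩ ⟨hx.1.trans hx.2, le_rfl⟩
  filter_upwards [h] with s hs
  rw [hs]

theorem Pβ_add {L : ℝ} (β : Lp ℝ ∞ (mu L)) (f g : L2 L) {x : ℝ} (hx : x ∈ Icc 0 L) :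
    Pβ L β (fun s => f s + g s) x = Pβ L β f x + Pβ L β g x := by
  have hL : L ∈ Icc 0 L := ⟨hx.1.trans hx.2, le_rfl⟩
  have hc : ∀ k : L2 L,
      IntervalIntegrable (fun τ => ∫ s in τ..L, (β s : ℂ) * k s) volume 0 x := by
    intro k
    have hi : IntegrableOn (fun s => (β s : ℂ) * k s) (uIcc 0 L) volume := by
      rw [uIcc_of_le hL.1, integrableOn_Icc_iff_integrableOn_Ioo]
      exact integrable_beta_mul β k
    have := intervalIntegral.continuousOn_primitive_interval_left hi
    refine (this.mono ?_).intervalIntegrable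
    exact uIcc_subset_uIcc left_mem_uIcc (by rw [uIcc_of_le hL.1]; exact hx)
  unfold Pβ
  rw [← intervalIntegral.integral_add (hc f) (hc g)]
  refine intervalIntegral.integral_congr fun τ hτ => ?_
  rw [uIcc_of_le hx.1] at hτ
  have hτ' : τ ∈ Icc 0 L := ⟨hτ.1, hτ.2.trans hx.2⟩
  beta_reduce
  rw [← intervalIntegral.integral_add
    (intervalIntegrable_of_mu (integrable_beta_mul β f) hτ' hL)
    (intervalIntegrable_of_mu (integrable_beta_mul β g) hτ' hL)]
  simp only [mul_add]

theorem Pβ_smul {L : ℝ} (β : Lp ℝ ∞ (mu L)) (a : ℂ) (f : ℝ → ℂ) (x : ℝ) :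
    Pβ L β (fun s => a * f s) x = a * Pβ L β f x := by
  unfold Pβ
  simp only [mul_left_comm _ a, intervalIntegral.integral_const_mul]

/-- `φ = (f, g, h)` lies in the domain of the dual operator `𝒜₀*` and `𝒜₀* φ = ψ`: here
`f, g ∈ H²(0, L)`, `h ∈ H¹(0, L)`, `f(0) = f(L) = g(0) = g'(L) = h(0) = 0`, and
`ψ = (f'' + c f, P_β f - h, -g'')`. -/
def AdjointRel (L c : ℝ) (β : Lp ℝ ∞ (mu L)) (φ ψ : H0 L) : Prop :=
  ∃ f f' f'' g g' g'' h h' : ℝ → ℂ,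
    IsH2 L f f' f'' ∧ IsH2 L g g' g'' ∧ IsH1 L h h' ∧
    f 0 = 0 ∧ f L = 0 ∧ g 0 = 0 ∧ g' L = 0 ∧ h 0 = 0 ∧
    φ.c1 =ᵐ[mu L] f ∧ H10.toL2 L φ.c2 =ᵐ[mu L] g ∧ φ.c3 =ᵐ[mu L] h ∧
    (ψ.c1 =ᵐ[mu L] fun x => f'' x + c * f x) ∧
    (H10.toL2 L ψ.c2 =ᵐ[mu L] fun x => Pβ L β φ.c1 x - h x) ∧
    (ψ.c3 =ᵐ[mu L] fun x => -g'' x)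

/-- The graph `{(φ, 𝒜₀* φ) | φ ∈ D(𝒜₀*)}` of the dual operator. With the norm of `ℋ⁰ × ℋ⁰`
it is the space `D(𝒜₀*)` with (a norm equivalent to) its graph norm. -/
def adjointGraph (L c : ℝ) (β : Lp ℝ ∞ (mu L)) : Submodule ℂ (H0 L × H0 L) where
  carrier := {p | AdjointRel L c β p.1 p.2}
  zero_mem' := by
    have h0 : ((0 : L2 L) : ℝ → ℂ) =ᵐ[mu L] fun _ => 0 := Lp.coeFn_zero ℂ 2 (mu L)
    refine ⟨fun _ => 0, fun _ => 0, fun _ => 0, fun _ => 0, fun _ => 0, fun _ => 0, fun _ => 0,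
      fun _ => 0, ⟨IsH1.zero L, IsH1.zero L⟩, ⟨IsH1.zero L, IsH1.zero L⟩, IsH1.zero L, rfl, rfl,
      rfl, rfl, rfl, h0, h0, h0, ?_, ?_, ?_⟩
    · filter_upwards [h0] with x hx
      exact hx.trans (by simp)
    · filter_upwards [h0, ae_restrict_mem measurableSet_Ioo] with x hx hxm
      change ((0 : L2 L) : ℝ → ℂ) x = Pβ L β (0 : L2 L) x - 0
      rw [hx, Pβ_congr β h0 (Ioo_subset_Icc_self hxm)]
      simp [Pβ]
    · filter_upwards [h0] with x hx
      exact hx.trans (by simp)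
  add_mem' := by
    rintro ⟨φ, ψ⟩ ⟨φ₁, ψ₁⟩
      ⟨f, f', f'', g, g', g'', h, h', hf, hg, hh, b1, b2, b3, b4, b5, e1, e2, e3, e4, e5, e6⟩
      ⟨k, k', k'', l, l', l'', m, m', hk, hl, hm, d1, d2, d3, d4, d5, i1, i2, i3, i4, i5, i6⟩
    refine ⟨fun x => f x + k x, fun x => f' x + k' x, fun x => f'' x + k'' x,
      fun x => g x + l x, fun x => g' x + l' x, fun x => g'' x + l'' x,
      fun x => h x + m x, fun x => h' x + m' x,
      ⟨hf.1.add hk.1, hf.2.add hk.2⟩, ⟨hg.1.add hl.1, hg.2.add hl.2⟩, hh.add hm,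
      by simp [b1, d1], by simp [b2, d2], by simp [b3, d3], by simp [b4, d4], by simp [b5, d5],
      ?_, ?_, ?_, ?_, ?_, ?_⟩
    · filter_upwards [Lp.coeFn_add φ.c1 φ₁.c1, e1, i1] with x hx h1 h2
      exact hx.trans (by rw [Pi.add_apply, h1, h2])
    · filter_upwards [Lp.coeFn_add (H10.toL2 L φ.c2) (H10.toL2 L φ₁.c2), e2, i2] with x hx h1 h2
      exact hx.trans (by rw [Pi.add_apply, h1, h2])
    · filter_upwards [Lp.coeFn_add φ.c3 φ₁.c3, e3, i3] with x hx h1 h2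
      exact hx.trans (by rw [Pi.add_apply, h1, h2])
    · filter_upwards [Lp.coeFn_add ψ.c1 ψ₁.c1, e4, i4] with x hx h1 h2
      exact hx.trans (by rw [Pi.add_apply, h1, h2]; ring)
    · filter_upwards [Lp.coeFn_add (H10.toL2 L ψ.c2) (H10.toL2 L ψ₁.c2), e5, i5,
        ae_restrict_mem measurableSet_Ioo] with x hx h1 h2 hxm
      have hP : Pβ L β (φ.c1 + φ₁.c1 : L2 L) x = Pβ L β φ.c1 x + Pβ L β φ₁.c1 x := by
        rw [Pβ_congr β (Lp.coeFn_add φ.c1 φ₁.c1) (Ioo_subset_Icc_self hxm)]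
        exact Pβ_add β _ _ (Ioo_subset_Icc_self hxm)
      refine hx.trans ?_
      change _ = Pβ L β (φ.c1 + φ₁.c1 : L2 L) x - _
      rw [hP, Pi.add_apply, h1, h2]
      ring
    · filter_upwards [Lp.coeFn_add ψ.c3 ψ₁.c3, e6, i6] with x hx h1 h2
      exact hx.trans (by rw [Pi.add_apply, h1, h2]; ring)
  smul_mem' := by
    rintro a ⟨φ, ψ⟩
      ⟨f, f', f'', g, g', g'', h, h', hf, hg, hh, b1, b2, b3, b4, b5, e1, e2, e3, e4, e5, e6⟩
    refine ⟨fun x => a * f x, fun x => a * f' x, fun x => a * f'' x,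
      fun x => a * g x, fun x => a * g' x, fun x => a * g'' x,
      fun x => a * h x, fun x => a * h' x,
      ⟨hf.1.smul a, hf.2.smul a⟩, ⟨hg.1.smul a, hg.2.smul a⟩, hh.smul a,
      by simp [b1], by simp [b2], by simp [b3], by simp [b4], by simp [b5],
      ?_, ?_, ?_, ?_, ?_, ?_⟩
    · filter_upwards [Lp.coeFn_smul a φ.c1, e1] with x hx h1
      exact hx.trans (by rw [Pi.smul_apply, h1, smul_eq_mul])
    · filter_upwards [Lp.coeFn_smul a (H10.toL2 L φ.c2), e2] with x hx h1
      exact hx.trans (by rw [Pi.smul_apply, h1, smul_eq_mul])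
    · filter_upwards [Lp.coeFn_smul a φ.c3, e3] with x hx h1
      exact hx.trans (by rw [Pi.smul_apply, h1, smul_eq_mul])
    · filter_upwards [Lp.coeFn_smul a ψ.c1, e4] with x hx h1
      exact hx.trans (by rw [Pi.smul_apply, h1, smul_eq_mul]; ring)
    · filter_upwards [Lp.coeFn_smul a (H10.toL2 L ψ.c2), e5,
        ae_restrict_mem measurableSet_Ioo] with x hx h1 hxm
      have hP : Pβ L β (a • φ.c1 : L2 L) x = a * Pβ L β φ.c1 x := by
        rw [Pβ_congr β (Lp.coeFn_smul a φ.c1) (Ioo_subset_Icc_self hxm)]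
        exact Pβ_smul β a _ x
      refine hx.trans ?_
      change _ = Pβ L β (a • φ.c1 : L2 L) x - _
      rw [hP, Pi.smul_apply, h1, smul_eq_mul]
      ring
    · filter_upwards [Lp.coeFn_smul a ψ.c3, e6] with x hx h1
      exact hx.trans (by rw [Pi.smul_apply, h1, smul_eq_mul]; ring)

/-! ### The dual system -/

/-- A strong solution on `[0, T]` of the dual system `X' = 𝒜₀* X`, of class
`C¹([0, T]; ℋ⁰) ∩ C([0, T]; D(𝒜₀*))`. -/
structure IsStrongDualSolution (L c : ℝ) (β : Lp ℝ ∞ (mu L)) (T : ℝ) (X X' : ℝ → H0 L) :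
    Prop where
  hasDeriv : ∀ t ∈ Icc 0 T, HasDerivWithinAt X (X' t) (Icc 0 T) t
  cont_deriv : ContinuousOn X' (Icc 0 T)
  eqn : ∀ t ∈ Icc 0 T, AdjointRel L c β (X t) (X' t)

/-- A weak solution on `[0, T]` of the dual system in second order form,
`∂ₜX¹ = ∂ₓₓX¹ + c X¹`, `∂ₜₜX³ = ∂ₓₓX³ + β X¹`,
`X¹(t,0) = X¹(t,L) = X³(t,0) = ∂ₓX³(t,L) = 0`.
Here `X¹ ∈ C([0, T]; L²)` and `X³ ∈ C([0, T]; L²) ∩ C¹([0, T]; H⁻¹₍₀₎)`, `V`, norm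
continuous, is the time derivative of `X³` in `H⁻¹₍₀₎`, and the equations with their boundary conditions are tested against the functions of
`H²(0, L)` that satisfy the same boundary conditions. -/
structure IsWeakDualSolution (L c : ℝ) (β : Lp ℝ ∞ (mu L)) (T : ℝ)
    (X1 X3 : ℝ → L2 L) (V : ℝ → Hm1 L) : Prop where
  cont1 : ContinuousOn X1 (Icc 0 T)
  cont3 : ContinuousOn X3 (Icc 0 T)
  contV : ContinuousOn V (Icc 0 T)
  velocity : ∀ φ : H10 L, ∀ t ∈ Icc 0 T,
    HasDerivWithinAt (fun s => pivot L (X3 s) φ) (V t φ) (Icc 0 T) t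
  heat : ∀ f f' f'' : ℝ → ℂ, IsH2 L f f' f'' → f 0 = 0 → f L = 0 → ∀ t ∈ Icc 0 T,
    HasDerivWithinAt (fun s => ∫ x in Ioo 0 L, X1 s x * conj (f x))
      (∫ x in Ioo 0 L, X1 t x * conj (f'' x + c * f x)) (Icc 0 T) t
  wave : ∀ (φ : H10 L) (f f' f'' : ℝ → ℂ), H10.toL2 L φ =ᵐ[mu L] f → IsH2 L f f' f'' →
    f 0 = 0 → f' L = 0 → ∀ t ∈ Icc 0 T,
    HasDerivWithinAt (fun s => V s φ)
      (∫ x in Ioo 0 L, (X3 t x * conj (f'' x) + (β x : ℂ) * X1 t x * conj (f x))) (Icc 0 T) t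

/-- `o` is the boundary trace `t ↦ X³(t, L)` on `(0, T)`, in the sense of distributions in time:
for each `t`, the function `∫₀ᵗ X³(s) ds` lies in `H¹(0, L)` and its value at `L` is `∫₀ᵗ o`. -/
def IsBoundaryTrace (L T : ℝ) (X3 : ℝ → L2 L) (o : ℝ → ℂ) : Prop :=
  ∀ t ∈ Icc 0 T, HasValueAtEnd L (∫ s in (0 : ℝ)..t, X3 s) (∫ s in (0 : ℝ)..t, o s)

/-! ### The control system -/

/-- The extrapolation space `D(𝒜₀*)'`: bounded conjugate-linear functionals on `D(𝒜₀*)`. -/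
abbrev Extrap (L c : ℝ) (β : Lp ℝ ∞ (mu L)) : Type := adjointGraph L c β →L⋆[ℂ] ℂ

/-- The embedding `ℋ⁰ ⊂ D(𝒜₀*)'`, `X ↦ (φ ↦ ⟨X, φ⟩)`. -/
def embed (L c : ℝ) (β : Lp ℝ ∞ (mu L)) (X : H0 L) : Extrap L c β :=
  ((innerSL ℂ : H0 L →L⋆[ℂ] H0 L →L[ℂ] ℂ).flip X).comp
    ((ContinuousLinearMap.fst ℂ (H0 L) (H0 L)).comp (adjointGraph L c β).subtypeL)

/-- A solution on `[0, T]`, continuous with values in `D(𝒜₀*)'`, of the control system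
`X' = 𝒜₀ X + ℬ₀ u`, `X(0) = X₀`, where `𝒜₀` is extended to `D(𝒜₀*)'` by transposition and
`ℬ₀* φ = φ₃(L)`: for all `φ ∈ D((𝒜₀*)²)`,
`⟨X(t), φ⟩ = ⟨X₀, φ⟩ + ∫₀ᵗ (⟨X(s), 𝒜₀* φ⟩ + u(s) conj(φ₃(L))) ds`.
Below `p = (φ, 𝒜₀* φ)` and `q = (𝒜₀* φ, (𝒜₀*)² φ)` are the points of the graph that represent the
elements `φ` and `𝒜₀* φ` of `D(𝒜₀*)`. -/
structure IsControlSolution (L c : ℝ) (β : Lp ℝ ∞ (mu L)) (T : ℝ) (X₀ : H0 L) (u : ℝ → ℂ)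
    (X : ℝ → Extrap L c β) : Prop where
  cont : ContinuousOn X (Icc 0 T)
  init : X 0 = embed L c β X₀
  eqn : ∀ p q : adjointGraph L c β, (q : H0 L × H0 L).1 = (p : H0 L × H0 L).2 →
    ∀ v : ℂ, HasValueAtEnd L (p : H0 L × H0 L).1.c3 v → ∀ t ∈ Icc 0 T,
      X t p = X 0 p + ∫ s in (0 : ℝ)..t, (X s q + u s * conj v)

/-- Well-posedness in `ℋ⁰` of the control system: for every `T > 0`, `X₀ ∈ ℋ⁰` and
`u ∈ L²(0, T)` there is a solution in `D(𝒜₀*)'`, it is unique, and it stays in `ℋ⁰`. -/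
def WellPosed (L c : ℝ) (β : Lp ℝ ∞ (mu L)) : Prop :=
  ∀ T : ℝ, 0 < T → ∀ (X₀ : H0 L) (u : ℝ → ℂ), MemLp u 2 (mu T) →
    (∃ X, IsControlSolution L c β T X₀ u X) ∧
    (∀ X Y, IsControlSolution L c β T X₀ u X → IsControlSolution L c β T X₀ u Y →
      EqOn X Y (Icc 0 T)) ∧
    (∀ X, IsControlSolution L c β T X₀ u X → ∀ t ∈ Icc 0 T, ∃ x : H0 L, X t = embed L c β x)

end Cascade

end

noncomputable section

namespace Cascade

/-! ### Integration by parts for primitives -/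

/-! Write V for integration from `0` (`volterra`) and V* for its adjoint, integration up to `L`.
Since `P_β f = V V*(β f)`, the relation `ψ = 𝒜₀* φ` with all its boundary conditions becomes a set
of identities between bounded operators on `L²` (`adjointRel_iff`). Two facts are read off from them
by integration by parts. First, `Re⟨φ, 𝒜₀* φ⟩ ≤ ω ‖φ‖²` (`AdjointRel.re_inner_le`): the heat part is
dissipative up to `c`, the wave part is skew, and the coupling is bounded. Second, with the
multiplier `x`, `L |φ₃(L)|²` equals terms bounded by `‖φ‖²` minus the time derivative of `2 Re⟨X³, x
∂ₓX²⟩` (`AdjointRel.multiplier`). Integration in time gives admissibility for strong solutions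
(`exists_admissible`). There `‖X²(0)‖` is at most the `H⁻¹₍₀₎` norm of `∂ₜX³(0)`, because `-∂ₓₓX² =
∂ₜX³`.

Semigroup theory is replaced by a complete system of eigenvectors (`exists_eigenvectors`): wave
vectors with vanishing first component, and one heat vector above each Dirichlet sine. Finite
combinations of `exp(lᵢ t) eᵢ` are strong solutions. Quasi-dissipativity makes the span of the `eᵢ`
dense even in the graph norm (`exists_traj_near`).

Existence for the control system: on finite combinations the solution is prescribed by Duhamel's
formula, admissibility bounds it by the norm of `ℋ⁰`, and the Riesz theorem yields a state in `ℋ⁰`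
(`exists_mild_solution`). Uniqueness: on an eigenvector the difference of two solutions satisfies a
homogeneous scalar equation, so it vanishes there and, by graph density, everywhere
(`eq_zero_of_transposed_equation`). Hence every solution is the constructed one and stays in `ℋ⁰`.

A weak solution becomes a curve in `ℋ⁰` by taking for `X²` the Riesz representative of `∂ₜX³`. Its
Fourier coefficients obey the same scalar equations as those of strong solutions, so it is a uniform
limit of finite trajectories (`IsSpectralSolution.norm_sub_le`). By admissibility their traces are
Cauchy in `L²(0,T)`, and the limit is the required trace
(`IsSpectralSolution.exists_boundaryTrace`). -/

theorem absolutelyContinuousOnInterval_primitive {f : ℝ → ℂ} {b : ℝ}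
    (hf : IntervalIntegrable f volume 0 b) :
    AbsolutelyContinuousOnInterval (fun x => ∫ s in (0 : ℝ)..x, f s) 0 b := by
  have hN := hf.norm.absolutelyContinuousOnInterval_intervalIntegral (c := 0) (by simp)
  -- Each increment of the complex primitive is at most that of the primitive of `‖f‖`, a real
  -- function known to be absolutely continuous.
  refine squeeze_zero' (.of_forall fun t => Finset.sum_nonneg fun i _ => dist_nonneg) ?_ hN
  have hmem : ∀ᶠ E : ℕ × (ℕ → ℝ × ℝ) in AbsolutelyContinuousOnInterval.totalLengthFilter ⊓
      Filter.principal (AbsolutelyContinuousOnInterval.disjWithin 0 b),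
      E ∈ AbsolutelyContinuousOnInterval.disjWithin 0 b :=
    Filter.eventually_inf_principal.2 (.of_forall fun _ h => h)
  filter_upwards [hmem] with E hE
  refine Finset.sum_le_sum fun i hi => ?_
  have hi' := hE.1 i hi
  have h0 : (0 : ℝ) ∈ uIcc 0 b := left_mem_uIcc
  have hint : ∀ {x y}, x ∈ uIcc 0 b → y ∈ uIcc 0 b → IntervalIntegrable f volume x y :=
    fun hx hy => hf.mono_set (uIcc_subset_uIcc hx hy)
  rw [dist_eq_norm, dist_eq_norm, intervalIntegral.integral_interval_sub_left
    (hint h0 hi'.1) (hint h0 hi'.2), intervalIntegral.integral_interval_sub_left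
    (hint h0 hi'.1).norm (hint h0 hi'.2).norm]
  exact intervalIntegral.norm_integral_le_abs_integral_norm

/-- As functions of the upper limit both sides are absolutely continuous with the same derivative
almost everywhere. Only integrability of the factors enters, so the formula serves for `L²`
functions; all later integrations by parts rest on it. -/
theorem primitive_mul_primitive {f g : ℝ → ℂ} {b : ℝ}
    (hf : IntervalIntegrable f volume 0 b) (hg : IntervalIntegrable g volume 0 b) :
    (∫ s in (0 : ℝ)..b, f s) * (∫ s in (0 : ℝ)..b, g s) =
      ∫ x in (0 : ℝ)..b, (f x * (∫ s in (0 : ℝ)..x, g s) + (∫ s in (0 : ℝ)..x, f s) * g x) := by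
  have hF := absolutelyContinuousOnInterval_primitive hf
  have hG := absolutelyContinuousOnInterval_primitive hg
  have hI : IntervalIntegrable (fun x => f x * (∫ s in (0 : ℝ)..x, g s) +
      (∫ s in (0 : ℝ)..x, f s) * g x) volume 0 b :=
    (hf.mul_continuousOn hG.continuousOn).add (hg.continuousOn_mul hF.continuousOn)
  have hH := (hF.smul hG).sub (absolutelyContinuousOnInterval_primitive hI)
  have hz : ∀ᵐ x, x ∈ uIcc 0 b → HasDerivAt
      ((fun x => (∫ s in (0 : ℝ)..x, f s) • (∫ s in (0 : ℝ)..x, g s)) -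
        fun x => ∫ x in (0 : ℝ)..x, (f x * (∫ s in (0 : ℝ)..x, g s) +
          (∫ s in (0 : ℝ)..x, f s) * g x)) 0 x := by
    filter_upwards [hf.ae_hasDerivAt_integral, hg.ae_hasDerivAt_integral,
      hI.ae_hasDerivAt_integral] with x h1 h2 h3 hx
    have := ((h1 hx 0 left_mem_uIcc).mul (h2 hx 0 left_mem_uIcc)).sub (h3 hx 0 left_mem_uIcc)
    convert! this using 1
    ring
  obtain ⟨C, hC⟩ := hH.const_of_ae_hasDerivAt_zero hz
  have h0 := hC 0 left_mem_uIcc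
  have h1 := hC b right_mem_uIcc
  simp only [Pi.sub_apply, intervalIntegral.integral_same, smul_eq_mul, mul_zero, sub_zero,
    Pi.mul_apply] at h0 h1
  rw [← h0] at h1
  linear_combination h1

/-- The variation of constants formula solves the scalar linear equation in integrated form. -/
theorem variation_of_constants {v : ℝ → ℂ} {T : ℝ} (hv : IntervalIntegrable v volume 0 T)
    (κ y₀ : ℂ) {t : ℝ} (ht : t ∈ uIcc 0 T) :
    Complex.exp (κ * t) * (y₀ + ∫ s in (0 : ℝ)..t, Complex.exp (-(κ * s)) * v s) =
      y₀ + ∫ s in (0 : ℝ)..t,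
        (κ * (Complex.exp (κ * s) * (y₀ + ∫ r in (0 : ℝ)..s, Complex.exp (-(κ * r)) * v r))
          + v s) := by
  set w : ℝ → ℂ := fun s => Complex.exp (-(κ * s)) * v s with hw
  have hvt : IntervalIntegrable v volume 0 t := hv.mono_set (uIcc_subset_uIcc left_mem_uIcc ht)
  have hwi : IntervalIntegrable w volume 0 t :=
    hvt.continuousOn_mul (by fun_prop)
  have hE : ∀ x : ℝ, ∫ s in (0 : ℝ)..x, κ * Complex.exp (κ * s) = Complex.exp (κ * x) - 1 := by
    intro x
    rw [intervalIntegral.integral_eq_sub_of_hasDerivAt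
      (f := fun s : ℝ => Complex.exp (κ * s))]
    · simp
    · intro s _
      have h1 : HasDerivAt (fun s : ℝ => κ * (s : ℂ)) κ s := by
        simpa using (Complex.ofRealCLM.hasDerivAt (x := s)).const_mul κ
      simpa [mul_comm] using h1.cexp
    · exact Continuous.intervalIntegrable (by fun_prop) _ _
  -- Integration by parts of the exponential against the primitive of `w`; the factor `exp(κ s)`
  -- then turns `w` back into `v`.
  have hP := primitive_mul_primitive (f := fun s : ℝ => κ * Complex.exp (κ * s))
    (Continuous.intervalIntegrable (by fun_prop) 0 t) hwi
  simp only [hE] at hP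
  have hWc : ContinuousOn (fun x => ∫ s in (0 : ℝ)..x, w s) (uIcc 0 t) :=
    (absolutelyContinuousOnInterval_primitive hwi).continuousOn
  have i1 : IntervalIntegrable (fun s : ℝ => κ * Complex.exp (κ * s) * ∫ r in (0 : ℝ)..s, w r)
      volume 0 t := ContinuousOn.intervalIntegrable (ContinuousOn.mul (by fun_prop) hWc)
  have i2 : IntervalIntegrable (fun s : ℝ => (Complex.exp (κ * s) - 1) * w s) volume 0 t :=
    hwi.continuousOn_mul (by fun_prop)
  have i3 : IntervalIntegrable (fun s : ℝ => κ * Complex.exp (κ * s) * y₀) volume 0 t :=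
    Continuous.intervalIntegrable (by fun_prop) _ _
  have hsplit : ∫ s in (0 : ℝ)..t, (κ * (Complex.exp (κ * s) *
      (y₀ + ∫ r in (0 : ℝ)..s, w r)) + v s) =
      (∫ s in (0 : ℝ)..t, ((κ * Complex.exp (κ * s) * ∫ r in (0 : ℝ)..s, w r) +
        (Complex.exp (κ * s) - 1) * w s)) + (∫ s in (0 : ℝ)..t, κ * Complex.exp (κ * s) * y₀) +
        ∫ s in (0 : ℝ)..t, w s := by
    rw [← intervalIntegral.integral_add (i1.add i2) i3,
      ← intervalIntegral.integral_add ((i1.add i2).add i3) hwi]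
    refine intervalIntegral.integral_congr fun s _ => ?_
    have : Complex.exp (κ * s) * w s = v s := by
      simp [hw, ← mul_assoc, ← Complex.exp_add]
    linear_combination -this
  rw [hsplit, ← hP, intervalIntegral.integral_mul_const, hE]
  ring

/-- A Gronwall estimate for the scalar equation `w' = κ w + F`. -/
theorem norm_le_of_scalar_ode {w F : ℝ → ℂ} {κ : ℂ} {T ε : ℝ} 
    (hw : ∀ t ∈ Icc 0 T, HasDerivWithinAt w (κ * w t + F t) (Icc 0 T) t)
    (hF : ∀ t ∈ Icc 0 T, ‖F t‖ ≤ ε) {t : ℝ} (ht : t ∈ Icc 0 T) :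
    ‖w t‖ ≤ Real.exp (‖κ‖ * T) * (‖w 0‖ + Real.exp (‖κ‖ * T) * ε * T) := by
  have hT : 0 ≤ T := ht.1.trans ht.2
  have h0 : (0 : ℝ) ∈ Icc 0 T := ⟨le_rfl, hT⟩
  have hε : 0 ≤ ε := (norm_nonneg _).trans (hF 0 h0)
  have hexp : ∀ s ∈ Icc (0 : ℝ) T, ∀ κ' : ℂ, ‖κ'‖ = ‖κ‖ →
      ‖Complex.exp (κ' * s)‖ ≤ Real.exp (‖κ‖ * T) := by
    intro s hs κ' hκ
    rw [Complex.norm_exp]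
    refine Real.exp_le_exp.2 ((Complex.re_le_norm _).trans ?_)
    rw [norm_mul, hκ, Complex.norm_real, Real.norm_of_nonneg hs.1]
    gcongr
    exact hs.2
  have hd : ∀ s ∈ Icc (0 : ℝ) T, HasDerivWithinAt (fun s : ℝ => Complex.exp (-κ * s) * w s)
      (Complex.exp (-κ * s) * F s) (Icc 0 T) s := by
    intro s hs
    have h1 : HasDerivAt (fun s : ℝ => -κ * (s : ℂ)) (-κ) s := by
      simpa using (Complex.ofRealCLM.hasDerivAt (x := s)).const_mul (-κ)
    convert! h1.cexp.hasDerivWithinAt.mul (hw s hs) using 1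
    ring
  have hb := (convex_Icc (0 : ℝ) T).norm_image_sub_le_of_norm_hasDerivWithin_le hd
    (C := Real.exp (‖κ‖ * T) * ε) (fun s hs => by
      rw [norm_mul]
      exact mul_le_mul (hexp s hs _ (norm_neg κ)) (hF s hs) (norm_nonneg _) (Real.exp_nonneg _))
    h0 ht
  simp only [Complex.ofReal_zero, mul_zero, Complex.exp_zero, one_mul, sub_zero,
    Real.norm_of_nonneg ht.1] at hb
  have hb2 : ‖Complex.exp (-κ * t) * w t‖ ≤ ‖w 0‖ + Real.exp (‖κ‖ * T) * ε * T := by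
    calc ‖Complex.exp (-κ * t) * w t‖
        = ‖w 0 + (Complex.exp (-κ * t) * w t - w 0)‖ := by congr 1; ring
      _ ≤ ‖w 0‖ + Real.exp (‖κ‖ * T) * ε * t := (norm_add_le _ _).trans (by gcongr)
      _ ≤ _ := by gcongr; exact ht.2
  calc ‖w t‖ = ‖Complex.exp (κ * t) * (Complex.exp (-κ * t) * w t)‖ := by
        rw [← mul_assoc, ← Complex.exp_add]; simp
    _ ≤ _ := by
        rw [norm_mul]
        exact mul_le_mul (hexp t ht κ rfl) hb2 (norm_nonneg _) (Real.exp_nonneg _)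

/-! ### Evolution by a quasi-dissipative graph with a complete system of eigenvectors -/

section Evolution

variable {H : Type*} [NormedAddCommGroup H] [InnerProductSpace ℂ H] {ι : Type*}

/-- Growth of the solutions of an evolution equation with quasi-dissipative right-hand side. -/
theorem norm_le_of_dissipative {ω T : ℝ} {X X' : ℝ → H}
    (hX : ∀ t ∈ Icc 0 T, HasDerivWithinAt X (X' t) (Icc 0 T) t)
    (hd : ∀ t ∈ Icc 0 T, (inner ℂ (X t) (X' t)).re ≤ ω * ‖X t‖ ^ 2) {t : ℝ} (ht : t ∈ Icc 0 T) :
    ‖X t‖ ≤ Real.exp (ω * t) * ‖X 0‖ := by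
  -- The weight `exp(-2ωs)` makes the energy nonincreasing.
  have hder : ∀ s ∈ Icc (0 : ℝ) T, HasDerivWithinAt (fun s => Real.exp (-(2 * ω * s)) * ‖X s‖ ^ 2)
      (Real.exp (-(2 * ω * s)) * (2 * (inner ℂ (X s) (X' s)).re - 2 * ω * ‖X s‖ ^ 2))
      (Icc 0 T) s := by
    intro s hs
    have h1 : HasDerivWithinAt (fun s => ‖X s‖ ^ 2) (2 * (inner ℂ (X s) (X' s)).re) (Icc 0 T) s := by
      have h2 := (Complex.reCLM.hasFDerivAt.comp_hasDerivWithinAt s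
        ((hX s hs).inner ℂ (hX s hs)))
      have h3 : (Complex.reCLM ∘ fun t => inner ℂ (X t) (X t)) = fun s => ‖X s‖ ^ 2 := by
        funext r
        have := inner_self_eq_norm_sq (𝕜 := ℂ) (X r)
        simpa using this
      rw [h3] at h2
      convert! h2 using 1
      have h4 : (inner ℂ (X' s) (X s)).re = (inner ℂ (X s) (X' s)).re := by
        rw [← inner_conj_symm, Complex.conj_re]
      simp only [Complex.reCLM_apply, Complex.add_re, h4]
      ring
    have h5 : HasDerivAt (fun s : ℝ => Real.exp (-(2 * ω * s)))
        (Real.exp (-(2 * ω * s)) * (-(2 * ω))) s := by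
      have : HasDerivAt (fun s : ℝ => -(2 * ω * s)) (-(2 * ω)) s := by
        simpa using ((hasDerivAt_id s).const_mul (2 * ω)).fun_neg
      exact this.exp
    convert! h5.hasDerivWithinAt.mul h1 using 1
    ring
  have hanti : AntitoneOn (fun s => Real.exp (-(2 * ω * s)) * ‖X s‖ ^ 2) (Icc 0 T) := by
    refine antitoneOn_of_deriv_nonpos (convex_Icc 0 T)
      (fun s hs => (hder s hs).continuousWithinAt)
      (fun s hs => ((hder s (interior_subset hs)).hasDerivAt
        (mem_interior_iff_mem_nhds.1 hs)).differentiableAt.differentiableWithinAt) ?_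
    intro s hs
    rw [((hder s (interior_subset hs)).hasDerivAt (mem_interior_iff_mem_nhds.1 hs)).deriv]
    refine mul_nonpos_of_nonneg_of_nonpos (Real.exp_nonneg _) ?_
    linarith [hd s (interior_subset hs)]
  have h := hanti ⟨le_rfl, ht.1.trans ht.2⟩ ht ht.1
  simp only [mul_zero, neg_zero, Real.exp_zero, one_mul] at h
  refine abs_le_of_sq_le_sq' ?_ (by positivity) |>.2
  rw [mul_pow, ← Real.exp_nat_mul]
  calc ‖X t‖ ^ 2 = Real.exp (2 * ω * t) * (Real.exp (-(2 * ω * t)) * ‖X t‖ ^ 2) := by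
        rw [← mul_assoc, ← Real.exp_add]; simp
    _ ≤ Real.exp (2 * ω * t) * ‖X 0‖ ^ 2 := by gcongr
    _ = _ := by congr 2; push_cast; ring

/-- The combination `∑ aᵢ exp(lᵢ t) eᵢ`. -/
def traj (e : ι → H) (l : ι → ℂ) (t : ℝ) : (ι →₀ ℂ) →ₗ[ℂ] H :=
  Finsupp.linearCombination ℂ fun i => Complex.exp (l i * t) • e i

theorem traj_zero (e : ι → H) (l : ι → ℂ) : traj e l 0 = Finsupp.linearCombination ℂ e := by
  simp [traj]

theorem traj_apply (e : ι → H) (l : ι → ℂ) (t : ℝ) (a : ι →₀ ℂ) :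
    traj e l t a = ∑ i ∈ a.support, a i • Complex.exp (l i * t) • e i := rfl

theorem hasDerivAt_traj (e : ι → H) (l : ι → ℂ) (a : ι →₀ ℂ) (t : ℝ) :
    HasDerivAt (fun t => traj e l t a) (traj (fun i => l i • e i) l t a) t := by
  simp only [traj_apply]
  refine HasDerivAt.fun_sum fun i _ => HasDerivAt.const_smul (a i) ?_
  have h1 : HasDerivAt (fun s : ℝ => l i * (s : ℂ)) (l i) t := by
    simpa using (Complex.ofRealCLM.hasDerivAt (x := t)).const_mul (l i)
  have := h1.cexp.smul_const (e i)
  rwa [mul_smul] at this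

theorem continuous_traj (e : ι → H) (l : ι → ℂ) (a : ι →₀ ℂ) :
    Continuous fun t => traj e l t a :=
  continuous_iff_continuousAt.2 fun t => (hasDerivAt_traj e l a t).continuousAt

theorem traj_prod (e : ι → H) (l : ι → ℂ) (t : ℝ) (a : ι →₀ ℂ) :
    (traj e l t a, traj (fun i => l i • e i) l t a) =
      ∑ i ∈ a.support, a i • Complex.exp (l i * t) • (e i, l i • e i) := by
  simp only [traj_apply, Prod.ext_iff, Prod.fst_sum, Prod.snd_sum, Prod.smul_mk]
  exact ⟨trivial, trivial⟩

theorem traj_mem {G : Submodule ℂ (H × H)} {e : ι → H} {l : ι → ℂ}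
    (he : ∀ i, (e i, l i • e i) ∈ G) (t : ℝ) (a : ι →₀ ℂ) :
    (traj e l t a, traj (fun i => l i • e i) l t a) ∈ G := by
  rw [traj_prod]
  exact Submodule.sum_mem _ fun i _ => G.smul_mem _ (G.smul_mem _ (he i))

/-- The growth bound does not depend on the number of eigenvectors or on their coefficients,
although the `eᵢ` need not be orthogonal. This is what lets statements pass from the span to its
closure. -/
theorem norm_traj_le {G : Submodule ℂ (H × H)} {e : ι → H} {l : ι → ℂ}
    (he : ∀ i, (e i, l i • e i) ∈ G) {ω : ℝ}
    (hG : ∀ p ∈ G, (inner ℂ p.1 p.2).re ≤ ω * ‖p.1‖ ^ 2) {t : ℝ} (ht : 0 ≤ t) (a : ι →₀ ℂ) :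
    ‖traj e l t a‖ ≤ Real.exp (ω * t) * ‖traj e l 0 a‖ :=
  norm_le_of_dissipative (T := t) (fun s _ => (hasDerivAt_traj e l a s).hasDerivWithinAt)
    (fun s _ => hG _ (traj_mem he s a)) ⟨ht, le_rfl⟩

/-- If a quasi-dissipative graph has a complete system of eigenvectors, their span is dense in
the graph norm. -/
theorem exists_traj_near {G : Submodule ℂ (H × H)} {e : ι → H} {l : ι → ℂ}
    (he : ∀ i, (e i, l i • e i) ∈ G) {ω : ℝ}
    (hG : ∀ p ∈ G, (inner ℂ p.1 p.2).re ≤ ω * ‖p.1‖ ^ 2)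
    (hdense : DenseRange (Finsupp.linearCombination ℂ e)) {p : H × H} (hp : p ∈ G) {ε : ℝ}
    (hε : 0 < ε) :
    ∃ a : ι →₀ ℂ, ‖p - (traj e l 0 a, traj (fun i => l i • e i) l 0 a)‖ < ε := by
  -- Since `μ ≥ ω + 1`, the operator `μ - A` is bounded below by `1` on the graph, so smallness of
  -- `μ q₁ - q₂` controls the graph norm of `q`.
  set μ : ℝ := |ω| + 1 with hμ
  have hμ1 : 1 ≤ μ := by rw [hμ]; linarith [abs_nonneg ω]
  have hμω : ω + 1 ≤ μ := by rw [hμ]; linarith [le_abs_self ω]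
  clear_value μ
  have hres : ∀ q ∈ G, ‖q.1‖ ≤ ‖(μ : ℂ) • q.1 - q.2‖ := by
    intro q hq
    rcases eq_or_ne q.1 0 with h0 | h0
    · rw [h0, norm_zero]; exact norm_nonneg _
    have h1 := hG q hq
    have h2 : (inner ℂ q.1 ((μ : ℂ) • q.1 - q.2)).re = μ * ‖q.1‖ ^ 2 - (inner ℂ q.1 q.2).re := by
      rw [inner_sub_right, inner_smul_right, Complex.sub_re, Complex.re_ofReal_mul]
      congr 2
      exact inner_self_eq_norm_sq (𝕜 := ℂ) q.1
    have h3 : (inner ℂ q.1 ((μ : ℂ) • q.1 - q.2)).re ≤ ‖q.1‖ * ‖(μ : ℂ) • q.1 - q.2‖ :=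
      (Complex.re_le_norm _).trans (norm_inner_le_norm _ _)
    have h4 : ‖q.1‖ * ‖q.1‖ ≤ ‖q.1‖ * ‖(μ : ℂ) • q.1 - q.2‖ := by nlinarith [sq_nonneg ‖q.1‖]
    exact le_of_mul_le_mul_left h4 (norm_pos_iff.2 h0)
  have hδ : 0 < ε / (μ + 1) / 2 := by positivity
  obtain ⟨b, hb⟩ := hdense.exists_dist_lt ((μ : ℂ) • p.1 - p.2) hδ
  rw [dist_eq_norm] at hb
  -- The resolvent acts diagonally on eigenvectors. If `μ = l i` the quotient is `0` by convention,
  -- which is harmless: the lower bound then forces `e i = 0`.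
  let a : ι →₀ ℂ := Finsupp.onFinset b.support (fun i => b i / (μ - l i)) (fun i hi => by
    rw [Finsupp.mem_support_iff]; rintro h; simp [h] at hi)
  have hkey : (μ : ℂ) • traj e l 0 a - traj (fun i => l i • e i) l 0 a =
      Finsupp.linearCombination ℂ e b := by
    rw [traj_zero, traj_zero, Finsupp.linearCombination_onFinset,
      Finsupp.linearCombination_onFinset, Finset.smul_sum, ← Finset.sum_sub_distrib,
      Finsupp.linearCombination_apply, Finsupp.sum]
    refine Finset.sum_congr rfl fun i _ => ?_
    rw [smul_smul, smul_smul, ← sub_smul]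
    rcases eq_or_ne (μ - l i : ℂ) 0 with h0 | h0
    · have h5 := hres _ (he i)
      rw [show (μ : ℂ) • (e i, l i • e i).1 - (e i, l i • e i).2 = (μ - l i : ℂ) • e i from
        (sub_smul _ _ _).symm, h0, zero_smul, norm_zero] at h5
      have h6 : e i = 0 := norm_le_zero_iff.1 h5
      rw [h6, smul_zero, smul_zero]
    · congr 1
      field_simp
  refine ⟨a, ?_⟩
  set q := p - (traj e l 0 a, traj (fun i => l i • e i) l 0 a) with hq
  have hqG : q ∈ G := G.sub_mem hp (traj_mem he 0 a)
  have h7 : (μ : ℂ) • q.1 - q.2 = ((μ : ℂ) • p.1 - p.2) - Finsupp.linearCombination ℂ e b := by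
    rw [← hkey, hq]; simp only [Prod.fst_sub, Prod.snd_sub, smul_sub]; abel
  have h8 : ‖q.1‖ ≤ ε / (μ + 1) / 2 := (hres q hqG).trans (by rw [h7]; exact hb.le)
  have h9 : ‖q.2‖ ≤ (μ + 1) * (ε / (μ + 1) / 2) := by
    have : q.2 = (μ : ℂ) • q.1 - ((μ : ℂ) • q.1 - q.2) := by abel
    rw [this]
    refine (norm_sub_le _ _).trans ?_
    rw [norm_smul, Complex.norm_real, Real.norm_of_nonneg (by linarith), h7, add_mul _ _ (ε / _ / 2), one_mul]
    exact add_le_add (mul_le_mul_of_nonneg_left h8 (zero_le_one.trans hμ1)) hb.le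
  have h10 : (μ + 1) * (ε / (μ + 1) / 2) = ε / 2 := by field_simp
  rw [Prod.norm_def]
  refine max_lt (h8.trans_lt ?_) (h9.trans_lt (by rw [h10]; linarith))
  rw [div_div]
  exact div_lt_self hε (by linarith)

end Evolution

/-! ### Existence and uniqueness for equations defined by transposition -/

theorem norm_integral_mul_le {u g : ℝ → ℂ} {t : ℝ} (ht : 0 ≤ t) (hu : MemLp u 2 (mu t))
    (hg : MemLp g 2 (mu t)) : ‖∫ s in (0 : ℝ)..t, u s * g s‖ ≤
      √(∫ s in (0 : ℝ)..t, ‖u s‖ ^ 2) * √(∫ s in (0 : ℝ)..t, ‖g s‖ ^ 2) := by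
  have h := integral_mul_norm_le_Lp_mul_Lq (μ := mu t) (f := u) (g := g) (p := 2) (q := 2)
    Real.HolderConjugate.two_two (by simpa using hu) (by simpa using hg)
  simp only [intervalIntegral.integral_of_le ht, integral_Ioc_eq_integral_Ioo,
    Real.sqrt_eq_rpow]
  refine (norm_integral_le_integral_norm _).trans ?_
  simp only [norm_mul]
  exact_mod_cast h

section Evolution

variable {H : Type*} [NormedAddCommGroup H] [InnerProductSpace ℂ H] {ι : Type*}

/-- Two forms of Duhamel's formula. The left one is a combination of solutions of scalar equations,
which is good for verifying the evolution equation; the right one contains only trajectories and can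
be estimated by admissibility. -/
theorem inner_traj_add_integral (e : ι → H) (l : ι → ℂ) (C : H × H →L[ℂ] ℂ) {T : ℝ} (X₀ : H)
    {v : ℝ → ℂ} (hv : IntervalIntegrable v volume 0 T) {t : ℝ} (ht : t ∈ uIcc 0 T) (a : ι →₀ ℂ) :
    Finsupp.linearCombination ℂ (fun i => Complex.exp (l i * t) * (inner ℂ X₀ (e i) +
      ∫ s in (0 : ℝ)..t, Complex.exp (-(l i * s)) * (v s * C (e i, l i • e i)))) a =
    inner ℂ X₀ (traj e l t a) +
      ∫ s in (0 : ℝ)..t, v s * C (traj e l (t - s) a, traj (fun i => l i • e i) l (t - s) a) := by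
  have hvt : IntervalIntegrable v volume 0 t := hv.mono_set (uIcc_subset_uIcc left_mem_uIcc ht)
  have h1 : ∀ s : ℝ, v s * C (traj e l (t - s) a, traj (fun i => l i • e i) l (t - s) a) =
      ∑ i ∈ a.support, a i * (Complex.exp (l i * t) *
        (Complex.exp (-(l i * s)) * (v s * C (e i, l i • e i)))) := by
    intro s
    rw [traj_prod, map_sum, Finset.mul_sum]
    refine Finset.sum_congr rfl fun i _ => ?_
    rw [map_smul, map_smul, Complex.ofReal_sub, mul_sub, sub_eq_add_neg, Complex.exp_add]
    simp only [smul_eq_mul]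
    ring
  simp only [h1]
  rw [intervalIntegral.integral_finsetSum, Finsupp.linearCombination_apply, Finsupp.sum,
    traj_apply, inner_sum, ← Finset.sum_add_distrib]
  · refine Finset.sum_congr rfl fun i _ => ?_
    rw [intervalIntegral.integral_const_mul, intervalIntegral.integral_const_mul, inner_smul_right,
      inner_smul_right, smul_eq_mul]
    ring
  · intro i _
    exact (((hvt.mul_const _).continuousOn_mul (by fun_prop)).const_mul _).const_mul _

/-- Existence of a mild solution of the control problem that is dual to a quasi-dissipative
graph with a complete system of eigenvectors and an admissible observation. -/
theorem exists_mild_solution [CompleteSpace H] {G : Submodule ℂ (H × H)} {e : ι → H} {l : ι → ℂ}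
    (he : ∀ i, (e i, l i • e i) ∈ G) {ω : ℝ}
    (hG : ∀ p ∈ G, (inner ℂ p.1 p.2).re ≤ ω * ‖p.1‖ ^ 2)
    (hdense : DenseRange (Finsupp.linearCombination ℂ e)) (C : H × H →L[ℂ] ℂ) {T K : ℝ}
    (hT : 0 < T) (hK : 0 ≤ K)
    (hadm : ∀ a, ∫ t in (0 : ℝ)..T, ‖C (traj e l t a, traj (fun i => l i • e i) l t a)‖ ^ 2 ≤
      K * ‖traj e l 0 a‖ ^ 2) (X₀ : H) {u : ℝ → ℂ} (hu : MemLp u 2 (mu T)) :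
    ∃ (x : ℝ → H) (M : ℝ), 0 ≤ M ∧ (∀ t ∈ Icc 0 T, ‖x t‖ ≤ M) ∧ x 0 = X₀ ∧
      (∀ η, ContinuousOn (fun t => inner ℂ (x t) η) (Icc 0 T)) ∧
      ∀ p ∈ G, ∀ t ∈ Icc 0 T, inner ℂ (x t) p.1 = inner ℂ X₀ p.1 +
        ∫ s in (0 : ℝ)..t, (inner ℂ (x s) p.2 + conj (u s) * C p) := by
  -- The unknown state occupies the conjugate-linear slot of the inner product, whence the conjugate
  -- of the control.
  set v : ℝ → ℂ := fun s => conj (u s) with hv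
  have hvL : MemLp v 2 (mu T) := hu.star
  have h0T : (0 : ℝ) ∈ Icc 0 T := ⟨le_rfl, hT.le⟩
  have hvi : IntervalIntegrable v volume 0 T :=
    intervalIntegrable_of_mu (hvL.integrable (by norm_num)) h0T ⟨hT.le, le_rfl⟩
  set y : ι → ℝ → ℂ := fun i t => Complex.exp (l i * t) * (inner ℂ X₀ (e i) +
      ∫ s in (0 : ℝ)..t, Complex.exp (-(l i * s)) * (v s * C (e i, l i • e i))) with hy
  set F : ℝ → (ι →₀ ℂ) →ₗ[ℂ] ℂ := fun t => Finsupp.linearCombination ℂ fun i => y i t with hF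
  set U : ℝ := √(∫ s in (0 : ℝ)..T, ‖v s‖ ^ 2) with hU
  -- The first summand comes from the growth of trajectories, the second from Cauchy–Schwarz and
  -- admissibility after the time reversal `s ↦ t - s`.
  set M : ℝ := Real.exp (|ω| * T) * ‖X₀‖ + U * √K with hM
  have hM0 : 0 ≤ M := by positivity
  have hbound : ∀ t ∈ Icc 0 T, ∀ a, ‖F t a‖ ≤ M * ‖Finsupp.linearCombination ℂ e a‖ := by
    intro t ht a
    rw [hF]
    beta_reduce
    rw [inner_traj_add_integral e l C X₀ hvi (by rwa [uIcc_of_le hT.le]), ← traj_zero e l, hM,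
      add_mul]
    refine (norm_add_le _ _).trans (add_le_add ?_ ?_)
    · refine (norm_inner_le_norm _ _).trans ?_
      rw [mul_comm (Real.exp _), mul_assoc]
      refine mul_le_mul_of_nonneg_left ?_ (norm_nonneg _)
      refine (norm_traj_le he hG ht.1 a).trans ?_
      gcongr
      · exact ht.1
      · exact le_abs_self ω
      · exact ht.2
    · have hcont : Continuous fun s => C (traj e l s a, traj (fun i => l i • e i) l s a) :=
        C.continuous.comp ((continuous_traj e l a).prodMk (continuous_traj _ l a))
      have hcont' : Continuous fun s =>
          C (traj e l (t - s) a, traj (fun i => l i • e i) l (t - s) a) :=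
        hcont.comp (continuous_const.sub continuous_id)
      have hsub : Ioo 0 t ⊆ Ioo 0 T := Ioo_subset_Ioo_right ht.2
      have hmem : MemLp (fun s => C (traj e l (t - s) a, traj (fun i => l i • e i) l (t - s) a))
          2 (mu t) := by
        obtain ⟨B, hB⟩ := (isCompact_Icc (a := (0 : ℝ)) (b := t)).exists_bound_of_continuousOn
          hcont'.continuousOn
        exact MemLp.of_bound hcont'.aestronglyMeasurable B
          ((ae_restrict_mem measurableSet_Ioo).mono fun s hs => hB s (Ioo_subset_Icc_self hs))
      refine (norm_integral_mul_le ht.1 (hvL.mono_measure (Measure.restrict_mono_set _ hsub))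
        hmem).trans ?_
      rw [mul_assoc]
      refine mul_le_mul ?_ ?_ (Real.sqrt_nonneg _) (Real.sqrt_nonneg _)
      · refine Real.sqrt_le_sqrt ?_
        simp only [intervalIntegral.integral_of_le ht.1, intervalIntegral.integral_of_le hT.le,
          integral_Ioc_eq_integral_Ioo]
        exact setIntegral_mono_set hvL.integrable_norm_pow'
          (.of_forall fun _ => by positivity) hsub.eventuallyLE
      · rw [← Real.sqrt_sq (norm_nonneg (traj e l 0 a)), ← Real.sqrt_mul hK]
        refine Real.sqrt_le_sqrt (le_trans ?_ (hadm a))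
        rw [intervalIntegral.integral_comp_sub_left
          (fun s => ‖C (traj e l s a, traj (fun i => l i • e i) l s a)‖ ^ 2) t, sub_self, sub_zero]
        refine intervalIntegral.integral_mono_interval le_rfl ht.1 ht.2
          (.of_forall fun _ => by positivity) ?_
        exact (hcont.norm.pow 2).intervalIntegrable _ _
  -- `F t` is bounded with respect to the norm of the combination, so it descends to the dense span
  -- and extends to `H`; `x t` represents the extension.
  set x : ℝ → H := fun t =>
    (InnerProductSpace.toDual ℂ H).symm ((F t).extendOfNorm (Finsupp.linearCombination ℂ e))
  have hxe : ∀ t ∈ Icc 0 T, ∀ a, inner ℂ (x t) (Finsupp.linearCombination ℂ e a) = F t a := by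
    intro t ht a
    rw [InnerProductSpace.toDual_symm_apply]
    exact LinearMap.extendOfNorm_eq hdense ⟨M, hbound t ht⟩ a
  have hxM : ∀ t ∈ Icc 0 T, ‖x t‖ ≤ M := by
    intro t ht
    rw [LinearIsometryEquiv.norm_map]
    exact ContinuousLinearMap.opNorm_le_bound _ hM0
      (LinearMap.norm_extendOfNorm_apply_le hdense M (hbound t ht))
  have hyeq : ∀ i, ∀ t ∈ Icc 0 T, y i t = inner ℂ X₀ (e i) +
      ∫ s in (0 : ℝ)..t, (l i * y i s + v s * C (e i, l i • e i)) := fun i t ht =>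
    variation_of_constants (hvi.mul_const _) (l i) _ (by rwa [uIcc_of_le hT.le])
  have hyc : ∀ i, ContinuousOn (y i) (Icc 0 T) := by
    intro i
    refine ContinuousOn.mul (by fun_prop) (continuousOn_const.add ?_)
    rw [← uIcc_of_le hT.le]
    exact (absolutelyContinuousOnInterval_primitive
      ((hvi.mul_const _).continuousOn_mul (by fun_prop))).continuousOn
  have hweak : ∀ η, ContinuousOn (fun t => inner ℂ (x t) η) (Icc 0 T) := by
    intro η
    -- Because `‖x t‖ ≤ M`, replacing `η` by a nearby finite combination causes an error uniform in
    -- `t`.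
    refine continuousOn_of_uniform_approx_of_continuousOn fun V hV => ?_
    obtain ⟨ε, hε, hεV⟩ := Metric.mem_uniformity_dist.1 hV
    obtain ⟨a, ha⟩ := hdense.exists_dist_lt η (show 0 < ε / (M + 1) by positivity)
    refine ⟨fun t => F t a, ?_, fun t ht => hεV ?_⟩
    · simp only [hF, Finsupp.linearCombination_apply, Finsupp.sum]
      exact continuousOn_finsetSum _ fun i _ => (hyc i).const_smul (a i)
    · beta_reduce
      rw [← hxe t ht, dist_eq_norm, ← inner_sub_right]
      rw [dist_eq_norm] at ha
      calc ‖inner ℂ (x t) (η - Finsupp.linearCombination ℂ e a)‖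
          ≤ ‖x t‖ * ‖η - Finsupp.linearCombination ℂ e a‖ := norm_inner_le_norm _ _
        _ ≤ M * ‖η - Finsupp.linearCombination ℂ e a‖ := by gcongr; exact hxM t ht
        _ ≤ (M + 1) * ‖η - Finsupp.linearCombination ℂ e a‖ := by gcongr; linarith
        _ < (M + 1) * (ε / (M + 1)) := by gcongr
        _ = ε := by field_simp
  have hx0 : x 0 = X₀ := by
    refine hdense.eq_of_inner_left (𝕜 := ℂ) fun a => ?_
    rw [hxe 0 h0T a]
    simp [hF, hy, Finsupp.linearCombination_apply, Finsupp.sum, inner_sum, inner_smul_right]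
  refine ⟨x, M, hM0, hxM, hx0, hweak, fun p hp t ht => ?_⟩
  have hsubt : uIcc 0 t ⊆ Icc 0 T := by
    rw [uIcc_of_le ht.1]; exact Icc_subset_Icc_right ht.2
  have hvt : IntervalIntegrable v volume 0 t := hvi.mono_set (by rwa [uIcc_of_le hT.le])
  have hIi : ∀ η, IntervalIntegrable (fun s => inner ℂ (x s) η) volume 0 t := fun η =>
    ((hweak η).mono hsubt).intervalIntegrable
  -- The defect of the equation at time `t`. It is linear, bounded in the graph norm and zero on
  -- eigenvectors, hence zero on `G` by graph density.
  let D : H × H →ₗ[ℂ] ℂ :=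
    { toFun := fun q => inner ℂ (x t) q.1 - inner ℂ X₀ q.1 -
        ∫ s in (0 : ℝ)..t, (inner ℂ (x s) q.2 + v s * C q)
      map_add' := fun q r => by
        have : ∀ s, inner ℂ (x s) (q + r).2 + v s * C (q + r) =
            (inner ℂ (x s) q.2 + v s * C q) + (inner ℂ (x s) r.2 + v s * C r) := fun s => by
          rw [Prod.snd_add, inner_add_right, map_add]; ring
        simp only [this]
        rw [intervalIntegral.integral_add ((hIi _).add (hvt.mul_const _))
          ((hIi _).add (hvt.mul_const _)), Prod.fst_add, inner_add_right, inner_add_right]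
        ring
      map_smul' := fun k q => by
        have : ∀ s, inner ℂ (x s) (k • q).2 + v s * C (k • q) =
            k * (inner ℂ (x s) q.2 + v s * C q) := fun s => by
          rw [Prod.smul_snd, inner_smul_right, map_smul, smul_eq_mul]; ring
        simp only [this]
        rw [intervalIntegral.integral_const_mul, Prod.smul_fst, inner_smul_right,
          inner_smul_right, RingHom.id_apply, smul_eq_mul]
        ring }
  have hDe : ∀ i, D (e i, l i • e i) = 0 := by
    intro i
    have h1 : ∀ s ∈ Icc 0 T, inner ℂ (x s) (e i) = y i s := by
      intro s hs
      have := hxe s hs (Finsupp.single i 1)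
      simpa [hF] using this
    change inner ℂ (x t) (e i) - inner ℂ X₀ (e i) - ∫ s in (0 : ℝ)..t,
      (inner ℂ (x s) (l i • e i) + v s * C (e i, l i • e i)) = 0
    have h2 : ∫ s in (0 : ℝ)..t, (inner ℂ (x s) (l i • e i) + v s * C (e i, l i • e i)) =
        ∫ s in (0 : ℝ)..t, (l i * y i s + v s * C (e i, l i • e i)) :=
      intervalIntegral.integral_congr fun s hs => by
        simp only [inner_smul_right, h1 s (hsubt hs)]
    rw [h1 t ht, hyeq i t ht, h2]
    ring
  have hDa : ∀ a, D (traj e l 0 a, traj (fun i => l i • e i) l 0 a) = 0 := by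
    intro a
    rw [traj_prod, map_sum]
    exact Finset.sum_eq_zero fun i _ => by rw [map_smul, map_smul, hDe, smul_zero, smul_zero]
  obtain ⟨B, hB⟩ : ∃ B, ∀ q, ‖D q‖ ≤ B * ‖q‖ := by
    refine ⟨M + ‖X₀‖ + (M * t + ‖C‖ * ∫ s in (0 : ℝ)..t, ‖v s‖), fun q => ?_⟩
    change ‖inner ℂ (x t) q.1 - inner ℂ X₀ q.1 - ∫ s in (0 : ℝ)..t,
      (inner ℂ (x s) q.2 + v s * C q)‖ ≤ _
    rw [intervalIntegral.integral_add (hIi _) (hvt.mul_const _),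
      intervalIntegral.integral_mul_const]
    have b1 : ‖inner ℂ (x t) q.1‖ ≤ M * ‖q‖ := (norm_inner_le_norm _ _).trans
      (mul_le_mul (hxM t ht) (norm_fst_le q) (norm_nonneg _) hM0)
    have b2 : ‖inner ℂ X₀ q.1‖ ≤ ‖X₀‖ * ‖q‖ := (norm_inner_le_norm _ _).trans
      (mul_le_mul le_rfl (norm_fst_le q) (norm_nonneg _) (norm_nonneg _))
    have b3 : ‖∫ s in (0 : ℝ)..t, inner ℂ (x s) q.2‖ ≤ M * ‖q‖ * |t - 0| :=
      intervalIntegral.norm_integral_le_of_norm_le_const fun s hs =>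
        (norm_inner_le_norm _ _).trans (mul_le_mul (hxM s (hsubt (uIoc_subset_uIcc hs)))
          (norm_snd_le q) (norm_nonneg _) hM0)
    rw [sub_zero, abs_of_nonneg ht.1] at b3
    have b4 : ‖(∫ s in (0 : ℝ)..t, v s) * C q‖ ≤ (∫ s in (0 : ℝ)..t, ‖v s‖) * (‖C‖ * ‖q‖) := by
      rw [norm_mul]
      exact mul_le_mul (intervalIntegral.norm_integral_le_integral_norm ht.1) (C.le_opNorm q)
        (norm_nonneg _) (intervalIntegral.integral_nonneg ht.1 fun _ _ => norm_nonneg _)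
    refine (norm_sub_le _ _).trans ((add_le_add (norm_sub_le _ _) (norm_add_le _ _)).trans ?_)
    linarith
  have hDp : D p = 0 := by
    refine norm_le_zero_iff.1 (le_of_forall_pos_le_add fun ε hε => ?_)
    rw [zero_add]
    obtain ⟨a, ha⟩ := exists_traj_near he hG hdense hp (show 0 < ε / (|B| + 1) by positivity)
    have : D p = D (p - (traj e l 0 a, traj (fun i => l i • e i) l 0 a)) := by
      rw [map_sub, hDa, sub_zero]
    rw [this]
    calc _ ≤ B * ‖p - (traj e l 0 a, traj (fun i => l i • e i) l 0 a)‖ := hB _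
      _ ≤ (|B| + 1) * ‖p - (traj e l 0 a, traj (fun i => l i • e i) l 0 a)‖ := by
        gcongr; linarith [le_abs_self B]
      _ ≤ (|B| + 1) * (ε / (|B| + 1)) := by gcongr
      _ = ε := by field_simp
  have : inner ℂ (x t) p.1 - inner ℂ X₀ p.1 - ∫ s in (0 : ℝ)..t,
      (inner ℂ (x s) p.2 + v s * C p) = 0 := hDp
  linear_combination this

/-- A continuous family of functionals on a graph with a complete system of eigenvectors
vanishes if it solves the homogeneous transposed equation with zero initial value. -/
theorem eq_zero_of_transposed_equation {G : Submodule ℂ (H × H)} {e : ι → H} {l : ι → ℂ}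
    (he : ∀ i, (e i, l i • e i) ∈ G) {ω : ℝ}
    (hG : ∀ p ∈ G, (inner ℂ p.1 p.2).re ≤ ω * ‖p.1‖ ^ 2)
    (hdense : DenseRange (Finsupp.linearCombination ℂ e)) {T : ℝ} {Z : ℝ → G →L⋆[ℂ] ℂ}
    (hZ : ContinuousOn Z (Icc 0 T))
    (hZeq : ∀ p q : G, (q : H × H).1 = (p : H × H).2 → ∀ t ∈ Icc 0 T,
      Z t p = ∫ s in (0 : ℝ)..t, Z s q) {t : ℝ} (ht : t ∈ Icc 0 T) : Z t = 0 := by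
  have hT : 0 ≤ T := ht.1.trans ht.2
  have hzero : ∀ i, Z t ⟨_, he i⟩ = 0 := by
    intro i
    set p : G := ⟨_, he i⟩
    set w : ℝ → ℂ := fun s => Z s p with hw
    have hwc : ContinuousOn w (Icc 0 T) := (continuous_eval_const p).comp_continuousOn hZ
    have hweq : ∀ s ∈ Icc 0 T, w s = ∫ r in (0 : ℝ)..s, conj (l i) * w r := by
      intro s hs
      -- An eigenvector lies in the domain of the square, so it is an admissible test.
      -- Conjugate-linearity of `Z` turns the eigenvalue into its conjugate.
      have := hZeq p (l i • p) rfl s hs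
      simpa only [map_smulₛₗ, smul_eq_mul] using this
    have hd : ∀ s ∈ Icc 0 T, HasDerivWithinAt w (conj (l i) * w s + (fun _ => 0) s)
        (Icc 0 T) s := by
      intro s hs
      have hcw : ContinuousOn (fun r => conj (l i) * w r) (Icc 0 T) := continuousOn_const.mul hwc
      have : Fact (s ∈ Icc 0 T) := ⟨hs⟩
      have h1 := intervalIntegral.integral_hasDerivWithinAt_right (s := Icc 0 T) (t := Icc 0 T)
        (hcw.mono (by rw [uIcc_of_le hs.1]; exact Icc_subset_Icc_right hs.2)).intervalIntegrable
        (hcw.stronglyMeasurableAtFilter_nhdsWithin measurableSet_Icc s) (hcw s hs)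
      simpa using h1.congr hweq (hweq s hs)
    have h0 : w 0 = 0 := by simpa using hweq 0 ⟨le_rfl, hT⟩
    have := norm_le_of_scalar_ode hd (ε := 0) (fun _ _ => by simp) ht
    simpa [h0] using this
  ext p
  refine norm_le_zero_iff.1 (le_of_forall_pos_le_add fun ε hε => ?_)
  rw [zero_add]
  -- `Z t` is continuous only for the graph norm, so density of the span in `H` alone would not
  -- suffice.
  obtain ⟨a, ha⟩ := exists_traj_near he hG hdense p.2 (show 0 < ε / (‖Z t‖ + 1) by positivity)
  set q : G := ⟨_, traj_mem he 0 a⟩ with hq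
  have hqsum : q = ∑ i ∈ a.support, a i • (⟨_, he i⟩ : G) := by
    apply Subtype.ext
    rw [hq, AddSubmonoidClass.coe_finsetSum]
    simp [traj_prod]
  have hZq : Z t q = 0 := by
    rw [hqsum, map_sum]
    exact Finset.sum_eq_zero fun i _ => by rw [map_smulₛₗ, hzero, smul_zero]
  have hn : ‖p - q‖ ≤ ε / (‖Z t‖ + 1) := ha.le
  calc ‖Z t p‖ = ‖Z t (p - q)‖ := by rw [map_sub, hZq, sub_zero]
    _ ≤ ‖Z t‖ * ‖p - q‖ := (Z t).le_opNorm _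
    _ ≤ (‖Z t‖ + 1) * (ε / (‖Z t‖ + 1)) := by gcongr; linarith
    _ = ε := by field_simp

end Evolution

variable {L : ℝ}

/-! ### Integration operators on `L²(0, L)` -/

theorem L2_integral_eq (hL : 0 ≤ L) (f : ℝ → ℂ) :
    ∫ x, f x ∂(mu L) = ∫ x in (0 : ℝ)..L, f x := by
  rw [intervalIntegral.integral_of_le hL, integral_Ioc_eq_integral_Ioo]

theorem L2_inner_eq (f g : L2 L) : inner ℂ f g = ∫ x, conj (f x) * g x ∂(mu L) := by
  rw [L2.inner_def]
  simp only [RCLike.inner_apply, mul_comm]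

/-- The primitive of `k` that vanishes at `0`. -/
def primitive (k : ℝ → ℂ) (x : ℝ) : ℂ := ∫ s in (0 : ℝ)..x, k s

theorem primitive_zero (k : ℝ → ℂ) : primitive k 0 = 0 := intervalIntegral.integral_same

theorem intervalIntegrable_of_memLp (hL : 0 ≤ L) {k : ℝ → ℂ} (hk : MemLp k 2 (mu L)) :
    IntervalIntegrable k volume 0 L :=
  intervalIntegrable_of_mu (hk.integrable (by norm_num)) ⟨le_rfl, hL⟩ ⟨hL, le_rfl⟩

theorem continuousOn_primitive (hL : 0 ≤ L) {k : ℝ → ℂ} (hk : MemLp k 2 (mu L)) :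
    ContinuousOn (primitive k) (Icc 0 L) := by
  rw [← uIcc_of_le hL]
  exact (absolutelyContinuousOnInterval_primitive (intervalIntegrable_of_memLp hL hk)).continuousOn

theorem memLp_of_continuousOn {f : ℝ → ℂ} (hf : ContinuousOn f (Icc 0 L)) (p : ℝ≥0∞) :
    MemLp f p (mu L) := by
  obtain ⟨B, hB⟩ := (isCompact_Icc (a := (0 : ℝ)) (b := L)).exists_bound_of_continuousOn hf
  exact MemLp.of_bound ((hf.mono Ioo_subset_Icc_self).aestronglyMeasurable measurableSet_Ioo) B
    ((ae_restrict_mem measurableSet_Ioo).mono fun x hx => hB x (Ioo_subset_Icc_self hx))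

theorem memLp_primitive (hL : 0 ≤ L) (k : L2 L) : MemLp (primitive k) 2 (mu L) :=
  memLp_of_continuousOn (continuousOn_primitive hL (Lp.memLp k)) 2

theorem primitive_congr {k l : ℝ → ℂ} (h : k =ᵐ[mu L] l) {x : ℝ} (hx : x ∈ Icc 0 L) :
    primitive k x = primitive l x :=
  intervalIntegral_congr_mu h ⟨le_rfl, hx.1.trans hx.2⟩ hx

theorem isH1_primitive {k : ℝ → ℂ} (hk : MemLp k 2 (mu L)) : IsH1 L (primitive k) k :=
  ⟨hk, fun x _ => by rw [primitive_zero, zero_add]; rfl⟩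

theorem IsH1.continuousOn (hL : 0 ≤ L) {f f' : ℝ → ℂ} (h : IsH1 L f f') :
    ContinuousOn f (Icc 0 L) :=
  (continuousOn_const.add (continuousOn_primitive hL h.1)).congr h.2

theorem eqOn_of_ae_eq (hL : 0 < L) {f g : ℝ → ℂ} (hf : ContinuousOn f (Icc 0 L))
    (hg : ContinuousOn g (Icc 0 L)) (h : f =ᵐ[mu L] g) : EqOn f g (Icc 0 L) :=
  Measure.eqOn_Icc_of_ae_eq volume hL.ne (by
    rw [← restrict_Ioo_eq_restrict_Icc]; exact h) hf hg

theorem HasValueAtEnd.unique (hL : 0 < L) {h : L2 L} {v w : ℂ} (hv : HasValueAtEnd L h v)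
    (hw : HasValueAtEnd L h w) : v = w := by
  obtain ⟨f, f', hf, e, rfl⟩ := hv
  obtain ⟨g, g', hg, e', rfl⟩ := hw
  exact eqOn_of_ae_eq hL (hf.continuousOn hL.le) (hg.continuousOn hL.le) (e.symm.trans e')
    ⟨hL.le, le_rfl⟩

/-- The constant function `1`. -/
def one (L : ℝ) : L2 L := MemLp.toLp (fun _ => 1) (memLp_const 1)

theorem one_ae (L : ℝ) : one L =ᵐ[mu L] fun _ => 1 := MemLp.coeFn_toLp _

theorem inner_one (hL : 0 ≤ L) (k : L2 L) : inner ℂ (one L) k = primitive k L := by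
  rw [L2_inner_eq, primitive, ← L2_integral_eq hL]
  refine integral_congr_ae ?_
  filter_upwards [one_ae L] with x hx
  rw [hx, map_one, one_mul]

/-- The element of `H¹₍₀₎(0, L)` with a given derivative. -/
def H10.prim (hL : 0 ≤ L) (k : L2 L) : H10 L :=
  ⟨((memLp_primitive hL k).toLp (primitive k), k),
    MemLp.coeFn_toLp (memLp_primitive hL k)⟩

theorem H10.deriv_prim (hL : 0 ≤ L) (k : L2 L) : H10.deriv L (H10.prim hL k) = k := rfl

theorem H10.prim_deriv (hL : 0 ≤ L) (g : H10 L) : H10.prim hL (H10.deriv L g) = g :=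
  H10.deriv_injective L rfl

/-- Differentiation is an isometry of `H¹₍₀₎(0, L)` onto `L²(0, L)`. -/
def H10.derivEquiv (hL : 0 ≤ L) : H10 L ≃ₗᵢ[ℂ] L2 L where
  toLinearEquiv := { H10.deriv L with
    invFun := H10.prim hL
    left_inv := H10.prim_deriv hL
    right_inv := H10.deriv_prim hL }
  norm_map' _ := rfl

theorem H10.inner_eq (g₁ g₂ : H10 L) :
    inner ℂ g₁ g₂ = inner ℂ (H10.deriv L g₁) (H10.deriv L g₂) := rfl

theorem H10.completeSpace (hL : 0 ≤ L) : CompleteSpace (H10 L) :=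
  (H10.derivEquiv hL).toIsometryEquiv.completeSpace_iff.2 inferInstance

/-- The integration operator `k ↦ ∫₀ˣ k` on `L²(0, L)`. -/
def volterra (hL : 0 ≤ L) : L2 L →L[ℂ] L2 L :=
  (H10.incl L).comp (H10.derivEquiv hL).symm.toContinuousLinearEquiv.toContinuousLinearMap

theorem volterra_ae (hL : 0 ≤ L) (k : L2 L) : volterra hL k =ᵐ[mu L] primitive k :=
  (H10.prim hL k).ae_eq

theorem H10.toL2_eq (hL : 0 ≤ L) (g : H10 L) :
    H10.toL2 L g = volterra hL (H10.deriv L g) := by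
  conv_lhs => rw [← H10.prim_deriv hL g]
  rfl

/-- The end value of a primitive is the pairing of its derivative with `1`, so boundary traces
become bounded functionals of the derivative. -/
theorem hasValueAtEnd_volterra (hL : 0 ≤ L) (k : L2 L) :
    HasValueAtEnd L (volterra hL k) (inner ℂ (one L) k) :=
  ⟨_, _, isH1_primitive (Lp.memLp k), volterra_ae hL k, (inner_one hL k).symm⟩

/-- A vanishing primitive is zero pointwise by continuity, and Lebesgue differentiation recovers the
integrand. -/
theorem volterra_injective (hL : 0 < L) : Function.Injective (volterra hL.le) := by
  rw [injective_iff_map_eq_zero]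
  intro k hk
  have h1 : EqOn (primitive k) (fun _ => 0) (Icc 0 L) := by
    refine eqOn_of_ae_eq hL (continuousOn_primitive hL.le (Lp.memLp k)) continuousOn_const ?_
    refine (volterra_ae hL.le k).symm.trans ?_
    rw [hk]
    exact Lp.coeFn_zero ..
  apply Lp.ext
  refine Filter.EventuallyEq.trans ?_ (Lp.coeFn_zero ..).symm
  have h2 := (intervalIntegrable_of_memLp hL.le (Lp.memLp k)).ae_hasDerivAt_integral
  change ∀ᵐ x ∂(volume.restrict (Ioo 0 L)), _
  rw [ae_restrict_iff' measurableSet_Ioo]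
  filter_upwards [h2] with x hx hxm
  have h3 := hx (by rw [uIcc_of_le hL.le]; exact Ioo_subset_Icc_self hxm) 0 left_mem_uIcc
  refine h3.unique ((hasDerivAt_const x (0 : ℂ)).congr_of_eventuallyEq ?_)
  filter_upwards [Ioo_mem_nhds hxm.1 hxm.2] with y hy
  exact h1 (Ioo_subset_Icc_self hy)

theorem IsH1.eq_volterra (hL : 0 ≤ L) {f f' : ℝ → ℂ} (h : IsH1 L f f') (h0 : f 0 = 0) {p : L2 L}
    (hp : p =ᵐ[mu L] f) : p = volterra hL (h.1.toLp f') := by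
  apply Lp.ext
  filter_upwards [hp, volterra_ae hL (h.1.toLp f'), ae_restrict_mem measurableSet_Ioo]
    with x h1 h2 hx
  have hx' := Ioo_subset_Icc_self hx
  have h3 := h.2 x hx'
  rw [h0, zero_add] at h3
  rw [h1, h2, primitive_congr (MemLp.coeFn_toLp h.1) hx', h3]
  rfl

theorem IsH1.end_value (hL : 0 ≤ L) {f f' : ℝ → ℂ} (h : IsH1 L f f') (h0 : f 0 = 0) :
    f L = inner ℂ (one L) (h.1.toLp f') := by
  have hLm : L ∈ Icc 0 L := ⟨hL, le_rfl⟩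
  have h3 := h.2 L hLm
  rw [h0, zero_add] at h3
  rw [inner_one hL, primitive_congr (MemLp.coeFn_toLp h.1) hLm, h3]
  rfl

/-- The adjoint `k ↦ ∫ₓᴸ k` of the integration operator. -/
def volterraAdj (hL : 0 ≤ L) : L2 L →L[ℂ] L2 L := ContinuousLinearMap.adjoint (volterra hL)

theorem inner_volterra_left (hL : 0 ≤ L) (f g : L2 L) :
    inner ℂ (volterra hL f) g = inner ℂ f (volterraAdj hL g) :=
  (ContinuousLinearMap.adjoint_inner_right _ _ _).symm

theorem inner_volterra_right (hL : 0 ≤ L) (f g : L2 L) :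
    inner ℂ f (volterra hL g) = inner ℂ (volterraAdj hL f) g :=
  (ContinuousLinearMap.adjoint_inner_left _ _ _).symm

/-- Integration by parts: `∫₀ˣ k + ∫ₓᴸ k = ∫₀ᴸ k`. -/
theorem volterraAdj_eq (hL : 0 ≤ L) (k : L2 L) :
    volterraAdj hL k = (inner ℂ (one L) k : ℂ) • one L - volterra hL k := by
  refine ext_inner_left ℂ fun g => ?_
  have hLm : L ∈ Icc 0 L := ⟨hL, le_rfl⟩
  rw [← inner_volterra_left, inner_sub_right, inner_smul_right, eq_sub_iff_add_eq, L2_inner_eq,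
    L2_inner_eq, ← integral_add, ← inner_conj_symm g, inner_one hL, inner_one hL]
  · have hg : IntervalIntegrable (fun x => conj (g x)) volume 0 L :=
      intervalIntegrable_of_memLp hL (Lp.memLp g).star
    have hk := intervalIntegrable_of_memLp hL (Lp.memLp k)
    have hconj : ∀ x, conj (primitive g x) = ∫ s in (0 : ℝ)..x, conj (g s) := by
      intro x
      rw [primitive, intervalIntegral, intervalIntegral, map_sub, ← integral_conj,
        ← integral_conj]
    have h := primitive_mul_primitive hg hk
    rw [hconj, mul_comm]
    refine Eq.trans ?_ h.symm
    rw [← L2_integral_eq hL]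
    refine integral_congr_ae ?_
    filter_upwards [volterra_ae hL g, volterra_ae hL k] with x h1 h2
    rw [h1, h2, hconj, primitive, add_comm]
  · simpa [mul_comm] using L2.integrable_inner (𝕜 := ℂ) (volterra hL g) k
  · simpa [mul_comm] using L2.integrable_inner (𝕜 := ℂ) g (volterra hL k)

theorem volterraAdj_ae (hL : 0 ≤ L) (k : L2 L) :
    volterraAdj hL k =ᵐ[mu L] fun x => ∫ s in x..L, k s := by
  rw [volterraAdj_eq]
  filter_upwards [Lp.coeFn_sub ((inner ℂ (one L) k : ℂ) • one L) (volterra hL k),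
    Lp.coeFn_smul (inner ℂ (one L) k : ℂ) (one L), one_ae L, volterra_ae hL k,
    ae_restrict_mem measurableSet_Ioo] with x h1 h2 h3 h4 hx
  have h0m : (0 : ℝ) ∈ Icc 0 L := ⟨le_rfl, hL⟩
  have hLm : L ∈ Icc 0 L := ⟨hL, le_rfl⟩
  have hx' := Ioo_subset_Icc_self hx
  have := intervalIntegral.integral_add_adjacent_intervals
    (intervalIntegrable_of_mu (L2_integrable k) h0m hx')
    (intervalIntegrable_of_mu (L2_integrable k) hx' hLm)
  rw [h1, Pi.sub_apply, h2, Pi.smul_apply, h3, h4, inner_one hL, primitive, primitive, ← this]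
  simp

/-- Multiplication by a real bounded function on `L²(0, L)`. -/
def mulOp (b : Lp ℝ ∞ (mu L)) : L2 L →L[ℂ] L2 L :=
  LinearMap.mkContinuous
    { toFun := fun f => (b • f : L2 L)
      map_add' := fun f g => Lp.add_smul b f g
      map_smul' := fun a f => by
        apply Lp.ext
        filter_upwards [Lp.coeFn_lpSMul (r := 2) b (a • f), Lp.coeFn_lpSMul (r := 2) b f,
          Lp.coeFn_smul a f, Lp.coeFn_smul a (b • f : L2 L)] with x h1 h2 h3 h4
        simp only [h1, h2, h3, h4, Pi.smul_apply, Pi.smul_apply', RingHom.id_apply]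
        exact smul_comm _ _ _ } ‖b‖ fun f => Lp.norm_smul_le b f

theorem mulOp_ae (b : Lp ℝ ∞ (mu L)) (f : L2 L) :
    mulOp b f =ᵐ[mu L] fun x => (b x : ℂ) * f x := by
  filter_upwards [Lp.coeFn_lpSMul (r := 2) b f] with x hx
  refine hx.trans ?_
  rw [Pi.smul_apply', Complex.real_smul]

theorem inner_mulOp (b : Lp ℝ ∞ (mu L)) (f g : L2 L) :
    inner ℂ (mulOp b f) g = inner ℂ f (mulOp b g) := by
  rw [L2_inner_eq, L2_inner_eq]
  refine integral_congr_ae ?_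
  filter_upwards [mulOp_ae b f, mulOp_ae b g] with x h1 h2
  rw [h1, h2, map_mul, Complex.conj_ofReal]
  ring

theorem memLp_coord (L : ℝ) : MemLp (fun x : ℝ => x) ∞ (mu L) :=
  memLp_top_of_bound (by fun_prop) |L| ((ae_restrict_mem measurableSet_Ioo).mono fun x hx => by
    rw [Real.norm_of_nonneg hx.1.le]; exact hx.2.le.trans (le_abs_self L))

/-- Multiplication by the coordinate `x`. -/
def mulX (L : ℝ) : L2 L →L[ℂ] L2 L := mulOp ((memLp_coord L).toLp _)

theorem mulX_ae (f : L2 L) : mulX L f =ᵐ[mu L] fun x => (x : ℂ) * f x := by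
  filter_upwards [mulOp_ae ((memLp_coord L).toLp _) f, MemLp.coeFn_toLp (memLp_coord L)]
    with x h1 h2
  exact h1.trans (by rw [h2])

/-- The product rule for `x ∫₀ˣ k`: this commutation relation of `x` with V is the source of the
multiplier identities. -/
theorem mulX_volterra (hL : 0 ≤ L) (k : L2 L) :
    mulX L (volterra hL k) = volterra hL (volterra hL k + mulX L k) := by
  apply Lp.ext
  filter_upwards [mulX_ae (volterra hL k), volterra_ae hL k,
    volterra_ae hL (volterra hL k + mulX L k), ae_restrict_mem measurableSet_Ioo]
    with x h1 h2 h3 hx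
  have hx' := Ioo_subset_Icc_self hx
  have hk : IntervalIntegrable k volume 0 x :=
    intervalIntegrable_of_mu (L2_integrable k) ⟨le_rfl, hL⟩ hx'
  have h := primitive_mul_primitive (f := fun _ => (1 : ℂ)) intervalIntegrable_const hk
  have h4 : primitive (volterra hL k + mulX L k : L2 L) x =
      primitive (fun s => primitive k s + s * k s) x := by
    refine primitive_congr ?_ hx'
    filter_upwards [Lp.coeFn_add (volterra hL k) (mulX L k), volterra_ae hL k, mulX_ae k]
      with s i1 i2 i3
    rw [i1, Pi.add_apply, i2, i3]
  rw [h1, h2, h3, h4]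
  simpa [primitive] using h

theorem volterra_one (hL : 0 ≤ L) : volterra hL (one L) = mulX L (one L) := by
  apply Lp.ext
  filter_upwards [volterra_ae hL (one L), mulX_ae (one L), one_ae L,
    ae_restrict_mem measurableSet_Ioo] with x h1 h2 h3 hx
  rw [h1, h2, h3, primitive_congr (one_ae L) (Ioo_subset_Icc_self hx)]
  simp [primitive]

theorem inner_one_one (hL : 0 ≤ L) : inner ℂ (one L) (one L) = (L : ℂ) := by
  rw [inner_one hL, primitive_congr (one_ae L) ⟨hL, le_rfl⟩]
  simp [primitive]

/-! ### The dual operator and the admissibility inequality -/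

/-- First component, as a bounded operator. -/
def H0.fst1 (L : ℝ) : H0 L →L[ℂ] L2 L := WithLp.fstL 2 ℂ _ _

/-- Derivative of the second component, as a bounded operator. -/
def H0.deriv2 (hL : 0 ≤ L) : H0 L →L[ℂ] L2 L :=
  ((H10.derivEquiv hL).toContinuousLinearEquiv.toContinuousLinearMap.comp
    (WithLp.fstL 2 ℂ _ _)).comp (WithLp.sndL 2 ℂ _ _)

/-- Third component, as a bounded operator. -/
def H0.snd3 (L : ℝ) : H0 L →L[ℂ] L2 L := (WithLp.sndL 2 ℂ _ _).comp (WithLp.sndL 2 ℂ _ _)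

theorem H0.inner_eq (X Y : H0 L) : inner ℂ X Y = inner ℂ X.c1 Y.c1 +
    (inner ℂ (H10.deriv L X.c2) (H10.deriv L Y.c2) + inner ℂ X.c3 Y.c3) := by
  rw [WithLp.prod_inner_apply, WithLp.prod_inner_apply]
  rfl

theorem H0.norm_sq_eq (X : H0 L) :
    ‖X‖ ^ 2 = ‖X.c1‖ ^ 2 + (‖X.c2‖ ^ 2 + ‖X.c3‖ ^ 2) := by
  rw [WithLp.prod_norm_sq_eq_of_L2, WithLp.prod_norm_sq_eq_of_L2]
  rfl

theorem H0.norm_c1_le (X : H0 L) : ‖X.c1‖ ≤ ‖X‖ :=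
  abs_le_of_sq_le_sq' (by rw [H0.norm_sq_eq]; nlinarith [sq_nonneg ‖X.c2‖, sq_nonneg ‖X.c3‖])
    (norm_nonneg _) |>.2

theorem H0.norm_c2_le (X : H0 L) : ‖X.c2‖ ≤ ‖X‖ :=
  abs_le_of_sq_le_sq' (by rw [H0.norm_sq_eq]; nlinarith [sq_nonneg ‖X.c1‖, sq_nonneg ‖X.c3‖])
    (norm_nonneg _) |>.2

theorem H0.norm_c3_le (X : H0 L) : ‖X.c3‖ ≤ ‖X‖ :=
  abs_le_of_sq_le_sq' (by rw [H0.norm_sq_eq]; nlinarith [sq_nonneg ‖X.c1‖, sq_nonneg ‖X.c2‖])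
    (norm_nonneg _) |>.2

/-- The inner integral defining `P_β` is V* and the outer one is V. -/
theorem Pβ_eq_primitive (hL : 0 ≤ L) (β : Lp ℝ ∞ (mu L)) (f : L2 L) {x : ℝ} (hx : x ∈ Icc 0 L) :
    Pβ L β f x = primitive (volterraAdj hL (mulOp β f)) x := by
  rw [primitive_congr (volterraAdj_ae hL (mulOp β f)) hx]
  refine intervalIntegral.integral_congr fun τ hτ => ?_
  rw [uIcc_of_le hx.1] at hτ
  exact (intervalIntegral_congr_mu (mulOp_ae β f) ⟨hτ.1, hτ.2.trans hx.2⟩ ⟨hL, le_rfl⟩).symm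

theorem coeFn_smul_one_add_volterra (hL : 0 ≤ L) (a : ℂ) (k : L2 L) :
    (a • one L + volterra hL k : L2 L) =ᵐ[mu L] fun x => a + primitive k x := by
  filter_upwards [Lp.coeFn_add (a • one L) (volterra hL k), Lp.coeFn_smul a (one L), one_ae L,
    volterra_ae hL k] with x h1 h2 h3 h4
  rw [h1, Pi.add_apply, h2, Pi.smul_apply, h3, h4]
  simp

/-- The dual operator in terms of integration operators. -/
theorem adjointRel_iff (hL : 0 < L) {c : ℝ} {β : Lp ℝ ∞ (mu L)} {φ ψ : H0 L} :
    AdjointRel L c β φ ψ ↔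
      H10.deriv L φ.c2 = volterraAdj hL.le ψ.c3 ∧
      φ.c3 = volterra hL.le (volterraAdj hL.le (mulOp β φ.c1) - H10.deriv L ψ.c2) ∧
      ∃ a : ℂ,
        φ.c1 = volterra hL.le (a • one L + volterra hL.le (ψ.c1 - (c : ℂ) • φ.c1)) ∧
        inner ℂ (one L) (a • one L + volterra hL.le (ψ.c1 - (c : ℂ) • φ.c1)) = 0 := by
  have h0m : (0 : ℝ) ∈ Icc 0 L := ⟨le_rfl, hL.le⟩
  have hLm : L ∈ Icc 0 L := ⟨hL.le, le_rfl⟩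
  constructor
  · rintro ⟨f, f', f'', g, g', g'', h, h', hf, hg, hh, b1, b2, b3, b4, b5, e1, e2, e3, e4, e5, e6⟩
    have hf'' : f'' =ᵐ[mu L] (ψ.c1 - (c : ℂ) • φ.c1 : L2 L) := by
      filter_upwards [e1, e4, Lp.coeFn_sub ψ.c1 ((c : ℂ) • φ.c1), Lp.coeFn_smul (c : ℂ) φ.c1]
        with x i1 i2 i3 i4
      rw [i3, Pi.sub_apply, i4, Pi.smul_apply, i1, i2, smul_eq_mul, add_sub_cancel_right]
    have hf' : hf.1.1.toLp f' = f' 0 • one L + volterra hL.le (ψ.c1 - (c : ℂ) • φ.c1) := by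
      apply Lp.ext
      filter_upwards [MemLp.coeFn_toLp hf.1.1,
        coeFn_smul_one_add_volterra hL.le (f' 0) (ψ.c1 - (c : ℂ) • φ.c1),
        ae_restrict_mem measurableSet_Ioo] with x i1 i2 hx
      have hx' := Ioo_subset_Icc_self hx
      rw [i1, i2, hf.2.2 x hx', ← primitive_congr hf'' hx']
      rfl
    -- The slope `f'(0)` is not prescribed and remains as the parameter `a`; the condition `f(L) =
    -- 0` becomes orthogonality of `f'` to `1`.
    refine ⟨?_, ?_, f' 0, ?_, ?_⟩
    · have h1 : H10.deriv L φ.c2 = hg.1.1.toLp g' := by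
        apply volterra_injective hL
        rw [← H10.toL2_eq hL.le, hg.1.eq_volterra hL.le b3 e2]
      rw [h1]
      apply Lp.ext
      filter_upwards [MemLp.coeFn_toLp hg.1.1, volterraAdj_ae hL.le ψ.c3,
        ae_restrict_mem measurableSet_Ioo] with x i1 i2 hx
      have hx' := Ioo_subset_Icc_self hx
      have i := fun {y z : ℝ} (hy : y ∈ Icc 0 L) (hz : z ∈ Icc 0 L) =>
        intervalIntegrable_of_mu (hg.2.1.integrable (by norm_num)) hy hz
      have j1 := hg.2.2 x hx'
      have j2 := hg.2.2 L hLm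
      have j3 := intervalIntegral.integral_add_adjacent_intervals (i h0m hx') (i hx' hLm)
      rw [i1, i2, intervalIntegral_congr_mu e6 hx' hLm, intervalIntegral.integral_neg]
      rw [b4] at j2
      linear_combination j1 - j2 + j3
    · have h1 : H10.toL2 L ψ.c2 = volterra hL.le (volterraAdj hL.le (mulOp β φ.c1)) - φ.c3 := by
        apply Lp.ext
        filter_upwards [e5, e3, volterra_ae hL.le (volterraAdj hL.le (mulOp β φ.c1)),
          Lp.coeFn_sub (volterra hL.le (volterraAdj hL.le (mulOp β φ.c1))) φ.c3,
          ae_restrict_mem measurableSet_Ioo] with x i1 i2 i3 i4 hx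
        rw [i1, i4, Pi.sub_apply, i3, i2, Pβ_eq_primitive hL.le β φ.c1 (Ioo_subset_Icc_self hx)]
      rw [map_sub, ← H10.toL2_eq hL.le, h1, sub_sub_cancel]
    · rw [← hf']
      exact hf.1.eq_volterra hL.le b1 e1
    · rw [← hf', ← hf.1.end_value hL.le b1, b2]
  · rintro ⟨h2, h3, a, h1, h1'⟩
    -- For the converse, `w` is to be `f''` and `k` is to be `h'`; `f'` and `g'` are the primitives
    -- `a + ∫₀ˣ w` and `∫ₓᴸ ψ₃`.
    set w : L2 L := ψ.c1 - (c : ℂ) • φ.c1 with hw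
    set k : L2 L := volterraAdj hL.le (mulOp β φ.c1) - H10.deriv L ψ.c2 with hk
    have hm : IsH1 L (fun x => a + primitive w x) w :=
      ⟨Lp.memLp w, fun x _ => by simp [primitive]⟩
    have hp : IsH1 L (fun x => ∫ s in x..L, ψ.c3 s) fun x => -ψ.c3 x := by
      refine ⟨(Lp.memLp ψ.c3).neg, fun x hx => ?_⟩
      have j3 := intervalIntegral.integral_add_adjacent_intervals
        (intervalIntegrable_of_mu (L2_integrable ψ.c3) h0m hx)
        (intervalIntegrable_of_mu (L2_integrable ψ.c3) hx hLm)
      beta_reduce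
      rw [intervalIntegral.integral_neg, ← j3]
      ring
    have hmL := memLp_of_continuousOn (hm.continuousOn hL.le) 2
    have hpL := memLp_of_continuousOn (hp.continuousOn hL.le) 2
    refine ⟨primitive fun x => a + primitive w x, fun x => a + primitive w x, w,
      primitive fun x => ∫ s in x..L, ψ.c3 s, fun x => ∫ s in x..L, ψ.c3 s, fun x => -ψ.c3 x,
      primitive k, k, ⟨isH1_primitive hmL, hm⟩, ⟨isH1_primitive hpL, hp⟩,
      isH1_primitive (Lp.memLp k), primitive_zero _, ?_, primitive_zero _,
      intervalIntegral.integral_same, primitive_zero _, ?_, ?_, ?_, ?_, ?_, ?_⟩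
    · rw [← primitive_congr (coeFn_smul_one_add_volterra hL.le a w) hLm, ← inner_one hL.le, h1']
    · have h4 := volterra_ae hL.le (a • one L + volterra hL.le w)
      rw [← h1] at h4
      filter_upwards [h4, ae_restrict_mem measurableSet_Ioo] with x i1 hx
      rw [i1, primitive_congr (coeFn_smul_one_add_volterra hL.le a w) (Ioo_subset_Icc_self hx)]
    · filter_upwards [φ.c2.ae_eq, ae_restrict_mem measurableSet_Ioo] with x i1 hx
      rw [i1, h2]
      exact primitive_congr (volterraAdj_ae hL.le ψ.c3) (Ioo_subset_Icc_self hx)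
    · rw [h3]
      exact volterra_ae hL.le k
    · have h4 := volterra_ae hL.le (a • one L + volterra hL.le w)
      rw [← h1] at h4
      filter_upwards [h4, ae_restrict_mem measurableSet_Ioo,
        Lp.coeFn_sub ψ.c1 ((c : ℂ) • φ.c1), Lp.coeFn_smul (c : ℂ) φ.c1] with x i1 hx i2 i3
      rw [← primitive_congr (coeFn_smul_one_add_volterra hL.le a w) (Ioo_subset_Icc_self hx),
        ← i1, hw, i2, Pi.sub_apply, i3, Pi.smul_apply, smul_eq_mul, sub_add_cancel]
    · filter_upwards [volterra_ae hL.le (volterraAdj hL.le (mulOp β φ.c1) - H10.deriv L ψ.c2),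
        ψ.c2.ae_eq, volterra_ae hL.le (volterraAdj hL.le (mulOp β φ.c1)),
        Lp.coeFn_sub (volterra hL.le (volterraAdj hL.le (mulOp β φ.c1)))
          (volterra hL.le (H10.deriv L ψ.c2)), volterra_ae hL.le (H10.deriv L ψ.c2),
        ae_restrict_mem measurableSet_Ioo] with x i1 i2 i3 i4 i5 hx
      rw [map_sub, i4, Pi.sub_apply, i3, i5] at i1
      rw [Pβ_eq_primitive hL.le β φ.c1 (Ioo_subset_Icc_self hx), ← i1, i2, sub_sub_cancel]
      rfl
    · exact .of_forall fun x => (neg_neg _).symm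

theorem re_inner_comm {E : Type*} [NormedAddCommGroup E] [InnerProductSpace ℂ E] (x y : E) :
    (inner ℂ x y).re = (inner ℂ y x).re := by
  rw [← inner_conj_symm, Complex.conj_re]

theorem re_inner_self {E : Type*} [NormedAddCommGroup E] [InnerProductSpace ℂ E] (x : E) :
    (inner ℂ x x).re = ‖x‖ ^ 2 := inner_self_eq_norm_sq (𝕜 := ℂ) x

/-- The dual operator is quasi-dissipative. -/
theorem AdjointRel.re_inner_le (hL : 0 < L) {c : ℝ} {β : Lp ℝ ∞ (mu L)} {φ ψ : H0 L}
    (h : AdjointRel L c β φ ψ) : (inner ℂ φ ψ).re ≤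
      (|c| + ‖volterraAdj hL.le ∘L mulOp β‖) * ‖φ‖ ^ 2 := by
  obtain ⟨h2, h3, a, h1, h1'⟩ := (adjointRel_iff hL).1 h
  set w : L2 L := ψ.c1 - (c : ℂ) • φ.c1 with hw
  set m : L2 L := a • one L + volterra hL.le w with hm
  set k : L2 L := volterraAdj hL.le (mulOp β φ.c1) - H10.deriv L ψ.c2 with hk
  clear_value w m k
  -- Here `m` is `f'` and `w` is `f''`. Orthogonality of `m` to `1` removes the boundary terms in
  -- `⟨f, f''⟩ = -‖f'‖²`.
  have i1 : (inner ℂ φ.c1 ψ.c1).re = -‖m‖ ^ 2 + c * ‖φ.c1‖ ^ 2 := by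
    have j1 : ψ.c1 = w + (c : ℂ) • φ.c1 := by rw [hw, sub_add_cancel]
    have j2 : inner ℂ φ.c1 w = -inner ℂ m m := by
      have j3 : volterra hL.le w = m - a • one L := by rw [hm, add_sub_cancel_left]
      have j4 : inner ℂ m (one L) = 0 := by rw [← inner_conj_symm, h1', map_zero]
      rw [h1, inner_volterra_left, volterraAdj_eq, j3, inner_sub_right,
        inner_sub_right, inner_smul_right, inner_smul_right, j4]
      ring
    rw [j1, inner_add_right, j2, inner_smul_right, Complex.add_re, Complex.neg_re, re_inner_self,
      Complex.re_ofReal_mul, re_inner_self]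
  -- The wave part is skew: `⟨h, ψ₃⟩ = ⟨k, g'⟩` cancels `-⟨g', k⟩` in the real part, and only the
  -- coupling survives.
  have i2 : (inner ℂ (H10.deriv L φ.c2) (H10.deriv L ψ.c2) + inner ℂ φ.c3 ψ.c3).re =
      (inner ℂ (H10.deriv L φ.c2) (volterraAdj hL.le (mulOp β φ.c1))).re := by
    have j1 : H10.deriv L ψ.c2 = volterraAdj hL.le (mulOp β φ.c1) - k := by
      rw [hk, sub_sub_cancel]
    rw [j1, h3, inner_volterra_left, ← h2, inner_sub_right, Complex.add_re,
      Complex.sub_re, re_inner_comm k]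
    ring
  have i3 : (inner ℂ (H10.deriv L φ.c2) (volterraAdj hL.le (mulOp β φ.c1))).re ≤
      ‖φ‖ * (‖volterraAdj hL.le ∘L mulOp β‖ * ‖φ‖) := by
    refine (Complex.re_le_norm _).trans ((norm_inner_le_norm _ _).trans ?_)
    refine mul_le_mul (H0.norm_c2_le φ) ?_ (norm_nonneg _) (norm_nonneg _)
    refine ((volterraAdj hL.le ∘L mulOp β).le_opNorm φ.c1).trans ?_
    gcongr
    exact H0.norm_c1_le φ
  have i4 : c * ‖φ.c1‖ ^ 2 ≤ |c| * ‖φ‖ ^ 2 := by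
    gcongr
    · exact le_abs_self c
    · exact H0.norm_c1_le φ
  rw [H0.inner_eq, Complex.add_re, i1, i2]
  nlinarith [sq_nonneg ‖m‖]

/-- The observation `φ ↦ φ₃(L)` on the graph of the dual operator. -/
def observe (hL : 0 ≤ L) (β : Lp ℝ ∞ (mu L)) : H0 L × H0 L →L[ℂ] ℂ :=
  innerSL ℂ (one L) ∘L
    ((volterraAdj hL ∘L mulOp β ∘L H0.fst1 L) ∘L ContinuousLinearMap.fst ℂ _ _ -
      H0.deriv2 hL ∘L ContinuousLinearMap.snd ℂ _ _)

theorem observe_apply (hL : 0 ≤ L) (β : Lp ℝ ∞ (mu L)) (φ ψ : H0 L) : observe hL β (φ, ψ) =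
    inner ℂ (one L) (volterraAdj hL (mulOp β φ.c1) - H10.deriv L ψ.c2) := rfl

/-- On the graph `φ₃` is V applied to `V*(β φ₁) - ψ₂'`, so its end value is bounded by the graph
norm of `φ`. -/
theorem AdjointRel.hasValueAtEnd (hL : 0 < L) {c : ℝ} {β : Lp ℝ ∞ (mu L)} {φ ψ : H0 L}
    (h : AdjointRel L c β φ ψ) : HasValueAtEnd L φ.c3 (observe hL.le β (φ, ψ)) := by
  rw [((adjointRel_iff hL).1 h).2.1]
  exact hasValueAtEnd_volterra hL.le _

/-- With `h = V k` the left side is `∫ x (|h|²)'`, and integration by parts leaves the boundary term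
at `L`. The proof uses only the commutation of `x` with V and the formula for V*. -/
theorem two_re_inner_volterra_mulX (hL : 0 ≤ L) (k : L2 L) :
    2 * (inner ℂ (volterra hL k) (mulX L k)).re =
      L * ‖(inner ℂ (one L) k : ℂ)‖ ^ 2 - ‖volterra hL k‖ ^ 2 := by
  have h1 : inner ℂ (volterra hL k) (mulX L k) =
      inner ℂ (one L) (mulX L k) * conj (inner ℂ (one L) k : ℂ) -
        (inner ℂ (mulX L k) (volterra hL k) - inner ℂ k (volterra hL (volterra hL k))) := by
    have e : volterra hL (mulX L k) = mulX L (volterra hL k) - volterra hL (volterra hL k) := by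
      rw [mulX_volterra, map_add, add_sub_cancel_left]
    rw [inner_volterra_left, volterraAdj_eq, e, inner_sub_right,
      inner_smul_right, inner_sub_right, inner_conj_symm, mulX, inner_mulOp]
  have h2 : inner ℂ k (volterra hL (volterra hL k)) =
      conj (inner ℂ (one L) k : ℂ) * inner ℂ (one L) (volterra hL k) -
        inner ℂ (volterra hL k) (volterra hL k) := by
    rw [inner_volterra_right, volterraAdj_eq, inner_sub_left,
      inner_smul_left]
  have h3 : inner ℂ (one L) (volterra hL k) + inner ℂ (one L) (mulX L k) =
      L * inner ℂ (one L) k := by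
    rw [inner_volterra_right, volterraAdj_eq, inner_one_one hL, volterra_one,
      inner_sub_left, inner_smul_left, Complex.conj_ofReal, mulX, inner_mulOp]
    ring
  have h4 : (inner ℂ (volterra hL k) (mulX L k)).re + (inner ℂ (mulX L k) (volterra hL k)).re =
      (conj (inner ℂ (one L) k : ℂ) * (L * inner ℂ (one L) k) -
        inner ℂ (volterra hL k) (volterra hL k)).re := by
    rw [← Complex.add_re]
    congr 1
    rw [h1, h2, ← h3]
    ring
  rw [re_inner_comm (mulX L k), Complex.sub_re, re_inner_self, mul_left_comm,
    ← Complex.normSq_eq_conj_mul_self, ← Complex.ofReal_mul, Complex.ofReal_re,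
    Complex.normSq_eq_norm_sq] at h4
  linarith

/-- With `p = V* a` one has `p' = -a` and `p(L) = 0`, so `-∫ x (|p|²)'` has no boundary term. -/
theorem two_re_inner_mulX_adjoint (hL : 0 ≤ L) (a : L2 L) :
    2 * (inner ℂ a (mulX L (volterraAdj hL a))).re = ‖volterraAdj hL a‖ ^ 2 := by
  set p := volterraAdj hL a with hp
  have hV : ∀ b, volterra hL b = (inner ℂ (one L) b : ℂ) • one L - volterraAdj hL b := fun b => by
    rw [volterraAdj_eq, sub_sub_cancel]
  have h2 : inner ℂ a (mulX L p) = inner ℂ (one L) a * inner ℂ a (mulX L (one L)) -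
      inner ℂ a (mulX L (volterra hL a)) := by
    rw [hp, volterraAdj_eq, map_sub, map_smul, inner_sub_right, inner_smul_right]
  have h3 : inner ℂ a (mulX L (volterra hL a)) =
      inner ℂ p (volterra hL a) + inner ℂ (mulX L p) a := by
    rw [mulX_volterra, inner_volterra_right, inner_add_right, mulX,
      inner_mulOp]
  have h4 : inner ℂ p (volterra hL a) =
      inner ℂ (one L) a * inner ℂ a (mulX L (one L)) - inner ℂ p p := by
    rw [hV a, inner_sub_right, inner_smul_right, ← hp, hp,
      ← inner_volterra_right, volterra_one]
  have h5 : (inner ℂ a (mulX L p)).re + (inner ℂ (mulX L p) a).re = (inner ℂ p p).re := by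
    rw [← Complex.add_re]
    congr 1
    linear_combination h2 - h3 - h4
  rw [re_inner_comm (mulX L p), re_inner_self] at h5
  linarith

/-- The multiplier identity for the dual operator. -/
theorem AdjointRel.multiplier (hL : 0 < L) {c : ℝ} {β : Lp ℝ ∞ (mu L)} {φ ψ : H0 L}
    (h : AdjointRel L c β φ ψ) :
    2 * (inner ℂ φ.c3 (mulX L (H10.deriv L ψ.c2)) +
      inner ℂ ψ.c3 (mulX L (H10.deriv L φ.c2))).re =
      ‖φ.c3‖ ^ 2 + ‖φ.c2‖ ^ 2 - L * ‖observe hL.le β (φ, ψ)‖ ^ 2 +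
        2 * (inner ℂ φ.c3 (mulX L (volterraAdj hL.le (mulOp β φ.c1)))).re := by
  obtain ⟨h2, h3, -⟩ := (adjointRel_iff hL).1 h
  rw [observe_apply]
  set k : L2 L := volterraAdj hL.le (mulOp β φ.c1) - H10.deriv L ψ.c2 with hk
  have j1 : H10.deriv L ψ.c2 = volterraAdj hL.le (mulOp β φ.c1) - k := by
    rw [hk, sub_sub_cancel]
  have j2 := two_re_inner_volterra_mulX hL.le k
  have j3 := two_re_inner_mulX_adjoint hL.le ψ.c3
  rw [← h3] at j2
  rw [← h2, ← H10.norm_def] at j3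
  rw [j1, map_sub, inner_sub_right, Complex.add_re, Complex.sub_re]
  linarith

/-- Admissibility of the observation for strong solutions of the dual system. -/
theorem exists_admissible (hL : 0 < L) (c : ℝ) (β : Lp ℝ ∞ (mu L)) {T : ℝ} (hT : 0 < T) :
    ∃ K : ℝ, 0 < K ∧ ∀ X X' : ℝ → H0 L, IsStrongDualSolution L c β T X X' →
      ∫ t in (0 : ℝ)..T, ‖observe hL.le β (X t, X' t)‖ ^ 2 ≤ K * ‖X 0‖ ^ 2 := by
  set ω : ℝ := |c| + ‖volterraAdj hL.le ∘L mulOp β‖ with hω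
  set S : L2 L →L[ℂ] L2 L := mulX L ∘L volterraAdj hL.le ∘L mulOp β with hS
  have hω0 : 0 ≤ ω := by positivity
  set A : ℝ := Real.exp (ω * T) ^ 2 with hA
  -- `4‖mulX L‖` bounds the two end values of `r`, and `T (2 + 2‖S‖)` the time integral of the
  -- remaining terms in the multiplier identity; `A` is the squared growth factor on `[0, T]`.
  have hK0 : 0 < (4 * ‖mulX L‖ + T * (2 + 2 * ‖S‖)) * A / L := by positivity
  refine ⟨_, hK0, fun X X' hX => ?_⟩
  have h0T : (0 : ℝ) ∈ Icc 0 T := ⟨le_rfl, hT.le⟩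
  have hTT : T ∈ Icc 0 T := ⟨hT.le, le_rfl⟩
  have hN : ∀ t ∈ Icc 0 T, ‖X t‖ ^ 2 ≤ A * ‖X 0‖ ^ 2 := by
    intro t ht
    rw [hA, ← mul_pow]
    gcongr
    refine (norm_le_of_dissipative hX.hasDeriv
      (fun s hs => (hX.eqn s hs).re_inner_le hL) ht).trans ?_
    gcongr
    exact ht.2
  have hXc : ContinuousOn X (Icc 0 T) := fun t ht => (hX.hasDeriv t ht).continuousWithinAt
  set r : ℝ → ℝ := fun t => 2 * (inner ℂ (H0.snd3 L (X t)) (mulX L (H0.deriv2 hL.le (X t)))).re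
  set r' : ℝ → ℝ := fun t => 2 * (inner ℂ (H0.snd3 L (X t)) (mulX L (H0.deriv2 hL.le (X' t))) +
    inner ℂ (H0.snd3 L (X' t)) (mulX L (H0.deriv2 hL.le (X t)))).re
  have hr : ∀ t ∈ Icc 0 T, HasDerivWithinAt r (r' t) (Icc 0 T) t := by
    intro t ht
    have d3 := ((H0.snd3 L).restrictScalars ℝ).hasFDerivAt.comp_hasDerivWithinAt t (hX.hasDeriv t ht)
    have d2 := ((mulX L ∘L H0.deriv2 hL.le).restrictScalars ℝ).hasFDerivAt.comp_hasDerivWithinAt t (hX.hasDeriv t ht)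
    exact (Complex.reCLM.hasFDerivAt.comp_hasDerivWithinAt t (d3.inner ℂ d2)).const_mul 2
  have hr'c : ContinuousOn r' (Icc 0 T) := by
    have c3 := (H0.snd3 L).continuous.comp_continuousOn hXc
    have c3' := (H0.snd3 L).continuous.comp_continuousOn hX.cont_deriv
    have c2 := (mulX L ∘L H0.deriv2 hL.le).continuous.comp_continuousOn hXc
    have c2' := (mulX L ∘L H0.deriv2 hL.le).continuous.comp_continuousOn hX.cont_deriv
    exact continuousOn_const.mul (Complex.continuous_re.comp_continuousOn
      ((c3.inner c2').add (c3'.inner c2)))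
  have hFTC : ∫ t in (0 : ℝ)..T, r' t = r T - r 0 :=
    intervalIntegral.integral_eq_sub_of_hasDerivAt_of_le hT.le
      (fun t ht => (hr t ht).continuousWithinAt)
      (fun t ht => (hr t (Ioo_subset_Icc_self ht)).hasDerivAt (Icc_mem_nhds ht.1 ht.2))
      (hr'c.intervalIntegrable_of_Icc hT.le)
  have hoc : ContinuousOn (fun t => ‖observe hL.le β (X t, X' t)‖ ^ 2) (Icc 0 T) :=
    (((observe hL.le β).continuous.comp_continuousOn (hXc.prodMk hX.cont_deriv)).norm).pow 2
  have hpt : ∀ t ∈ Icc 0 T, L * ‖observe hL.le β (X t, X' t)‖ ^ 2 + r' t ≤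
      (2 + 2 * ‖S‖) * (A * ‖X 0‖ ^ 2) := by
    intro t ht
    have h1 := (hX.eqn t ht).multiplier hL
    have h2 : (inner ℂ (X t).c3 (mulX L (volterraAdj hL.le (mulOp β (X t).c1)))).re ≤
        ‖X t‖ * (‖S‖ * ‖X t‖) := by
      refine (Complex.re_le_norm _).trans ((norm_inner_le_norm _ _).trans ?_)
      refine mul_le_mul (H0.norm_c3_le _) ?_ (norm_nonneg _) (norm_nonneg _)
      refine (S.le_opNorm (X t).c1).trans ?_
      gcongr
      exact H0.norm_c1_le _
    have h3 : r' t = 2 * (inner ℂ (X t).c3 (mulX L (H10.deriv L (X' t).c2)) +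
      inner ℂ (X' t).c3 (mulX L (H10.deriv L (X t).c2))).re := rfl
    have h4 : ‖(X t).c3‖ ^ 2 ≤ ‖X t‖ ^ 2 := by gcongr; exact H0.norm_c3_le _
    have h5 : ‖(X t).c2‖ ^ 2 ≤ ‖X t‖ ^ 2 := by gcongr; exact H0.norm_c2_le _
    calc _ ≤ (2 + 2 * ‖S‖) * ‖X t‖ ^ 2 := by rw [h3, h1]; linarith
      _ ≤ _ := by gcongr; exact hN t ht
  have hoi : IntervalIntegrable (fun t => L * ‖observe hL.le β (X t, X' t)‖ ^ 2) volume 0 T :=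
    (continuousOn_const.mul hoc).intervalIntegrable_of_Icc hT.le
  have hle : ∫ t in (0 : ℝ)..T, (L * ‖observe hL.le β (X t, X' t)‖ ^ 2 + r' t) ≤
      ∫ t in (0 : ℝ)..T, (2 + 2 * ‖S‖) * (A * ‖X 0‖ ^ 2) := intervalIntegral.integral_mono_on (μ := volume) hT.le
    (hoi.add (hr'c.intervalIntegrable_of_Icc hT.le))
    (intervalIntegrable_const (c := (2 + 2 * ‖S‖) * (A * ‖X 0‖ ^ 2))) hpt
  rw [intervalIntegral.integral_add hoi (hr'c.intervalIntegrable_of_Icc hT.le), hFTC,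
    intervalIntegral.integral_const_mul, intervalIntegral.integral_const, sub_zero,
    smul_eq_mul] at hle
  have hrb : ∀ t ∈ Icc 0 T, |r t| ≤ 2 * (‖mulX L‖ * (A * ‖X 0‖ ^ 2)) := by
    intro t ht
    have h1 : ‖(inner ℂ (X t).c3 (mulX L (H10.deriv L (X t).c2)) : ℂ)‖ ≤
        ‖X t‖ * (‖mulX L‖ * ‖X t‖) := by
      refine (norm_inner_le_norm _ _).trans ?_
      refine mul_le_mul (H0.norm_c3_le _) ?_ (norm_nonneg _) (norm_nonneg _)
      refine ((mulX L).le_opNorm _).trans ?_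
      gcongr
      exact H0.norm_c2_le _
    calc |r t| = |2 * (inner ℂ (X t).c3 (mulX L (H10.deriv L (X t).c2))).re| := rfl
      _ = 2 * |(inner ℂ (X t).c3 (mulX L (H10.deriv L (X t).c2))).re| := by
          rw [abs_mul, abs_two]
      _ ≤ 2 * (‖X t‖ * (‖mulX L‖ * ‖X t‖)) := by
          gcongr; exact (Complex.abs_re_le_norm _).trans h1
      _ = 2 * (‖mulX L‖ * ‖X t‖ ^ 2) := by ring
      _ ≤ _ := by gcongr; exact hN t ht
  have b1 := (abs_le.1 (hrb T hTT)).1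
  have b2 := (abs_le.1 (hrb 0 h0T)).2
  rw [div_mul_eq_mul_div, le_div_iff₀ hL]
  linarith

/-! ### Completeness of trigonometric systems -/

/-- If the functions `s n` satisfy the recurrence `2 cos(πx/L) s n = s (n+1) + s (n-1)` and one of
them has no zero in `(0, L)`, then they are complete in `L²(0, L)`. -/
theorem ae_eq_zero_of_orthogonal (hL : 0 < L) {s : ℤ → ℝ → ℝ} (hs : ∀ n, Continuous (s n))
    (hrec : ∀ n x, 2 * Real.cos (Real.pi * x / L) * s n x = s (n + 1) x + s (n - 1) x)
    {k : ℤ} (hk : ∀ x ∈ Ioo 0 L, s k x ≠ 0) {f : ℝ → ℂ} (hf : Integrable f (mu L))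
    (horth : ∀ n, ∫ x, s n x • f x ∂(mu L) = 0) : f =ᵐ[mu L] 0 := by
  set z : ℝ → ℝ := fun x => Real.cos (Real.pi * x / L) with hz
  have hzc : Continuous z := by fun_prop
  have hint : ∀ {g : ℝ → ℝ}, Continuous g → Integrable (fun x => g x • f x) (mu L) := by
    intro g hg
    obtain ⟨B, hB⟩ := (isCompact_Icc (a := (0 : ℝ)) (b := L)).exists_bound_of_continuousOn
      hg.continuousOn
    exact hf.bdd_smul B hg.aestronglyMeasurable
      ((ae_restrict_mem measurableSet_Ioo).mono fun x hx => hB x (Ioo_subset_Icc_self hx))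
  have hjn : ∀ (j : ℕ) (n : ℤ), Integrable (fun x => (z x ^ j * s n x) • f x) (mu L) :=
    fun j n => hint ((hzc.pow j).mul (hs n))
  -- The recurrence trades a factor `cos(πx/L)` for a shift of the index, so orthogonality to all `s
  -- n` propagates to all powers of the cosine.
  have hpow : ∀ (j : ℕ) (n : ℤ), ∫ x, (z x ^ j * s n x) • f x ∂(mu L) = 0 := by
    intro j
    induction j with
    | zero => intro n; simpa using horth n
    | succ j ih =>
      intro n
      have h1 : ∀ x, (z x ^ (j + 1) * s n x) • f x =
          (2⁻¹ : ℝ) • ((z x ^ j * s (n + 1) x) • f x + (z x ^ j * s (n - 1) x) • f x) := by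
        intro x
        rw [← add_smul, smul_smul, ← mul_add, ← hrec n x]
        congr 1
        simp only [hz]
        ring
      simp only [h1]
      rw [integral_smul, integral_add (hjn _ _) (hjn _ _), ih, ih, add_zero, smul_zero]
  have hpoly : ∀ q : Polynomial ℝ, ∫ x, (q.eval (z x) * s k x) • f x ∂(mu L) = 0 := by
    intro q
    have h1 : ∀ x, (q.eval (z x) * s k x) • f x =
        ∑ j ∈ q.support, q.coeff j • ((z x ^ j * s k x) • f x) := by
      intro x
      rw [Polynomial.eval_eq_sum, Polynomial.sum, Finset.sum_mul, Finset.sum_smul]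
      exact Finset.sum_congr rfl fun j _ => by rw [smul_smul, mul_assoc]
    simp only [h1]
    rw [integral_finsetSum _ fun j _ => (hjn j k).fun_smul _]
    exact Finset.sum_eq_zero fun j _ => by rw [integral_smul, hpow, smul_zero]
  have hG : Integrable (fun x => s k x • f x) (mu L) := hint (hs k)
  have hcont : ∀ g : ℝ → ℝ, Continuous g → ∫ x, g x • s k x • f x ∂(mu L) = 0 := by
    intro g hg
    set C : ℝ := ∫ x, ‖s k x • f x‖ ∂(mu L) with hC
    have hC0 : 0 ≤ C := integral_nonneg fun _ => norm_nonneg _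
    refine norm_le_zero_iff.1 (le_of_forall_pos_le_add fun ε hε => ?_)
    rw [zero_add]
    -- `x ↦ cos(πx/L)` is injective on `[0, L]`, so every continuous `g` is a continuous function of
    -- it, and Weierstrass approximation applies in that variable.
    obtain ⟨q, hq⟩ := exists_polynomial_near_of_continuousOn (-1) 1
      (fun y => g (L * Real.arccos y / Real.pi))
      (hg.comp ((continuous_const.mul Real.continuous_arccos).div_const _)).continuousOn
      (ε / (C + 1)) (by positivity)
    have h1 : ∫ x, g x • s k x • f x ∂(mu L) =
        ∫ x, (g x - q.eval (z x)) • s k x • f x ∂(mu L) := by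
      have h2 : ∀ x, (g x - q.eval (z x)) • s k x • f x =
          g x • s k x • f x - (q.eval (z x) * s k x) • f x := fun x => by
        rw [sub_smul, smul_smul (q.eval _)]
      have h5 : Integrable (fun x => (q.eval (z x) * s k x) • f x) (mu L) :=
        hint ((q.continuous.comp hzc).mul (hs k))
      simp only [h2]
      rw [integral_sub _ h5, hpoly, sub_zero]
      have h6 : Integrable (fun x => (g x * s k x) • f x) (mu L) := hint (hg.mul (hs k))
      simpa only [smul_smul] using h6
    rw [h1]
    calc ‖∫ x, (g x - q.eval (z x)) • s k x • f x ∂(mu L)‖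
        ≤ ∫ x, ε / (C + 1) * ‖s k x • f x‖ ∂(mu L) := by
          refine norm_integral_le_of_norm_le (hG.norm.const_mul _) ?_
          filter_upwards [ae_restrict_mem measurableSet_Ioo] with x hx
          rw [norm_smul]
          refine mul_le_mul_of_nonneg_right ?_ (norm_nonneg _)
          have h3 := hq (z x) ⟨Real.neg_one_le_cos _, Real.cos_le_one _⟩
          have h4 : L * Real.arccos (z x) / Real.pi = x := by
            rw [hz, Real.arccos_cos]
            · field_simp
            · have := hx.1; positivity
            · rw [div_le_iff₀ hL]
              exact mul_le_mul_of_nonneg_left hx.2.le Real.pi_pos.le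
          rw [h4] at h3
          rw [Real.norm_eq_abs, abs_sub_comm]
          exact h3.le
      _ = ε / (C + 1) * C := by rw [integral_const_mul]
      _ ≤ ε / (C + 1) * (C + 1) := by gcongr; linarith
      _ = ε := by field_simp
  have hzero := ae_eq_zero_of_integral_contDiff_smul_eq_zero hG.locallyIntegrable
    fun g hg _ => hcont g hg.continuous
  filter_upwards [hzero, ae_restrict_mem measurableSet_Ioo] with x hx hxm
  exact (smul_eq_zero.1 hx).resolve_left (hk x hxm)

theorem memLp_ofReal_continuous {g : ℝ → ℝ} (hg : Continuous g) :
    MemLp (fun x => (g x : ℂ)) 2 (mu L) :=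
  memLp_of_continuousOn (Complex.continuous_ofReal.comp hg).continuousOn 2

/-- The function `cos(νx)` in `L²(0, L)`. -/
def cosL (L ν : ℝ) : L2 L :=
  (memLp_ofReal_continuous (g := fun x => Real.cos (ν * x)) (by fun_prop)).toLp _

/-- The function `sin(νx)` in `L²(0, L)`. -/
def sinL (L ν : ℝ) : L2 L :=
  (memLp_ofReal_continuous (g := fun x => Real.sin (ν * x)) (by fun_prop)).toLp _

theorem cosL_ae (L ν : ℝ) : cosL L ν =ᵐ[mu L] fun x => (Real.cos (ν * x) : ℂ) :=
  MemLp.coeFn_toLp _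

theorem sinL_ae (L ν : ℝ) : sinL L ν =ᵐ[mu L] fun x => (Real.sin (ν * x) : ℂ) :=
  MemLp.coeFn_toLp _

theorem cosL_neg (L ν : ℝ) : cosL L (-ν) = cosL L ν := by
  apply Lp.ext
  filter_upwards [cosL_ae L ν, cosL_ae L (-ν)] with x h1 h2
  rw [h1, h2, neg_mul, Real.cos_neg]

theorem sinL_neg (L ν : ℝ) : sinL L (-ν) = -sinL L ν := by
  apply Lp.ext
  filter_upwards [sinL_ae L ν, sinL_ae L (-ν), Lp.coeFn_neg (sinL L ν)] with x h1 h2 h3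
  rw [h2, h3, Pi.neg_apply, h1, neg_mul, Real.sin_neg, Complex.ofReal_neg]

theorem eq_zero_of_inner_toLp (hL : 0 < L) {s : ℤ → ℝ → ℝ} (hs : ∀ n, Continuous (s n))
    (hrec : ∀ n x, 2 * Real.cos (Real.pi * x / L) * s n x = s (n + 1) x + s (n - 1) x)
    {k : ℤ} (hk : ∀ x ∈ Ioo 0 L, s k x ≠ 0) {f : L2 L}
    (horth : ∀ n, ∃ S : L2 L, S =ᵐ[mu L] (fun x => (s n x : ℂ)) ∧ inner ℂ S f = 0) : f = 0 := by
  apply Lp.ext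
  refine (ae_eq_zero_of_orthogonal hL hs hrec hk (L2_integrable f) fun n => ?_).trans
    (Lp.coeFn_zero ..).symm
  obtain ⟨S, hS, h0⟩ := horth n
  rw [L2_inner_eq] at h0
  rw [← h0]
  refine integral_congr_ae ?_
  filter_upwards [hS] with x hx
  rw [hx, Complex.conj_ofReal, Complex.real_smul]

/-- The frequencies `nπ/L` of the Dirichlet problem. -/
def heatFreq (L : ℝ) (n : ℤ) : ℝ := n * Real.pi / L

/-- The frequencies `(n + 1/2)π/L` of the mixed Dirichlet-Neumann problem. -/
def waveFreq (L : ℝ) (n : ℤ) : ℝ := (n + 1 / 2) * Real.pi / L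

theorem waveFreq_neg (L : ℝ) (n : ℤ) : waveFreq L (-n - 1) = -waveFreq L n := by
  simp only [waveFreq]; push_cast; ring

theorem waveFreq_ne_zero (hL : 0 < L) (n : ℤ) : waveFreq L n ≠ 0 := by
  have h1 : (n : ℝ) + 1 / 2 ≠ 0 := by
    intro h
    have h2 : (2 * n + 1 : ℤ) = 0 := by
      have : (2 * n + 1 : ℝ) = 0 := by linarith
      exact_mod_cast this
    omega
  exact div_ne_zero (mul_ne_zero h1 Real.pi_ne_zero) hL.ne'

theorem sin_heatFreq (hL : 0 < L) (n : ℤ) : Real.sin (heatFreq L n * L) = 0 := by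
  rw [heatFreq, div_mul_cancel₀ _ hL.ne', Real.sin_int_mul_pi]

theorem cos_waveFreq (hL : 0 < L) (n : ℤ) : Real.cos (waveFreq L n * L) = 0 := by
  rw [waveFreq, div_mul_cancel₀ _ hL.ne', Real.cos_eq_zero_iff]
  exact ⟨n, by ring⟩

theorem eq_zero_of_inner_sin_heatFreq (hL : 0 < L) {f : L2 L}
    (h : ∀ n, inner ℂ (sinL L (heatFreq L n)) f = 0) : f = 0 := by
  -- The index `1` is that of the ground state, which is positive on `(0, L)`.
  refine eq_zero_of_inner_toLp hL (s := fun n x => Real.sin (heatFreq L n * x))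
    (fun n => by fun_prop) (fun n x => ?_) (k := 1) (fun x hx => ?_)
    fun n => ⟨_, sinL_ae L _, h n⟩
  · rw [show heatFreq L (n + 1) * x = heatFreq L n * x + Real.pi * x / L by
      simp only [heatFreq]; push_cast; ring, show heatFreq L (n - 1) * x =
      heatFreq L n * x - Real.pi * x / L by simp only [heatFreq]; push_cast; ring,
      Real.sin_add, Real.sin_sub]
    ring
  · refine (Real.sin_pos_of_pos_of_lt_pi ?_ ?_).ne'
    · have := hx.1; have := Real.pi_pos; simp only [heatFreq, Int.cast_one]; positivity
    · simp only [heatFreq, Int.cast_one, one_mul]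
      rw [div_mul_eq_mul_div, div_lt_iff₀ hL]
      exact mul_lt_mul_of_pos_left hx.2 Real.pi_pos

theorem waveFreq_add_one_mul (L : ℝ) (n : ℤ) (x : ℝ) :
    waveFreq L (n + 1) * x = waveFreq L n * x + Real.pi * x / L := by
  simp only [waveFreq]; push_cast; ring

theorem waveFreq_sub_one_mul (L : ℝ) (n : ℤ) (x : ℝ) :
    waveFreq L (n - 1) * x = waveFreq L n * x - Real.pi * x / L := by
  simp only [waveFreq]; push_cast; ring

/-- At the lowest frequency `π/(2L)` both sine and cosine are positive on `(0, L)`, as the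
completeness criterion demands. -/
theorem waveFreq_zero_mul_mem (hL : 0 < L) {x : ℝ} (hx : x ∈ Ioo 0 L) :
    waveFreq L 0 * x ∈ Ioo 0 (Real.pi / 2) := by
  have h := Real.pi_pos
  have h1 : waveFreq L 0 * x = Real.pi / 2 * (x / L) := by simp only [waveFreq]; push_cast; ring
  rw [h1]
  refine ⟨by have := hx.1; positivity, ?_⟩
  have : x / L < 1 := (div_lt_one hL).2 hx.2
  nlinarith

theorem eq_zero_of_inner_sin_waveFreq (hL : 0 < L) {f : L2 L}
    (h : ∀ n, inner ℂ (sinL L (waveFreq L n)) f = 0) : f = 0 := by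
  refine eq_zero_of_inner_toLp hL (s := fun n x => Real.sin (waveFreq L n * x))
    (fun n => by fun_prop) (fun n x => ?_) (k := 0) (fun x hx => ?_)
    fun n => ⟨_, sinL_ae L _, h n⟩
  · rw [waveFreq_add_one_mul, waveFreq_sub_one_mul, Real.sin_add, Real.sin_sub]
    ring
  · have h1 := waveFreq_zero_mul_mem hL hx
    exact (Real.sin_pos_of_pos_of_lt_pi h1.1 (by linarith [h1.2, Real.pi_pos])).ne'

theorem eq_zero_of_inner_cos_waveFreq (hL : 0 < L) {f : L2 L}
    (h : ∀ n, inner ℂ (cosL L (waveFreq L n)) f = 0) : f = 0 := by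
  refine eq_zero_of_inner_toLp hL (s := fun n x => Real.cos (waveFreq L n * x))
    (fun n => by fun_prop) (fun n x => ?_) (k := 0) (fun x hx => ?_)
    fun n => ⟨_, cosL_ae L _, h n⟩
  · rw [waveFreq_add_one_mul, waveFreq_sub_one_mul, Real.cos_add, Real.cos_sub]
    ring
  · have h1 := waveFreq_zero_mul_mem hL hx
    exact (Real.cos_pos_of_mem_Ioo ⟨by linarith [h1.1, Real.pi_pos], h1.2⟩).ne'

/-- Multiplying by `ν` instead of dividing includes `ν = 0`, which occurs among the heat
frequencies. -/
theorem primitive_cos (ν x : ℝ) :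
    ν * primitive (fun s => (Real.cos (ν * s) : ℂ)) x = Real.sin (ν * x) := by
  have h : ∫ s in (0 : ℝ)..x, ν * Real.cos (ν * s) = Real.sin (ν * x) := by
    rw [intervalIntegral.integral_eq_sub_of_hasDerivAt (f := fun s => Real.sin (ν * s))]
    · simp
    · intro s _
      have h1 : HasDerivAt (fun s : ℝ => ν * s) ν s := by
        simpa using (hasDerivAt_id s).const_mul ν
      simpa [mul_comm] using h1.sin
    · exact Continuous.intervalIntegrable (by fun_prop) _ _
  rw [primitive, ← intervalIntegral.integral_const_mul, ← h, ← intervalIntegral.integral_ofReal]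
  simp

theorem primitive_sin (ν x : ℝ) :
    ν * primitive (fun s => (Real.sin (ν * s) : ℂ)) x = 1 - Real.cos (ν * x) := by
  have h : ∫ s in (0 : ℝ)..x, ν * Real.sin (ν * s) = 1 - Real.cos (ν * x) := by
    rw [intervalIntegral.integral_eq_sub_of_hasDerivAt (f := fun s => -Real.cos (ν * s))]
    · simp; ring
    · intro s _
      have h1 : HasDerivAt (fun s : ℝ => ν * s) ν s := by
        simpa using (hasDerivAt_id s).const_mul ν
      simpa [mul_comm] using h1.cos.fun_neg
    · exact Continuous.intervalIntegrable (by fun_prop) _ _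
  rw [primitive, ← intervalIntegral.integral_const_mul, ← Complex.ofReal_one, ← Complex.ofReal_sub,
    ← h, ← intervalIntegral.integral_ofReal]
  simp

theorem volterra_cosL (hL : 0 ≤ L) (ν : ℝ) :
    (ν : ℂ) • volterra hL (cosL L ν) = sinL L ν := by
  apply Lp.ext
  filter_upwards [Lp.coeFn_smul (ν : ℂ) (volterra hL (cosL L ν)), volterra_ae hL (cosL L ν),
    sinL_ae L ν, ae_restrict_mem measurableSet_Ioo] with x h1 h2 h3 hx
  rw [h1, Pi.smul_apply, h2, h3, primitive_congr (cosL_ae L ν) (Ioo_subset_Icc_self hx),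
    smul_eq_mul, primitive_cos]

theorem volterra_sinL (hL : 0 ≤ L) (ν : ℝ) :
    (ν : ℂ) • volterra hL (sinL L ν) = one L - cosL L ν := by
  apply Lp.ext
  filter_upwards [Lp.coeFn_smul (ν : ℂ) (volterra hL (sinL L ν)), volterra_ae hL (sinL L ν),
    cosL_ae L ν, one_ae L, Lp.coeFn_sub (one L) (cosL L ν), ae_restrict_mem measurableSet_Ioo]
    with x h1 h2 h3 h4 h5 hx
  rw [h1, Pi.smul_apply, h2, h5, Pi.sub_apply, h3, h4,
    primitive_congr (sinL_ae L ν) (Ioo_subset_Icc_self hx), smul_eq_mul, primitive_sin]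

theorem inner_one_cosL (hL : 0 ≤ L) (ν : ℝ) :
    ν * inner ℂ (one L) (cosL L ν) = (Real.sin (ν * L) : ℂ) := by
  rw [inner_one hL, primitive_congr (cosL_ae L ν) ⟨hL, le_rfl⟩, primitive_cos]

theorem volterraAdj_sinL (hL : 0 ≤ L) (ν : ℝ) :
    (ν : ℂ) • volterraAdj hL (sinL L ν) = cosL L ν - (Real.cos (ν * L) : ℂ) • one L := by
  rw [volterraAdj_eq, smul_sub, volterra_sinL, smul_smul, inner_one hL,
    primitive_congr (sinL_ae L ν) ⟨hL, le_rfl⟩, primitive_sin, sub_smul, one_smul]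
  abel

theorem volterraAdj_sinL_waveFreq (hL : 0 < L) (n : ℤ) :
    (waveFreq L n : ℂ) • volterraAdj hL.le (sinL L (waveFreq L n)) = cosL L (waveFreq L n) := by
  rw [volterraAdj_sinL, cos_waveFreq hL, Complex.ofReal_zero, zero_smul, sub_zero]

/-! ### Eigenvectors of the dual operator -/

/-- The state with given first component, derivative of the second, and third component. -/
def H0.mk (hL : 0 ≤ L) (f p h : L2 L) : H0 L :=
  WithLp.toLp 2 (f, WithLp.toLp 2 (H10.prim hL p, h))

theorem H0.mk_c1 (hL : 0 ≤ L) (f p h : L2 L) : (H0.mk hL f p h).c1 = f := rfl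
theorem H0.mk_c2 (hL : 0 ≤ L) (f p h : L2 L) : (H0.mk hL f p h).c2 = H10.prim hL p := rfl
theorem H0.mk_c3 (hL : 0 ≤ L) (f p h : L2 L) : (H0.mk hL f p h).c3 = h := rfl

theorem H0.smul_c1 (a : ℂ) (X : H0 L) : (a • X).c1 = a • X.c1 := rfl

theorem H0.smul_c2 (a : ℂ) (X : H0 L) : (a • X).c2 = a • X.c2 := rfl

theorem H0.smul_c3 (a : ℂ) (X : H0 L) : (a • X).c3 = a • X.c3 := rfl

/-- The eigenvectors of wave type. -/
def waveVec (hL : 0 ≤ L) (n : ℤ) : H0 L :=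
  H0.mk hL 0 (cosL L (waveFreq L n)) (-Complex.I • sinL L (waveFreq L n))

/-- With first component zero the coupling disappears and the plain wave operator remains, with
imaginary eigenvalue `iν`. -/
theorem adjointRel_waveVec (hL : 0 < L) (c : ℝ) (β : Lp ℝ ∞ (mu L)) (n : ℤ) :
    AdjointRel L c β (waveVec hL.le n) ((Complex.I * waveFreq L n) • waveVec hL.le n) := by
  rw [adjointRel_iff hL]
  simp only [waveVec, H0.smul_c1, H0.smul_c2, H0.smul_c3, H0.mk_c1, H0.mk_c2, H0.mk_c3, map_smul,
    H10.deriv_prim, smul_zero, sub_zero, map_zero, add_zero, zero_sub, map_neg]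
  refine ⟨?_, ?_, 0, by simp, by simp⟩
  · rw [← volterraAdj_sinL_waveFreq hL n, smul_smul]
    congr 1
    linear_combination (waveFreq L n : ℂ) * Complex.I_mul_I
  · rw [mul_smul, volterra_cosL, neg_smul]

/-- The operator is `1 + (rV)*(rV)`, and the positive operator `(rV)*(rV)` does not have `-1` in its
spectrum. -/
theorem exists_one_add_sq_volterra_eq (hL : 0 ≤ L) (r : ℝ) (y : L2 L) :
    ∃ p : L2 L, p + (r : ℂ) • (r : ℂ) • volterraAdj hL (volterra hL p) = y := by
  set V : L2 L →L[ℂ] L2 L := (r : ℂ) • volterra hL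
  have h1 : (-1 : ℝ) ∉ spectrum ℝ (star V * V) := fun h =>
    absurd (spectrum_star_mul_self_nonneg _ h) (by norm_num)
  have h2 : IsUnit (1 + star V * V) := by
    have h3 := (spectrum.notMem_iff.1 h1).neg
    convert! h3 using 1
    rw [map_neg, map_one]
    abel
  obtain ⟨U, hU⟩ := h2
  refine ⟨(↑U⁻¹ : L2 L →L[ℂ] L2 L) y, ?_⟩
  have h4 : (1 + star V * V) ((↑U⁻¹ : L2 L →L[ℂ] L2 L) y) = y := by
    rw [← hU, ← mul_apply_eq_comp, Units.mul_inv, one_apply_eq_self]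
  refine Eq.trans ?_ h4
  set p := (↑U⁻¹ : L2 L →L[ℂ] L2 L) y
  have h5 : star V = (r : ℂ) • volterraAdj hL := by
    rw [star_smul, ← starRingEnd_apply, Complex.conj_ofReal]
    rfl
  rw [h5]
  change _ = p + (r : ℂ) • volterraAdj hL ((r : ℂ) • volterra hL p)
  rw [map_smul]

/-- Over the sine one needs `p = g'` with `p = r V* h` and `h = V(V* b - r p)`. Eliminating `h`
gives `(1 + r² V*V) p = r V* V V* b`, solvable for every real `r`: real heat eigenvalues cause no
resonance with the wave part. -/
theorem exists_heatVec (hL : 0 < L) (c : ℝ) (β : Lp ℝ ∞ (mu L)) (n : ℤ) :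
    ∃ φ : H0 L, φ.c1 = sinL L (heatFreq L n) ∧
      AdjointRel L c β φ (((c - heatFreq L n ^ 2 : ℝ) : ℂ) • φ) := by
  set ν := heatFreq L n with hν
  set r : ℝ := c - ν ^ 2 with hr
  set b := mulOp β (sinL L ν)
  obtain ⟨p, hp⟩ := exists_one_add_sq_volterra_eq hL.le r
    ((r : ℂ) • volterraAdj hL.le (volterra hL.le (volterraAdj hL.le b)))
  refine ⟨H0.mk hL.le (sinL L ν) p (volterra hL.le (volterraAdj hL.le b - (r : ℂ) • p)), rfl, ?_⟩
  rw [adjointRel_iff hL]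
  simp only [H0.smul_c1, H0.smul_c2, H0.smul_c3, H0.mk_c1, H0.mk_c2, H0.mk_c3, map_smul,
    H10.deriv_prim]
  have hm : (ν : ℂ) • one L + volterra hL.le ((r : ℂ) • sinL L ν - (c : ℂ) • sinL L ν) =
      (ν : ℂ) • cosL L ν := by
    have : (r : ℂ) • sinL L ν - (c : ℂ) • sinL L ν = -((ν : ℂ) • (ν : ℂ) • sinL L ν) := by
      rw [← sub_smul, smul_smul, ← neg_smul, hr]
      congr 1
      push_cast
      ring
    rw [this, map_neg, map_smul, map_smul, volterra_sinL, smul_sub]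
    abel
  refine ⟨?_, rfl, ν, ?_, ?_⟩
  · rw [map_sub, map_sub, smul_sub, ← hp, map_smul, map_smul, add_sub_cancel_right]
  · rw [hm, map_smul, volterra_cosL]
  · rw [hm, inner_smul_right, inner_one_cosL hL.le, hν, sin_heatFreq hL, Complex.ofReal_zero]

theorem inner_waveVec (hL : 0 ≤ L) (n : ℤ) (X : H0 L) : inner ℂ (waveVec hL n) X =
    inner ℂ (cosL L (waveFreq L n)) (H10.deriv L X.c2) +
      Complex.I * inner ℂ (sinL L (waveFreq L n)) X.c3 := by
  rw [H0.inner_eq]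
  simp [waveVec, H0.mk_c1, H0.mk_c2, H0.mk_c3, H10.deriv_prim, inner_smul_left]

/-- Replacing `n` by `-n - 1` changes the sign of the frequency, which keeps the cosine and flips
the sine; the sum and the difference of the two relations separate the components. -/
theorem eq_zero_of_inner_waveVec (hL : 0 < L) {X : H0 L}
    (h : ∀ n, inner ℂ (waveVec hL.le n) X = 0) : H10.deriv L X.c2 = 0 ∧ X.c3 = 0 := by
  have hp : ∀ n, inner ℂ (cosL L (waveFreq L n)) (H10.deriv L X.c2) +
      Complex.I * inner ℂ (sinL L (waveFreq L n)) X.c3 = 0 := fun n => by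
    rw [← inner_waveVec hL.le, h n]
  have hm : ∀ n, inner ℂ (cosL L (waveFreq L n)) (H10.deriv L X.c2) -
      Complex.I * inner ℂ (sinL L (waveFreq L n)) X.c3 = 0 := by
    intro n
    have := hp (-n - 1)
    rw [waveFreq_neg, cosL_neg, sinL_neg, inner_neg_left] at this
    linear_combination this
  refine ⟨eq_zero_of_inner_cos_waveFreq hL fun n => ?_,
    eq_zero_of_inner_sin_waveFreq hL fun n => ?_⟩
  · linear_combination (1 / 2) * hp n + (1 / 2) * hm n
  · have h4 : Complex.I * inner ℂ (sinL L (waveFreq L n)) X.c3 = 0 := by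
      linear_combination (1 / 2) * hp n - (1 / 2) * hm n
    exact (mul_eq_zero.1 h4).resolve_left Complex.I_ne_zero

theorem H0.eq_zero {X : H0 L} (h1 : X.c1 = 0) (h2 : H10.deriv L X.c2 = 0) (h3 : X.c3 = 0) :
    X = 0 := by
  have h4 : ‖X‖ ^ 2 = 0 := by rw [H0.norm_sq_eq, h1, h3, H10.norm_def, h2]; simp
  exact norm_eq_zero.1 (pow_eq_zero_iff two_ne_zero |>.1 h4)

/-- The dual operator has a complete system of eigenvectors. -/
theorem exists_eigenvectors (hL : 0 < L) (c : ℝ) (β : Lp ℝ ∞ (mu L)) :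
    ∃ (e : ℤ ⊕ ℤ → H0 L) (l : ℤ ⊕ ℤ → ℂ), (∀ i, (e i, l i • e i) ∈ adjointGraph L c β) ∧
      DenseRange (Finsupp.linearCombination ℂ e) := by
  choose w hw1 hw using exists_heatVec hL c β
  refine ⟨Sum.elim w (waveVec hL.le), Sum.elim (fun n => ((c - heatFreq L n ^ 2 : ℝ) : ℂ))
    (fun n => Complex.I * waveFreq L n), ?_, ?_⟩
  · rintro (n | n)
    · exact hw n
    · exact adjointRel_waveVec hL c β n
  have := H10.completeSpace hL.le
  have hsp : (Submodule.span ℂ (range (Sum.elim w (waveVec hL.le)))).topologicalClosure = ⊤ := by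
    rw [Submodule.topologicalClosure_eq_top_iff, Submodule.eq_bot_iff]
    intro X hX
    have hX' : ∀ i, inner ℂ (Sum.elim w (waveVec hL.le) i) X = 0 := fun i =>
      (Submodule.mem_orthogonal _ _).1 hX _ (Submodule.subset_span ⟨i, rfl⟩)
    -- The system is triangular: wave vectors eliminate the last two components, after which heat
    -- vectors only see their sine.
    obtain ⟨h2, h3⟩ := eq_zero_of_inner_waveVec hL fun n => hX' (Sum.inr n)
    have h1 : X.c1 = 0 := eq_zero_of_inner_sin_heatFreq hL fun n => by
      have := hX' (Sum.inl n)
      rw [Sum.elim_inl, H0.inner_eq, h2, h3, hw1] at this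
      simpa using this
    exact H0.eq_zero h1 h2 h3
  have h5 := Submodule.dense_iff_topologicalClosure_eq_top.2 hsp
  rw [← Finsupp.range_linearCombination] at h5
  exact h5

/-! ### Well-posedness of the control system -/

theorem continuousOn_dual_sub {E : Type*} [SeminormedAddCommGroup E] [NormedSpace ℂ E]
    {X Y : ℝ → E →L⋆[ℂ] ℂ} {s : Set ℝ} (hX : ContinuousOn X s) (hY : ContinuousOn Y s) :
    ContinuousOn (fun t => X t - Y t) s :=
  hX.sub hY

/-- A scalar continuous function dominating the increments gives continuity in the operator norm,
though each functional is only tested pointwise. -/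
theorem continuousOn_dual_of_norm_apply_le {E : Type*} [SeminormedAddCommGroup E]
    [NormedSpace ℂ E] {X : ℝ → E →L⋆[ℂ] ℂ} {s : Set ℝ} {B : ℝ → ℝ} (hB : ContinuousOn B s)
    (h : ∀ a ∈ s, ∀ b ∈ s, ∀ p, ‖X a p - X b p‖ ≤ |B a - B b| * ‖p‖) : ContinuousOn X s := by
  intro t ht
  refine tendsto_iff_dist_tendsto_zero.2 (squeeze_zero' (.of_forall fun _ => dist_nonneg) ?_
    (tendsto_iff_dist_tendsto_zero.1 (hB t ht)))
  filter_upwards [self_mem_nhdsWithin] with r hr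
  rw [dist_eq_norm]
  exact ContinuousLinearMap.opNorm_le_bound _ dist_nonneg fun p => h r hr t ht p

theorem isStrongDualSolution_traj {c : ℝ} {β : Lp ℝ ∞ (mu L)} {ι : Type*} {e : ι → H0 L}
    {l : ι → ℂ} (he : ∀ i, (e i, l i • e i) ∈ adjointGraph L c β) (T : ℝ) (a : ι →₀ ℂ) :
    IsStrongDualSolution L c β T (fun t => traj e l t a)
      fun t => traj (fun i => l i • e i) l t a where
  hasDeriv t _ := (hasDerivAt_traj e l a t).hasDerivWithinAt
  cont_deriv := (continuous_traj _ l a).continuousOn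
  eqn t _ := traj_mem he t a

theorem embed_apply {c : ℝ} {β : Lp ℝ ∞ (mu L)} (X : H0 L) (p : adjointGraph L c β) :
    embed L c β X p = inner ℂ (p : H0 L × H0 L).1 X := rfl

/-- Uniqueness holds among all curves in the extrapolation space, so one solution with values in
`ℋ⁰` forces every solution to have values there. -/
theorem wellPosed (hL : 0 < L) (c : ℝ) (β : Lp ℝ ∞ (mu L)) : WellPosed L c β := by
  intro T hT X₀ u hu
  obtain ⟨e, l, he, hdense⟩ := exists_eigenvectors hL c β
  have hG : ∀ p ∈ adjointGraph L c β, (inner ℂ p.1 p.2).re ≤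
      (|c| + ‖volterraAdj hL.le ∘L mulOp β‖) * ‖p.1‖ ^ 2 := fun p hp =>
    AdjointRel.re_inner_le hL hp
  have h0T : (0 : ℝ) ∈ Icc 0 T := ⟨le_rfl, hT.le⟩
  have hui : IntervalIntegrable u volume 0 T :=
    intervalIntegrable_of_mu (hu.integrable (by norm_num)) h0T ⟨hT.le, le_rfl⟩
  have hsub : ∀ {t}, t ∈ Icc 0 T → uIcc 0 t ⊆ Icc 0 T := fun ht => by
    rw [uIcc_of_le ht.1]; exact Icc_subset_Icc_right ht.2
  have hut : ∀ {t}, t ∈ Icc 0 T → IntervalIntegrable u volume 0 t := fun ht =>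
    hui.mono_set (by rw [uIcc_of_le hT.le]; exact hsub ht)
  have huniq : ∀ X Y, IsControlSolution L c β T X₀ u X → IsControlSolution L c β T X₀ u Y →
      EqOn X Y (Icc 0 T) := by
    intro X Y hX hY t ht
    have hc : ContinuousOn (fun t => X t - Y t) (Icc 0 T) :=
      continuousOn_dual_sub hX.cont hY.cont
    refine sub_eq_zero.1 (eq_zero_of_transposed_equation he hG hdense hc ?_ ht)
    intro p q hpq t ht
    have hv := AdjointRel.hasValueAtEnd hL p.2
    set v := observe hL.le β ((p : H0 L × H0 L).1, (p : H0 L × H0 L).2)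
    have hci : ∀ {W : ℝ → Extrap L c β}, ContinuousOn W (Icc 0 T) →
        IntervalIntegrable (fun s => W s q + u s * conj v) volume 0 t := fun hW =>
      ((((continuous_eval_const q).comp_continuousOn hW).mono (hsub ht)).intervalIntegrable).add
        ((hut ht).mul_const _)
    rw [sub_apply, hX.eqn p q hpq v hv t ht, hY.eqn p q hpq v hv t ht,
      hX.init, hY.init, add_sub_add_left_eq_sub,
      ← intervalIntegral.integral_sub (hci hX.cont) (hci hY.cont)]
    simp
  have hexist : ∃ x : ℝ → H0 L, IsControlSolution L c β T X₀ u fun t => embed L c β (x t) := by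
    have := H10.completeSpace hL.le
    obtain ⟨K, hK, hadm⟩ := exists_admissible hL c β hT
    obtain ⟨x, M, hM, hxM, hx0, hweak, hxeq⟩ := exists_mild_solution he hG hdense
      (observe hL.le β) hT hK.le (fun a => hadm _ _ (isStrongDualSolution_traj he T a)) X₀ hu
    set C := observe hL.le β with hC
    have heq : ∀ p ∈ adjointGraph L c β, ∀ t ∈ Icc 0 T, inner ℂ p.1 (x t) =
        inner ℂ p.1 X₀ + ∫ s in (0 : ℝ)..t, (inner ℂ p.2 (x s) + u s * conj (C p)) := by
      intro p hp t ht
      rw [← inner_conj_symm, hxeq p hp t ht, map_add, inner_conj_symm]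
      congr 1
      rw [intervalIntegral, intervalIntegral, map_sub, ← integral_conj, ← integral_conj]
      simp
    have hint : ∀ p : H0 L × H0 L, ∀ {t}, t ∈ Icc 0 T →
        IntervalIntegrable (fun s => inner ℂ p.2 (x s) + u s * conj (C p)) volume 0 t := by
      intro p t ht
      refine IntervalIntegrable.add ?_ ((hut ht).mul_const _)
      have := Complex.continuous_conj.comp_continuousOn ((hweak p.2).mono (hsub ht))
      simp only [Function.comp_def, inner_conj_symm] at this
      exact this.intervalIntegrable
    refine ⟨x, ?_, by rw [hx0], ?_⟩
    -- The equation bounds the increments of `⟨x, φ⟩` by those of this primitive times the graph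
    -- norm. Hence continuity in `D(𝒜₀*)'` is in norm, while `x` is only known to be bounded and
    -- weakly continuous in `ℋ⁰`.
    · set B : ℝ → ℝ := fun t => ∫ s in (0 : ℝ)..t, (M + ‖u s‖ * ‖C‖) with hB
      have hbi : ∀ {t}, t ∈ Icc 0 T →
          IntervalIntegrable (fun s => M + ‖u s‖ * ‖C‖) volume 0 t := fun ht =>
        intervalIntegrable_const.add ((hut ht).norm.mul_const _)
      have hBc : ContinuousOn B (Icc 0 T) := by
        have h1 := (hbi (t := T) ⟨hT.le, le_rfl⟩)
        have := h1.absolutelyContinuousOnInterval_intervalIntegral (c := 0) left_mem_uIcc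
        have := this.continuousOn
        rwa [uIcc_of_le hT.le] at this
      refine continuousOn_dual_of_norm_apply_le hBc fun s hs t ht p => ?_
      rw [embed_apply, embed_apply, heq p p.2 s hs, heq p p.2 t ht, add_sub_add_left_eq_sub,
        intervalIntegral.integral_interval_sub_left (hint _ hs) (hint _ ht), hB]
      beta_reduce
      rw [intervalIntegral.integral_interval_sub_left (hbi hs) (hbi ht), ← abs_norm p,
        ← abs_mul, ← intervalIntegral.integral_mul_const]
      refine intervalIntegral.norm_integral_le_abs_of_norm_le ?_
        (((hbi ht).symm.trans (hbi hs)).mul_const _)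
      refine (ae_restrict_mem measurableSet_uIoc).mono fun r hr => ?_
      have hr' : r ∈ Icc 0 T := (uIcc_subset_Icc ht hs) (uIoc_subset_uIcc hr)
      refine (norm_add_le _ _).trans ?_
      rw [add_mul]
      refine add_le_add ?_ ?_
      · refine (norm_inner_le_norm _ _).trans ?_
        rw [mul_comm]
        exact mul_le_mul (hxM r hr') (norm_snd_le (p : H0 L × H0 L)) (norm_nonneg _) hM
      · rw [norm_mul, RCLike.norm_conj, mul_assoc]
        exact mul_le_mul_of_nonneg_left (C.le_opNorm _) (norm_nonneg _)
    · intro p q hpq v hv t ht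
      have hv' : v = C p := hv.unique hL (AdjointRel.hasValueAtEnd hL p.2)
      simp only [embed_apply, hpq, hv', hx0]
      exact heq p p.2 t ht
  obtain ⟨x, hx⟩ := hexist
  exact ⟨⟨_, hx⟩, huniq, fun X hX t ht => ⟨x t, huniq X _ hX hx ht⟩⟩

/-! ### The boundary trace of strong solutions -/

/-- Testing `ψ₃ = -g''` with `g` itself gives `‖g'‖² = ⟨g, ψ₃⟩`. This puts the `H⁻¹₍₀₎` norm of the
velocity in place of the norm of the second component. -/
theorem AdjointRel.norm_c2_le (hL : 0 < L) {c : ℝ} {β : Lp ℝ ∞ (mu L)} {φ ψ : H0 L}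
    (h : AdjointRel L c β φ ψ) : ‖φ.c2‖ ≤ ‖pivot L ψ.c3‖ := by
  have h1 : pivot L ψ.c3 φ.c2 = inner ℂ φ.c2 φ.c2 := by
    change inner ℂ (H10.toL2 L φ.c2) ψ.c3 = _
    rw [H10.toL2_eq hL.le, inner_volterra_left, ← ((adjointRel_iff hL).1 h).1, H10.inner_eq]
  rcases eq_or_ne φ.c2 0 with h0 | h0
  · rw [h0, norm_zero]; exact norm_nonneg (pivot L ψ.c3)
  have h2 := (pivot L ψ.c3).le_opNorm φ.c2
  rw [h1, inner_self_eq_norm_sq_to_K, norm_pow] at h2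
  simp only [Complex.coe_algebraMap, Complex.norm_real, norm_norm] at h2
  exact le_of_mul_le_mul_right (by rwa [sq] at h2) (norm_pos_iff.2 h0)

theorem IsStrongDualSolution.trace (hL : 0 < L) {c : ℝ} {β : Lp ℝ ∞ (mu L)} {T K : ℝ}
    (hT : 0 < T) (hK : 0 < K) (hadm : ∀ X X' : ℝ → H0 L, IsStrongDualSolution L c β T X X' →
      ∫ t in (0 : ℝ)..T, ‖observe hL.le β (X t, X' t)‖ ^ 2 ≤ K * ‖X 0‖ ^ 2)
    {X X' : ℝ → H0 L} (hX : IsStrongDualSolution L c β T X X') :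
    ∃ o : ℝ → ℂ, ContinuousOn o (Icc 0 T) ∧
      (∀ t ∈ Icc 0 T, HasValueAtEnd L (X t).c3 (o t)) ∧
      ∫ t in (0 : ℝ)..T, ‖o t‖ ^ 2 ≤
        K * (‖(X 0).c1‖ ^ 2 + ‖(X 0).c3‖ ^ 2 + ‖pivot L (X' 0).c3‖ ^ 2) := by
  have hXc : ContinuousOn X (Icc 0 T) := fun t ht => (hX.hasDeriv t ht).continuousWithinAt
  refine ⟨fun t => observe hL.le β (X t, X' t),
    (observe hL.le β).continuous.comp_continuousOn (hXc.prodMk hX.cont_deriv),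
    fun t ht => (hX.eqn t ht).hasValueAtEnd hL, (hadm X X' hX).trans ?_⟩
  have h1 := (hX.eqn 0 ⟨le_rfl, hT.le⟩).norm_c2_le hL
  have h2 : ‖(X 0).c2‖ ^ 2 ≤ ‖pivot L (X' 0).c3‖ ^ 2 := by gcongr
  rw [H0.norm_sq_eq]
  refine mul_le_mul_of_nonneg_left ?_ hK.le
  linarith

/-! ### Solutions in terms of their Fourier coefficients -/

/-- The evolution equations satisfied by the Fourier coefficients of a solution of the dual
system. -/
structure IsSpectralSolution (hL : 0 ≤ L) (c : ℝ) (β : Lp ℝ ∞ (mu L)) (T : ℝ) (X : ℝ → H0 L) :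
    Prop where
  heat : ∀ n, ∀ t ∈ Icc 0 T, HasDerivWithinAt (fun s => inner ℂ (sinL L (heatFreq L n)) (X s).c1)
    (((c - heatFreq L n ^ 2 : ℝ) : ℂ) * inner ℂ (sinL L (heatFreq L n)) (X t).c1) (Icc 0 T) t
  wave : ∀ n, ∀ t ∈ Icc 0 T, HasDerivWithinAt (fun s => inner ℂ (waveVec hL n) (X s))
    (Complex.I * waveFreq L n * inner ℂ (waveVec hL n) (X t) +
      inner ℂ (volterra hL (cosL L (waveFreq L n))) (mulOp β (X t).c1)) (Icc 0 T) t

theorem HasDerivWithinAt.clm_apply_complex {E F : Type*} [NormedAddCommGroup E] [NormedSpace ℂ E]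
    [NormedAddCommGroup F] [NormedSpace ℂ F] (A : E →L[ℂ] F) {X : ℝ → E} {X' : E} {s : Set ℝ}
    {t : ℝ} (h : HasDerivWithinAt X X' s t) : HasDerivWithinAt (fun r => A (X r)) (A X') s t :=
  (A.restrictScalars ℝ).hasFDerivAt.comp_hasDerivWithinAt t h

/-- Two integrations by parts; the boundary terms vanish because `sin(νL) = 0` and because `f'` is
orthogonal to `1`. The heat coefficients thus form closed scalar equations. -/
theorem AdjointRel.inner_sinL (hL : 0 < L) {c : ℝ} {β : Lp ℝ ∞ (mu L)} {φ ψ : H0 L}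
    (h : AdjointRel L c β φ ψ) (n : ℤ) : inner ℂ (sinL L (heatFreq L n)) ψ.c1 =
      ((c - heatFreq L n ^ 2 : ℝ) : ℂ) * inner ℂ (sinL L (heatFreq L n)) φ.c1 := by
  obtain ⟨-, -, a, h1, h1'⟩ := (adjointRel_iff hL).1 h
  set w : L2 L := ψ.c1 - (c : ℂ) • φ.c1 with hw
  set m : L2 L := a • one L + volterra hL.le w with hm
  set ν := heatFreq L n with hν
  clear_value w m
  have j1 : ψ.c1 = w + (c : ℂ) • φ.c1 := by rw [hw, sub_add_cancel]
  have j2 : volterra hL.le w = m - a • one L := by rw [hm, add_sub_cancel_left]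
  have j3 : (ν : ℂ) * inner ℂ (cosL L ν) (one L) = 0 := by
    have := congrArg conj (inner_one_cosL hL.le ν)
    rw [map_mul, inner_conj_symm, Complex.conj_ofReal, Complex.conj_ofReal, hν, sin_heatFreq hL,
      Complex.ofReal_zero] at this
    exact this
  have j4 : inner ℂ (sinL L ν) w = -(ν : ℂ) * inner ℂ (cosL L ν) m := by
    rw [← volterra_cosL hL.le, inner_smul_left, inner_volterra_left, volterraAdj_eq, j2,
      inner_sub_right, inner_sub_right, inner_smul_right, inner_smul_right, Complex.conj_ofReal]
    linear_combination (inner ℂ (one L) w + a) * j3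
  have j5 : (ν : ℂ) * inner ℂ (sinL L ν) φ.c1 = inner ℂ (cosL L ν) m := by
    have h2 : (ν : ℂ) * inner ℂ (sinL L ν) φ.c1 =
        inner ℂ ((ν : ℂ) • volterraAdj hL.le (sinL L ν)) m := by
      rw [h1, inner_volterra_right, inner_smul_left, Complex.conj_ofReal]
    rw [h2, volterraAdj_sinL, inner_sub_left, inner_smul_left, h1', mul_zero, sub_zero]
  rw [j1, inner_add_right, j4, inner_smul_right, ← j5]
  push_cast
  ring

/-- Skewness moves the wave operator onto its eigenvector; the coupling remains as a source
depending on the first component alone. -/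
theorem AdjointRel.inner_waveVec (hL : 0 < L) {c : ℝ} {β : Lp ℝ ∞ (mu L)} {φ ψ : H0 L}
    (h : AdjointRel L c β φ ψ) (n : ℤ) : inner ℂ (waveVec hL.le n) ψ =
      Complex.I * waveFreq L n * inner ℂ (waveVec hL.le n) φ +
        inner ℂ (volterra hL.le (cosL L (waveFreq L n))) (mulOp β φ.c1) := by
  obtain ⟨h2, h3, -⟩ := (adjointRel_iff hL).1 h
  set k : L2 L := volterraAdj hL.le (mulOp β φ.c1) - H10.deriv L ψ.c2 with hk
  set ν := waveFreq L n with hν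
  clear_value k
  have j1 : H10.deriv L ψ.c2 = volterraAdj hL.le (mulOp β φ.c1) - k := by
    rw [hk, sub_sub_cancel]
  have j2 : (ν : ℂ) * inner ℂ (sinL L ν) φ.c3 = inner ℂ (cosL L ν) k := by
    rw [← volterraAdj_sinL_waveFreq hL n, inner_smul_left, Complex.conj_ofReal, h3,
      inner_volterra_right]
  have j3 : inner ℂ (sinL L ν) ψ.c3 = (ν : ℂ) * inner ℂ (cosL L ν) (H10.deriv L φ.c2) := by
    rw [← volterra_cosL hL.le, inner_smul_left, Complex.conj_ofReal, inner_volterra_left, h2]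
  rw [Cascade.inner_waveVec, Cascade.inner_waveVec, j1, j3, inner_sub_right, ← inner_volterra_left,
    ← j2]
  linear_combination (-(ν : ℂ) * inner ℂ (sinL L ν) φ.c3) * Complex.I_mul_I

theorem IsStrongDualSolution.isSpectralSolution (hL : 0 < L) {c : ℝ} {β : Lp ℝ ∞ (mu L)} {T : ℝ}
    {X X' : ℝ → H0 L} (hX : IsStrongDualSolution L c β T X X') :
    IsSpectralSolution hL.le c β T X where
  heat n t ht := by
    rw [← (hX.eqn t ht).inner_sinL hL n]
    exact HasDerivWithinAt.clm_apply_complex (innerSL ℂ (sinL L (heatFreq L n)) ∘L H0.fst1 L)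
      (hX.hasDeriv t ht)
  wave n t ht := by
    rw [← (hX.eqn t ht).inner_waveVec hL n]
    exact HasDerivWithinAt.clm_apply_complex (innerSL ℂ (waveVec hL.le n)) (hX.hasDeriv t ht)

/-- A solution of the equations for the Fourier coefficients is the limit of the strong solutions
whose initial values converge to its own. -/
theorem IsSpectralSolution.norm_sub_le (hL : 0 < L) {c : ℝ} {β : Lp ℝ ∞ (mu L)} {T : ℝ}
    {X : ℝ → H0 L} (hX : IsSpectralSolution hL.le c β T X) {M : ℝ} {Y : ℕ → ℝ → H0 L}
    (hY : ∀ n, IsSpectralSolution hL.le c β T (Y n))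
    (hM : ∀ m n, ∀ t ∈ Icc 0 T, ‖Y m t - Y n t‖ ≤ M * ‖Y m 0 - Y n 0‖)
    (h0 : Filter.Tendsto (fun n => Y n 0) Filter.atTop (nhds (X 0))) (n : ℕ) :
    ∀ t ∈ Icc 0 T, ‖Y n t - X t‖ ≤ M * ‖Y n 0 - X 0‖ := by
  have := H10.completeSpace hL.le
  have hex : ∀ t, ∃ z : H0 L, t ∈ Icc 0 T →
      Filter.Tendsto (fun n => Y n t) Filter.atTop (nhds z) := by
    intro t
    by_cases ht : t ∈ Icc 0 T
    · have hc : CauchySeq fun n => Y n t := by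
        rw [Metric.cauchySeq_iff]
        intro ε hε
        obtain ⟨N, hN⟩ := Metric.cauchySeq_iff.1 h0.cauchySeq (ε / (|M| + 1)) (by positivity)
        refine ⟨N, fun m hm k hk => ?_⟩
        have h1 := hN m hm k hk
        rw [dist_eq_norm] at h1 ⊢
        calc ‖Y m t - Y k t‖ ≤ M * ‖Y m 0 - Y k 0‖ := hM m k t ht
          _ ≤ (|M| + 1) * ‖Y m 0 - Y k 0‖ := by gcongr; linarith [le_abs_self M]
          _ < (|M| + 1) * (ε / (|M| + 1)) := by gcongr
          _ = ε := by field_simp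
      obtain ⟨z, hz⟩ := cauchySeq_tendsto_of_complete hc
      exact ⟨z, fun _ => hz⟩
    · exact ⟨0, fun h => absurd h ht⟩
  choose Z hZ using hex
  have hYZ : ∀ n, ∀ t ∈ Icc 0 T, ‖Y n t - Z t‖ ≤ M * ‖Y n 0 - X 0‖ := fun n t ht =>
    le_of_tendsto_of_tendsto' ((tendsto_const_nhds.sub (hZ t ht)).norm)
      ((tendsto_const_nhds.sub h0).norm.const_mul M) fun m => hM n m t ht
  have hδ : Filter.Tendsto (fun n => ‖X 0 - Y n 0‖) Filter.atTop (nhds 0) := by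
    simpa using (tendsto_const_nhds (x := X 0)).sub h0 |>.norm
  -- The heat coefficients are compared first, since their equations contain no other unknown.
  have h1 : ∀ t ∈ Icc 0 T, (X t).c1 = (Z t).c1 := by
    intro t ht
    refine sub_eq_zero.1 (eq_zero_of_inner_sin_heatFreq hL fun k => ?_)
    set S := sinL L (heatFreq L k)
    set κ : ℂ := ((c - heatFreq L k ^ 2 : ℝ) : ℂ)
    set A : ℝ := Real.exp (‖κ‖ * T)
    have hb : ∀ n, ‖inner ℂ S ((X t).c1 - (Y n t).c1)‖ ≤ A * (‖S‖ * ‖X 0 - Y n 0‖) := by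
      intro n
      have hd := norm_le_of_scalar_ode (w := fun s => inner ℂ S (X s).c1 - inner ℂ S (Y n s).c1)
        (F := fun _ => 0) (κ := κ) (ε := 0) (T := T) (fun s hs => by
          convert! (hX.heat k s hs).sub ((hY n).heat k s hs) using 1
          ring) (fun _ _ => by simp) ht
      rw [inner_sub_right]
      refine hd.trans ?_
      rw [mul_zero, zero_mul, add_zero, ← inner_sub_right]
      refine mul_le_mul_of_nonneg_left ((norm_inner_le_norm _ _).trans ?_) (Real.exp_nonneg _)
      exact mul_le_mul_of_nonneg_left (H0.norm_c1_le (X 0 - Y n 0)) (norm_nonneg _)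
    have hl : Filter.Tendsto (fun n => ‖inner ℂ S ((X t).c1 - (Y n t).c1)‖) Filter.atTop
        (nhds ‖inner ℂ S ((X t).c1 - (Z t).c1)‖) :=
      (tendsto_const_nhds.inner (tendsto_const_nhds.sub
        (((H0.fst1 L).continuous.tendsto _).comp (hZ t ht)))).norm
    have hr : Filter.Tendsto (fun n => A * (‖S‖ * ‖X 0 - Y n 0‖)) Filter.atTop (nhds 0) := by
      simpa using (hδ.const_mul ‖S‖).const_mul A
    exact norm_le_zero_iff.1 (le_of_tendsto_of_tendsto' hl hr hb)
  have h23 : ∀ t ∈ Icc 0 T, ∀ k, inner ℂ (waveVec hL.le k) (X t - Z t) = 0 := by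
    intro t ht k
    set S := waveVec hL.le k
    set κ : ℂ := Complex.I * waveFreq L k
    set A : ℝ := Real.exp (‖κ‖ * T)
    set R : L2 L := volterra hL.le (cosL L (waveFreq L k))
    set B : ℝ := ‖R‖ * (‖mulOp β‖ * M)
    -- The first components of `X` and `Z` are now known to agree, so the source in the wave
    -- equations tends to zero uniformly in time.
    have hF : ∀ n, ∀ s ∈ Icc 0 T, ‖inner ℂ R (mulOp β (X s).c1) - inner ℂ R (mulOp β (Y n s).c1)‖
        ≤ B * ‖X 0 - Y n 0‖ := by
      intro n s hs
      rw [← inner_sub_right, ← map_sub, mul_assoc, mul_assoc]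
      refine (norm_inner_le_norm _ _).trans (mul_le_mul_of_nonneg_left ?_ (norm_nonneg _))
      refine ((mulOp β).le_opNorm _).trans (mul_le_mul_of_nonneg_left ?_ (norm_nonneg _))
      rw [h1 s hs, norm_sub_rev, norm_sub_rev (X 0)]
      exact (H0.norm_c1_le (Y n s - Z s)).trans (hYZ n s hs)
    have hb : ∀ n, ‖inner ℂ S (X t - Y n t)‖ ≤
        A * (‖S‖ * ‖X 0 - Y n 0‖ + A * (B * ‖X 0 - Y n 0‖) * T) := by
      intro n
      have hd := norm_le_of_scalar_ode (w := fun s => inner ℂ S (X s) - inner ℂ S (Y n s))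
        (F := fun s => inner ℂ R (mulOp β (X s).c1) - inner ℂ R (mulOp β (Y n s).c1)) (κ := κ)
        (ε := B * ‖X 0 - Y n 0‖) (T := T) (fun s hs => by
          convert! (hX.wave k s hs).sub ((hY n).wave k s hs) using 1
          ring) (hF n) ht
      rw [inner_sub_right]
      refine hd.trans ?_
      rw [← inner_sub_right]
      refine mul_le_mul_of_nonneg_left ?_ (Real.exp_nonneg _)
      exact add_le_add (norm_inner_le_norm _ _) le_rfl
    have hl : Filter.Tendsto (fun n => ‖inner ℂ S (X t - Y n t)‖) Filter.atTop
        (nhds ‖inner ℂ S (X t - Z t)‖) :=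
      (tendsto_const_nhds.inner (tendsto_const_nhds.sub (hZ t ht))).norm
    have hr : Filter.Tendsto (fun n => A * (‖S‖ * ‖X 0 - Y n 0‖ +
        A * (B * ‖X 0 - Y n 0‖) * T)) Filter.atTop (nhds 0) := by
      simpa using ((hδ.const_mul ‖S‖).add (((hδ.const_mul B).const_mul A).mul_const T)).const_mul A
    exact norm_le_zero_iff.1 (le_of_tendsto_of_tendsto' hl hr hb)
  intro t ht
  have h2 := eq_zero_of_inner_waveVec hL (h23 t ht)
  have h3 : X t = Z t :=
    sub_eq_zero.1 (H0.eq_zero (sub_eq_zero.2 (h1 t ht)) h2.1 h2.2)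
  rw [h3]
  exact hYZ n t ht

/-! ### The boundary trace of weak solutions -/

theorem norm_toLp_sq {T : ℝ} (hT : 0 ≤ T) {o : ℝ → ℂ} (ho : MemLp o 2 (mu T)) :
    ‖ho.toLp o‖ ^ 2 = ∫ t in (0 : ℝ)..T, ‖o t‖ ^ 2 := by
  have h1 : inner ℂ (ho.toLp o) (ho.toLp o) = ((∫ t in (0 : ℝ)..T, ‖o t‖ ^ 2 : ℝ) : ℂ) := by
    rw [L2_inner_eq, ← intervalIntegral.integral_ofReal, ← L2_integral_eq hT]
    refine integral_congr_ae ?_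
    filter_upwards [ho.coeFn_toLp] with t h
    rw [h, RCLike.conj_mul]
    norm_cast
  rw [← re_inner_self, h1, Complex.ofReal_re]

theorem norm_primitive_le (k : L2 L) {x : ℝ} (hx : x ∈ Icc 0 L) :
    ‖primitive k x‖ ≤ ((mu L).real univ) ^ ((1 : ℝ) / 2) * ‖k‖ := by
  refine le_trans ?_ (L2_integral_norm_le k)
  refine (intervalIntegral.norm_integral_le_integral_norm hx.1).trans ?_
  rw [intervalIntegral.integral_of_le hx.1, integral_Ioc_eq_integral_Ioo]
  exact setIntegral_mono_set (L2_integrable _).norm (.of_forall fun _ => norm_nonneg _)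
    (.of_forall fun s hs => ⟨hs.1, hs.2.trans_le hx.2⟩)

theorem tendsto_primitive {k : ℕ → L2 L} {k₀ : L2 L}
    (h : Filter.Tendsto k Filter.atTop (nhds k₀)) {x : ℝ} (hx : x ∈ Icc 0 L) :
    Filter.Tendsto (fun n => primitive (k n) x) Filter.atTop (nhds (primitive k₀ x)) := by
  have h0 : (0 : ℝ) ∈ Icc 0 L := ⟨le_rfl, hx.1.trans hx.2⟩
  have hsub : ∀ n, primitive (k n) x - primitive k₀ x = primitive (k n - k₀ : L2 L) x := fun n => by
    rw [primitive_congr (Lp.coeFn_sub (k n) k₀) hx]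
    exact (intervalIntegral.integral_sub (intervalIntegrable_of_mu (L2_integrable _) h0 hx)
      (intervalIntegrable_of_mu (L2_integrable _) h0 hx)).symm
  rw [tendsto_iff_norm_sub_tendsto_zero] at h ⊢
  refine squeeze_zero (fun _ => norm_nonneg _) (fun n => ?_)
    (by simpa only [mul_zero] using h.const_mul (((mu L).real univ) ^ ((1 : ℝ) / 2)))
  rw [hsub]
  exact norm_primitive_le _ hx

/-- The trace is the `L²(0,T)` limit of the traces of finite trajectories. It is identified after
integration in time, where no derivative of `X` is needed. -/
theorem IsSpectralSolution.exists_boundaryTrace (hL : 0 < L) {c : ℝ} {β : Lp ℝ ∞ (mu L)}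
    {T K : ℝ} (hT : 0 < T) (hadm : ∀ X X' : ℝ → H0 L, IsStrongDualSolution L c β T X X' →
      ∫ t in (0 : ℝ)..T, ‖observe hL.le β (X t, X' t)‖ ^ 2 ≤ K * ‖X 0‖ ^ 2)
    {X : ℝ → H0 L} (hXc : ContinuousOn X (Icc 0 T)) (hX : IsSpectralSolution hL.le c β T X) :
    ∃ o : ℝ → ℂ, MemLp o 2 (mu T) ∧ IsBoundaryTrace L T (fun t => (X t).c3) o ∧
      ∫ t in (0 : ℝ)..T, ‖o t‖ ^ 2 ≤ K * ‖X 0‖ ^ 2 := by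
  have := H10.completeSpace hL.le
  obtain ⟨e, l, he, hdense⟩ := exists_eigenvectors hL c β
  obtain ⟨y, hy, hy0⟩ := mem_closure_iff_seq_limit.1 (hdense (X 0))
  choose a ha using hy
  set Y : ℕ → ℝ → H0 L := fun n t => traj e l t (a n) with hY
  set Y' : ℕ → ℝ → H0 L := fun n t => traj (fun i => l i • e i) l t (a n) with hY'
  have hstrong : ∀ n, IsStrongDualSolution L c β T (Y n) (Y' n) := fun n =>
    isStrongDualSolution_traj he T (a n)
  have hY0 : Filter.Tendsto (fun n => Y n 0) Filter.atTop (nhds (X 0)) := by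
    simpa only [hY, traj_zero, ha] using hy0
  set ω : ℝ := |c| + ‖volterraAdj hL.le ∘L mulOp β‖ with hω
  have hω0 : 0 ≤ ω := by positivity
  have hYX : ∀ n, ∀ t ∈ Icc 0 T, ‖Y n t - X t‖ ≤ Real.exp (ω * T) * ‖Y n 0 - X 0‖ := by
    refine hX.norm_sub_le hL (fun n => (hstrong n).isSpectralSolution hL) ?_ hY0
    intro m n t ht
    simp only [hY, ← map_sub]
    refine (norm_traj_le he (fun p hp => AdjointRel.re_inner_le hL hp) ht.1 _).trans ?_
    gcongr
    exact ht.2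
  have hδ : Filter.Tendsto (fun n => Real.exp (ω * T) * ‖Y n 0 - X 0‖) Filter.atTop (nhds 0) := by
    simpa using ((hY0.sub_const (X 0)).norm).const_mul (Real.exp (ω * T))
  have hYt : ∀ t ∈ Icc 0 T, Filter.Tendsto (fun n => Y n t) Filter.atTop (nhds (X t)) :=
    fun t ht => tendsto_iff_norm_sub_tendsto_zero.2
      (squeeze_zero (fun _ => norm_nonneg _) (fun n => hYX n t ht) hδ)
  have hYc : ∀ n, Continuous (Y n) := fun n => continuous_traj e l (a n)
  have hYc' : ∀ n, Continuous (Y' n) := fun n => continuous_traj _ l (a n)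
  set o : ℕ → ℝ → ℂ := fun n t => observe hL.le β (Y n t, Y' n t) with ho
  have hoc : ∀ n, Continuous (o n) := fun n =>
    (observe hL.le β).continuous.comp ((hYc n).prodMk (hYc' n))
  have hom : ∀ n, MemLp (o n) 2 (mu T) := fun n => memLp_of_continuousOn (hoc n).continuousOn 2
  have hK : ∀ n, ‖(hom n).toLp (o n)‖ ^ 2 ≤ K * ‖Y n 0‖ ^ 2 := fun n => by
    rw [norm_toLp_sq hT.le]
    exact hadm _ _ (hstrong n)
  -- By linearity the difference of two approximants is again a finite trajectory, so admissibility
  -- applies to it.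
  have hKsub : ∀ m n, ‖(hom m).toLp (o m) - (hom n).toLp (o n)‖ ^ 2 ≤ K * ‖Y m 0 - Y n 0‖ ^ 2 := by
    intro m n
    rw [← MemLp.toLp_sub, norm_toLp_sq hT.le]
    have h1 : ∀ t, (o m - o n) t = observe hL.le β
        (traj e l t (a m - a n), traj (fun i => l i • e i) l t (a m - a n)) := fun t => by
      rw [map_sub, map_sub, ← Prod.mk_sub_mk, map_sub]
      rfl
    have h2 : Y m 0 - Y n 0 = traj e l 0 (a m - a n) := (map_sub _ _ _).symm
    simp only [h1]
    rw [h2]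
    exact hadm _ _ (isStrongDualSolution_traj he T (a m - a n))
  have hcauchy : CauchySeq fun n => (hom n).toLp (o n) := by
    rw [Metric.cauchySeq_iff]
    intro ε hε
    obtain ⟨N, hN⟩ := Metric.cauchySeq_iff.1 hY0.cauchySeq (ε / (√|K| + 1)) (by positivity)
    refine ⟨N, fun m hm n hn => ?_⟩
    have h1 := hN m hm n hn
    rw [dist_eq_norm] at h1 ⊢
    have h2 : ‖(hom m).toLp (o m) - (hom n).toLp (o n)‖ ≤ √|K| * ‖Y m 0 - Y n 0‖ := by
      refine (sq_le_sq₀ (norm_nonneg _) (by positivity)).1 ((hKsub m n).trans ?_)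
      rw [mul_pow, Real.sq_sqrt (abs_nonneg K)]
      gcongr
      exact le_abs_self K
    calc _ ≤ √|K| * ‖Y m 0 - Y n 0‖ := h2
      _ ≤ (√|K| + 1) * ‖Y m 0 - Y n 0‖ := by gcongr; linarith
      _ < (√|K| + 1) * (ε / (√|K| + 1)) := by gcongr
      _ = ε := by field_simp
  obtain ⟨O, hO⟩ := cauchySeq_tendsto_of_complete hcauchy
  refine ⟨O, Lp.memLp O, ?_, ?_⟩
  · intro t ht
    -- On the graph `κ` gives the derivative of the third component, and it is bounded on all pairs.
    set κ : H0 L × H0 L →L[ℂ] L2 L := (volterraAdj hL.le ∘L mulOp β ∘L H0.fst1 L) ∘L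
      ContinuousLinearMap.fst ℂ _ _ - H0.deriv2 hL.le ∘L ContinuousLinearMap.snd ℂ _ _ with hκ
    have hsub : uIcc 0 t ⊆ Icc 0 T := by rw [uIcc_of_le ht.1]; exact Icc_subset_Icc_right ht.2
    have hXi : IntervalIntegrable X volume 0 t := (hXc.mono hsub).intervalIntegrable
    have hYi : ∀ n, IntervalIntegrable (Y n) volume 0 t := fun n => (hYc n).intervalIntegrable _ _
    have hPi : ∀ n, IntervalIntegrable (fun s => (Y n s, Y' n s)) volume 0 t := fun n =>
      ((hYc n).prodMk (hYc' n)).intervalIntegrable _ _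
    have hκi : ∀ n, IntervalIntegrable (fun s => κ (Y n s, Y' n s)) volume 0 t := fun n =>
      (κ.continuous.comp ((hYc n).prodMk (hYc' n))).intervalIntegrable _ _
    -- The integral of `Y'` is an increment of `Y`, so it converges even if `Y'` itself does not.
    have hpair : ∀ n, ∫ s in (0 : ℝ)..t, (Y n s, Y' n s) =
        (∫ s in (0 : ℝ)..t, Y n s, Y n t - Y n 0) := by
      intro n
      refine Prod.ext ?_ ?_
      · exact ((ContinuousLinearMap.fst ℂ (H0 L) (H0 L)).intervalIntegral_comp_comm (hPi n)).symm
      · refine ((ContinuousLinearMap.snd ℂ (H0 L) (H0 L)).intervalIntegral_comp_comm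
          (hPi n)).symm.trans ?_
        exact intervalIntegral.integral_eq_sub_of_hasDerivAt
          (fun s _ => hasDerivAt_traj e l (a n) s) ((hYc' n).intervalIntegrable _ _)
    have hYint : Filter.Tendsto (fun n => ∫ s in (0 : ℝ)..t, Y n s) Filter.atTop
        (nhds (∫ s in (0 : ℝ)..t, X s)) := by
      refine tendsto_iff_norm_sub_tendsto_zero.2 (squeeze_zero (fun _ => norm_nonneg _)
        (fun n => ?_) (by simpa only [zero_mul] using hδ.mul_const |t - 0|))
      rw [← intervalIntegral.integral_sub (hYi n) hXi]
      exact intervalIntegral.norm_integral_le_of_norm_le_const fun s hs =>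
        hYX n s (hsub (uIoc_subset_uIcc hs))
    have hP : Filter.Tendsto (fun n => κ (∫ s in (0 : ℝ)..t, (Y n s, Y' n s))) Filter.atTop
        (nhds (κ (∫ s in (0 : ℝ)..t, X s, X t - X 0))) := by
      simp only [hpair]
      exact (κ.continuous.tendsto _).comp (hYint.prodMk_nhds ((hYt t ht).sub hY0))
    have h3 : ∫ s in (0 : ℝ)..t, (X s).c3 =
        volterra hL.le (κ (∫ s in (0 : ℝ)..t, X s, X t - X 0)) := by
      refine ((H0.snd3 L).intervalIntegral_comp_comm hXi).trans
        (tendsto_nhds_unique (((H0.snd3 L).continuous.tendsto _).comp hYint) ?_)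
      refine (((volterra hL.le).continuous.tendsto _).comp hP).congr fun n => ?_
      simp only [Function.comp_apply]
      rw [← (H0.snd3 L).intervalIntegral_comp_comm (hYi n),
        ← κ.intervalIntegral_comp_comm (hPi n), ← (volterra hL.le).intervalIntegral_comp_comm
        (hκi n)]
      refine intervalIntegral.integral_congr fun s hs => ?_
      exact ((adjointRel_iff hL).1 ((hstrong n).eqn s (hsub hs))).2.1.symm
    have h4 : ∫ s in (0 : ℝ)..t, O s =
        inner ℂ (one L) (κ (∫ s in (0 : ℝ)..t, X s, X t - X 0)) := by
      refine tendsto_nhds_unique (tendsto_primitive hO ht)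
        ((tendsto_const_nhds.inner hP).congr fun n => ?_)
      rw [primitive_congr (hom n).coeFn_toLp ht]
      exact ((innerSL ℂ (one L) ∘L κ).intervalIntegral_comp_comm (hPi n)).symm
    rw [h3, h4]
    exact hasValueAtEnd_volterra hL.le _
  · have h1 := norm_toLp_sq hT.le (Lp.memLp O)
    rw [Lp.toLp_coeFn] at h1
    rw [← h1]
    exact le_of_tendsto_of_tendsto' (hO.norm.pow 2) ((hY0.norm.pow 2).const_mul K) hK

/-- Applied to `H¹₍₀₎`, this turns the velocity in `H⁻¹₍₀₎` into a second component in `ℋ⁰`.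
Functionals here are conjugate-linear, so they are conjugated before the Riesz theorem is used. -/
theorem exists_riesz (E : Type*) [NormedAddCommGroup E] [InnerProductSpace ℂ E] [CompleteSpace E] :
    ∃ R : (E →L⋆[ℂ] ℂ) → E, (∀ V φ, inner ℂ φ (R V) = V φ) ∧ (∀ V, ‖R V‖ ≤ ‖V‖) ∧
      Continuous R := by
  set R : (E →L⋆[ℂ] ℂ) → E := fun V => (InnerProductSpace.toDual ℂ E).symm
    ((starL ℂ : ℂ ≃L⋆[ℂ] ℂ).toContinuousLinearMap.comp V) with hR
  have h1 : ∀ V φ, inner ℂ φ (R V) = V φ := by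
    intro V φ
    rw [← inner_conj_symm, hR, InnerProductSpace.toDual_symm_apply]
    exact star_star (V φ)
  have h2 : ∀ (V : E →L⋆[ℂ] ℂ) (g : E), (∀ φ, inner ℂ φ g = V φ) → ‖g‖ ≤ ‖V‖ := by
    intro V g hg
    rcases eq_or_ne g 0 with h0 | h0
    · rw [h0, norm_zero]; exact norm_nonneg V
    have h := V.le_opNorm g
    rw [← hg, inner_self_eq_norm_sq_to_K, norm_pow] at h
    simp only [Complex.coe_algebraMap, Complex.norm_real, norm_norm] at h
    exact le_of_mul_le_mul_right (by rwa [sq] at h) (norm_pos_iff.2 h0)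
  refine ⟨R, h1, fun V => h2 V _ (h1 V), (LipschitzWith.mk_one fun V W => ?_).continuous⟩
  rw [dist_eq_norm, dist_eq_norm]
  exact h2 (V - W) _ fun φ => by rw [inner_sub_right, h1, h1]; rfl

/-! ### Weak solutions in Fourier coefficients -/

theorem isH2_sin (L ν : ℝ) : IsH2 L (fun x => (Real.sin (ν * x) : ℂ))
    (fun x => ν * (Real.cos (ν * x) : ℂ)) (fun x => -ν ^ 2 * (Real.sin (ν * x) : ℂ)) := by
  refine ⟨⟨(memLp_ofReal_continuous (by fun_prop)).const_mul _, fun x _ => ?_⟩,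
    ⟨(memLp_ofReal_continuous (by fun_prop)).const_mul _, fun x _ => ?_⟩⟩
  · rw [intervalIntegral.integral_const_mul]
    have := primitive_cos ν x
    rw [primitive] at this
    simp only [mul_zero, Real.sin_zero, Complex.ofReal_zero, zero_add, this]
  · rw [intervalIntegral.integral_const_mul]
    have := primitive_sin ν x
    rw [primitive] at this
    simp only [mul_zero, Real.cos_zero, Complex.ofReal_one]
    linear_combination (ν : ℂ) * this

theorem integral_mul_conj_sin (f : L2 L) (ν : ℝ) :
    ∫ x in Ioo 0 L, f x * conj ((Real.sin (ν * x) : ℝ) : ℂ) = inner ℂ (sinL L ν) f := by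
  rw [L2_inner_eq]
  refine integral_congr_ae ?_
  filter_upwards [sinL_ae L ν] with x hx
  rw [hx, mul_comm]

/-- A weak solution solves the equations for the Fourier coefficients, with `R` the Riesz map of
`H⁻¹₍₀₎(0, L)`. -/
theorem IsWeakDualSolution.isSpectralSolution (hL : 0 < L) {c : ℝ} {β : Lp ℝ ∞ (mu L)} {T : ℝ}
    {X1 X3 : ℝ → L2 L} {V : ℝ → Hm1 L} (h : IsWeakDualSolution L c β T X1 X3 V)
    {R : Hm1 L → H10 L} (hR : ∀ V φ, inner ℂ φ (R V) = V φ) :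
    IsSpectralSolution hL.le c β T
      fun t => H0.mk hL.le (X1 t) (H10.deriv L (R (V t))) (X3 t) where
  heat n t ht := by
    set ν := heatFreq L n with hν
    have h1 := h.heat _ _ _ (isH2_sin L ν) (by simp)
      (by rw [hν, sin_heatFreq hL, Complex.ofReal_zero]) t ht
    simp only [integral_mul_conj_sin] at h1
    refine h1.congr_deriv ?_
    rw [H0.mk_c1, ← integral_mul_conj_sin, ← integral_const_mul]
    refine integral_congr_ae (.of_forall fun x => ?_)
    simp only [map_add, map_mul, map_neg, map_pow, Complex.conj_ofReal]
    push_cast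
    ring
  wave n t ht := by
    set ν := waveFreq L n with hν
    have hν0 : (ν : ℂ) ≠ 0 := Complex.ofReal_ne_zero.2 (waveFreq_ne_zero hL n)
    -- This is `sin(νx)/ν`: its derivative is the cosine in the wave vector, and it satisfies the
    -- boundary conditions required of a test function.
    set φ : H10 L := H10.prim hL.le (cosL L ν) with hφ
    have hφ2 : H10.toL2 L φ = volterra hL.le (cosL L ν) := by
      rw [H10.toL2_eq hL.le, hφ, H10.deriv_prim]
    have hsin : sinL L ν = (ν : ℂ) • H10.toL2 L φ := by rw [hφ2, volterra_cosL]
    have hφ3 : H10.toL2 L φ = (ν : ℂ)⁻¹ • sinL L ν := by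
      rw [hsin, smul_smul, inv_mul_cancel₀ hν0, one_smul]
    have hae : H10.toL2 L φ =ᵐ[mu L] fun x => (ν : ℂ)⁻¹ * (Real.sin (ν * x) : ℂ) := by
      rw [hφ3]
      filter_upwards [Lp.coeFn_smul (ν : ℂ)⁻¹ (sinL L ν), sinL_ae L ν] with x h1 h2
      rw [h1, Pi.smul_apply, h2, smul_eq_mul]
    have h2 := isH2_sin L ν
    have hw := h.wave φ _ _ _ hae ⟨h2.1.smul (ν : ℂ)⁻¹, h2.2.smul (ν : ℂ)⁻¹⟩ (by simp)
      (by rw [hν, cos_waveFreq hL, Complex.ofReal_zero, mul_zero, mul_zero]) t ht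
    have hv := (h.velocity φ t ht).const_mul (Complex.I * ν)
    -- The Riesz property converts the pairing of the cosine with the second component into the
    -- velocity tested on `φ`, so the coefficient can be differentiated by the two weak equations.
    have hfun : ∀ s, inner ℂ (waveVec hL.le n) (H0.mk hL.le (X1 s) (H10.deriv L (R (V s))) (X3 s))
        = V s φ + Complex.I * ν * pivot L (X3 s) φ := by
      intro s
      have j1 : pivot L (X3 s) φ = inner ℂ (H10.toL2 L φ) (X3 s) := rfl
      rw [inner_waveVec, H0.mk_c2, H0.mk_c3, H10.deriv_prim, ← hR, H10.inner_eq, hφ,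
        H10.deriv_prim, ← hν, ← hφ, j1, hsin, inner_smul_left, Complex.conj_ofReal]
      ring
    have hder : ∫ x in Ioo 0 L, (X3 t x * conj ((ν : ℂ)⁻¹ * (-ν ^ 2 * (Real.sin (ν * x) : ℂ))) +
        (β x : ℂ) * X1 t x * conj ((ν : ℂ)⁻¹ * (Real.sin (ν * x) : ℂ))) =
        -(ν : ℂ) * inner ℂ (sinL L ν) (X3 t) +
          inner ℂ (H10.toL2 L φ) (mulOp β (X1 t)) := by
      have j1 : inner ℂ ((-(ν : ℂ)) • sinL L ν) (X3 t) = -(ν : ℂ) * inner ℂ (sinL L ν) (X3 t) := by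
        rw [inner_smul_left, map_neg, Complex.conj_ofReal]
      rw [← j1, L2_inner_eq, L2_inner_eq, ← integral_add]
      · refine integral_congr_ae ?_
        filter_upwards [hae, mulOp_ae β (X1 t), Lp.coeFn_smul (-(ν : ℂ)) (sinL L ν), sinL_ae L ν]
          with x h1 h2 h3 h4
        rw [h1, h2, h3, Pi.smul_apply, h4]
        simp only [smul_eq_mul, map_mul, map_neg, map_pow, map_inv₀, Complex.conj_ofReal]
        field_simp
      · simpa only [RCLike.inner_apply, mul_comm] using
          L2.integrable_inner (𝕜 := ℂ) ((-(ν : ℂ)) • sinL L ν) (X3 t)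
      · simpa only [RCLike.inner_apply, mul_comm] using
          L2.integrable_inner (𝕜 := ℂ) (H10.toL2 L φ) (mulOp β (X1 t))
    rw [hder] at hw
    simp only [hfun]
    refine (hw.add hv).congr_deriv ?_
    have j1 : pivot L (X3 t) φ = inner ℂ (H10.toL2 L φ) (X3 t) := rfl
    rw [H0.mk_c1, ← hφ2, j1, hsin, inner_smul_left, Complex.conj_ofReal]
    linear_combination -(ν : ℂ) ^ 2 * inner ℂ (H10.toL2 L φ) (X3 t) * Complex.I_mul_I

theorem H0.continuousOn_mk (hL : 0 ≤ L) {s : Set ℝ} {f p h : ℝ → L2 L} (hf : ContinuousOn f s)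
    (hp : ContinuousOn p s) (hh : ContinuousOn h s) :
    ContinuousOn (fun t => H0.mk hL (f t) (p t) (h t)) s := by
  refine (WithLp.prod_continuous_toLp 2 _ _).comp_continuousOn (hf.prodMk
    ((WithLp.prod_continuous_toLp 2 _ _).comp_continuousOn (ContinuousOn.prodMk ?_ hh)))
  exact (H10.derivEquiv hL).symm.continuous.comp_continuousOn hp

/-- The Riesz map does not increase norms, so the bound in `‖X 0‖` becomes one in the `H⁻¹₍₀₎` norm
of the initial velocity with the same constant. -/
theorem IsWeakDualSolution.exists_boundaryTrace (hL : 0 < L) {c : ℝ} {β : Lp ℝ ∞ (mu L)}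
    {T K : ℝ} (hT : 0 < T) (hK : 0 < K)
    (hadm : ∀ X X' : ℝ → H0 L, IsStrongDualSolution L c β T X X' →
      ∫ t in (0 : ℝ)..T, ‖observe hL.le β (X t, X' t)‖ ^ 2 ≤ K * ‖X 0‖ ^ 2)
    {X1 X3 : ℝ → L2 L} {V : ℝ → Hm1 L} (h : IsWeakDualSolution L c β T X1 X3 V) :
    ∃ o : ℝ → ℂ, MemLp o 2 (mu T) ∧ IsBoundaryTrace L T X3 o ∧
      ∫ t in (0 : ℝ)..T, ‖o t‖ ^ 2 ≤ K * (‖X1 0‖ ^ 2 + ‖X3 0‖ ^ 2 + ‖V 0‖ ^ 2) := by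
  have := H10.completeSpace hL.le
  obtain ⟨R, hR, hRV, hRc⟩ := exists_riesz (H10 L)
  have hc : ContinuousOn (fun t => H0.mk hL.le (X1 t) (H10.deriv L (R (V t))) (X3 t))
      (Icc 0 T) := H0.continuousOn_mk hL.le h.cont1
    ((H10.derivEquiv hL.le).continuous.comp_continuousOn (hRc.comp_continuousOn h.contV)) h.cont3
  obtain ⟨o, ho, htr, hle⟩ :=
    (h.isSpectralSolution hL hR).exists_boundaryTrace hL hT hadm hc
  refine ⟨o, ho, htr, hle.trans ?_⟩
  rw [H0.norm_sq_eq, H0.mk_c1, H0.mk_c2, H0.mk_c3, H10.prim_deriv]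
  have h2 : ‖R (V 0)‖ ^ 2 ≤ ‖V 0‖ ^ 2 := pow_le_pow_left₀ (norm_nonneg _) (hRV _) 2
  refine mul_le_mul_of_nonneg_left ?_ hK.le
  linarith

end Cascade

end

theorem mainTheorem9 (L : ℝ) (hL : 0 < L) (c : ℝ)
    (β : MeasureTheory.Lp ℝ ⊤ (Cascade.mu L)) :
    (∀ T : ℝ, 0 < T → ∃ K : ℝ, 0 < K ∧
      (∀ (X1 X3 : ℝ → Cascade.L2 L) (V : ℝ → Cascade.Hm1 L),
        Cascade.IsWeakDualSolution L c β T X1 X3 V →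
        ∃ o : ℝ → ℂ, MeasureTheory.MemLp o 2 (Cascade.mu T) ∧
          Cascade.IsBoundaryTrace L T X3 o ∧
          ∫ t in (0 : ℝ)..T, ‖o t‖ ^ 2 ≤ K * (‖X1 0‖ ^ 2 + ‖X3 0‖ ^ 2 + ‖V 0‖ ^ 2)) ∧
      (∀ X X' : ℝ → Cascade.H0 L, Cascade.IsStrongDualSolution L c β T X X' →
        ∃ o : ℝ → ℂ, ContinuousOn o (Set.Icc 0 T) ∧
          (∀ t ∈ Set.Icc 0 T, Cascade.HasValueAtEnd L (X t).c3 (o t)) ∧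
          ∫ t in (0 : ℝ)..T, ‖o t‖ ^ 2 ≤
            K * (‖(X 0).c1‖ ^ 2 + ‖(X 0).c3‖ ^ 2 + ‖Cascade.pivot L (X' 0).c3‖ ^ 2))) ∧
    Cascade.WellPosed L c β := by
  refine ⟨fun T hT => ?_, Cascade.wellPosed hL c β⟩
  obtain ⟨K, hK, hadm⟩ := Cascade.exists_admissible hL c β hT
  exact ⟨K, hK, fun X1 X3 V h => h.exists_boundaryTrace hL hT hK hadm,
    fun X X' h => h.trace hL hT hK hadm⟩
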